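/- **Theorem (the degenerate toric variety of a flag variety is $X(n,r_1,\dots,r_\rho)$).** Let $\rho\ge 1$ and $n>r_1>\dots>r_\rho>0$ be integers, and put $k_i=n-r_i$. We work over $\mathbb{C}$. *The Gelfand–Cetlin degenerate toric variety of $\mathrm{Fl}(n;r_1,\dots,r_\rho)$.* Let $(x_{ij})$ be a generic $k_\rho\times n$ matrix. The Plücker coordinates of $\mathrm{Fl}(n;r_1,\dots,r_\rho)$ are the top-aligned minors of $(x_{ij})$ of sizes $k_1,\dots,k_\rho$ (a minor of size $k_i$ uses the first $k_i$ rows and any $k_i$ columns). For the lexicographic order with $x_{11}>x_{12}>\dots>x_{1n}>x_{21}>\cdots$, take the initial terms of these minors. They define a morphism from the torus $(\mathbb{C}^*)^{k_\rho\times n}$ to $\prod_{i=1}^{\rho}\mathbb{P}^{\binom{n}{k_i}-1}$, and the degenerate toric variety $Y(n,r_1,\dots,r_\rho)$ is the closure of its image. *The toric variety $X(n,r_1,\dots,r_\rho)$.* The ladder diagram is the union in the plane, for $i=1,\dots,\rho$, of the $k_i\times r_i$ grids of unit squares (width $k_i$, height $r_i$) with bottom left corner $(0,0)$. Its vertices are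 $(0,0)$, the points $(k_i,r_i)$, the lattice points in the interior of each of the grids, and the points $(k_{i-1},r_i)$ for $i>1$. The ladder quiver has these vertices; its arrows from $v$ to $w$ are the lattice paths from $v$ to $w$ along edges of the diagram, going only up and to the right, which pass through no vertex strictly between $v$ and $w$. Assign dimension $1$ to each vertex. Let $K$ be the torus $\prod_{v\ne(0,0)}\mathbb{C}^*$, let $e_v$ $(v\neq(0,0))$ be the standard basis of its character lattice, and set $e_{(0,0)}=0$. Then $K$ acts on $\mathbb{C}^{\{\text{arrows}\}}$ with weight $D_a=e_w-e_v$ on the coordinate of an arrow $a:v\to w$. With the anticanonical stability condition $\theta=\sum_a D_a$, let $$X(n,r_1,\dots,r_\rho)=\mathbb{C}^{\{\text{arrows}\}}/\!/_{\theta}\,K=\operatorname{Proj}\bigoplus_{m\ge0}\mathbb{C}[z_a : a \text{ an arrow}]_{m\theta},$$ where $\mathbb{C}[z_a]_{m\theta}$ is the space of polynomials $f$ with $f(g\cdot z)=\theta(g)^m f(z)$ for all $g\in K$. Then $Y(n,r_1,\dots,r_\rho)$ and $X(n,r_1,\dots,r_\rho)$ are isomorphic over $\mathbb{C}$. -/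

import Mathlib

noncomputable section

open CategoryTheory CategoryTheory.Limits AlgebraicGeometry

namespace LadderToric

/-! ## Projective spectra over the complex numbers -/

/-- `Proj` of a graded `ℂ`-algebra, as a scheme over `Spec ℂ`. -/
def projOver {A : Type} [CommRing A] [Algebra ℂ A] (𝒜 : ℕ → Submodule ℂ A) [GradedAlgebra 𝒜] :
    Over (Spec (.of ℂ)) :=
  Over.mk (Proj.toSpecZero 𝒜 ≫ Spec.map (CommRingCat.ofHom (algebraMap ℂ (𝒜 0))))

section ProjectiveSpace

attribute [local instance] MvPolynomial.gradedAlgebra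

/-- The projective space over `ℂ` with homogeneous coordinates indexed by `N`. -/
def projectiveSpace (N : Type) : Over (Spec (.of ℂ)) :=
  projOver (MvPolynomial.homogeneousSubmodule N ℂ)

/-! ## Toric subvarieties of products of projective spaces given by monomials -/

/-- The ring of Laurent polynomials in variables indexed by `ι`. -/
abbrev Laurent (ι : Type) : Type := AddMonoidAlgebra ℂ (ι →₀ ℤ)

/-- The monomial with exponents `d`, as a Laurent polynomial. -/
def laurentMonomial {ι : Type} (d : ι →₀ ℕ) : Laurent ι :=
  AddMonoidAlgebra.single (d.mapRange (fun m : ℕ => (m : ℤ)) Nat.cast_zero) 1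

theorem isUnit_laurentMonomial {ι : Type} (d : ι →₀ ℕ) : IsUnit (laurentMonomial d) := by
  refine IsUnit.of_mul_eq_one
    (AddMonoidAlgebra.single (-(d.mapRange (fun m : ℕ => (m : ℤ)) Nat.cast_zero)) 1) ?_
  rw [laurentMonomial, AddMonoidAlgebra.single_mul_single, add_neg_cancel, mul_one]
  rfl

/-- The torus `(ℂ^*)^ι`. -/
def torus (ι : Type) : Over (Spec (.of ℂ)) :=
  Over.mk (Spec.map (CommRingCat.ofHom (algebraMap ℂ (Laurent ι))))

/-- The substitution sending the `a`-th homogeneous coordinate to the monomial with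
exponents `d a`. -/
def monomialSubst {ι N : Type} (d : N → ι →₀ ℕ) : MvPolynomial N ℂ →+* Laurent ι :=
  (MvPolynomial.aeval (R := ℂ) fun a => laurentMonomial (d a)).toRingHom

/-- The substitution, with values in the global functions on the torus. -/
def monomialSections {ι N : Type} (d : N → ι →₀ ℕ) :
    MvPolynomial N ℂ →+* Γ((torus ι).left, ⊤) :=
  (Scheme.ΓSpecIso (.of (Laurent ι))).inv.hom.comp (monomialSubst d)

theorem map_irrelevant_monomialSections {ι N : Type} [Nonempty N] (d : N → ι →₀ ℕ) :
    (HomogeneousIdeal.irrelevant (MvPolynomial.homogeneousSubmodule N ℂ)).toIdeal.map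
      (monomialSections d) = ⊤ := by
  obtain ⟨a⟩ := ‹Nonempty N›
  refine Ideal.eq_top_of_isUnit_mem _ (x := monomialSections d (MvPolynomial.X a))
    (Ideal.mem_map_of_mem _ ?_) ?_
  · change _ ∈ HomogeneousIdeal.irrelevant (MvPolynomial.homogeneousSubmodule N ℂ)
    rw [HomogeneousIdeal.mem_irrelevant_iff, GradedRing.proj_apply,
      DirectSum.decompose_of_mem_ne (MvPolynomial.homogeneousSubmodule N ℂ)
        (i := 1) (j := 0) (MvPolynomial.isHomogeneous_X ℂ a) one_ne_zero]
  · have h : IsUnit (monomialSubst d (MvPolynomial.X a)) := by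
      simpa [monomialSubst] using isUnit_laurentMonomial (d a)
    exact h.map (Scheme.ΓSpecIso (.of (Laurent ι))).inv.hom

/-- The morphism from the torus `(ℂ^*)^ι` to the projective space with coordinates indexed by `N`
given by the monomials with exponents `d a`, `a ∈ N`. -/
def monomialMap {ι N : Type} [Nonempty N] (d : N → ι →₀ ℕ) : torus ι ⟶ projectiveSpace N :=
  Over.homMk (Proj.fromOfGlobalSections (MvPolynomial.homogeneousSubmodule N ℂ)
    (monomialSections d) (map_irrelevant_monomialSections d)) (by
    have h : CommRingCat.ofHom (algebraMap ℂ (MvPolynomial.homogeneousSubmodule N ℂ 0)) ≫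
        CommRingCat.ofHom ((monomialSections d).comp
          (algebraMap (MvPolynomial.homogeneousSubmodule N ℂ 0) (MvPolynomial N ℂ))) =
        CommRingCat.ofHom (algebraMap ℂ (Laurent ι)) ≫
          (Scheme.ΓSpecIso (.of (Laurent ι))).inv := by
      ext c
      exact congrArg (Scheme.ΓSpecIso (.of (Laurent ι))).inv.hom
        ((MvPolynomial.aeval (R := ℂ) fun a => laurentMonomial (d a)).commutes c)
    refine (Proj.fromOfGlobalSections_toSpecZero_assoc _ _ _ _).trans ?_
    refine (congrArg (fun t => (torus ι).left.toSpecΓ ≫ t)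
      ((Spec.map_comp _ _).symm.trans ((congrArg Spec.map h).trans (Spec.map_comp _ _)))).trans ?_
    exact toSpecΓ_SpecMap_ΓSpecIso_inv_assoc _ _)

end ProjectiveSpace

instance : HasFiniteProducts (Over (Spec (.of ℂ))) :=
  Over.ConstructProducts.over_finiteProducts_of_finiteWidePullbacks

/-- The morphism from the torus `(ℂ^*)^ι` to the product over `i` of the projective spaces with
coordinates indexed by `N i`, given by the monomials with exponents `d i a`, `a ∈ N i`. -/
def multiMonomialMap {ι : Type} {k : ℕ} {N : Fin k → Type} [∀ i, Nonempty (N i)]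
    (d : ∀ i, N i → ι →₀ ℕ) : torus ι ⟶ ∏ᶜ fun i => projectiveSpace (N i) :=
  Pi.lift fun i => monomialMap (d i)

/-- The closed subvariety of the product of projective spaces which is the closure
(scheme-theoretic image) of the image of the torus under `multiMonomialMap`. -/
def monomialClosure {ι : Type} {k : ℕ} {N : Fin k → Type} [∀ i, Nonempty (N i)]
    (d : ∀ i, N i → ι →₀ ℕ) : Over (Spec (.of ℂ)) :=
  Over.mk ((multiMonomialMap d).left.imageι ≫ (∏ᶜ fun i => projectiveSpace (N i)).hom)

/-! ## The degenerate toric variety of a flag variety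

For `n > r_1 > ⋯ > r_ρ > 0` put `k_i = n - r_i`. The Plücker coordinates of the flag variety
`Fl(n; r_1, …, r_ρ)` are the top-aligned minors of sizes `k_1, …, k_ρ` of a generic `k_ρ × n`
matrix. -/

section Flag

variable (n : ℕ) {ρ : ℕ} (r : Fin ρ → ℕ)

/-- The number of rows of the generic matrix: the largest of the `k_i = n - r_i`. -/
def numRows : ℕ := Finset.univ.sup fun i => n - r i

theorem le_numRows (i : Fin ρ) : n - r i ≤ numRows n r :=
  Finset.le_sup (f := fun i => n - r i) (Finset.mem_univ i)

/-- The positions `(i, j)` of the variables `x_{ij}`, ordered row by row. -/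
abbrev Entry : Type := Fin (numRows n r) ×ₗ Fin n

/-- The generic matrix `(x_{ij})`. -/
def genericMatrix : Matrix (Fin (numRows n r)) (Fin n) (MvPolynomial (Entry n r) ℂ) :=
  Matrix.of fun i j => MvPolynomial.X (toLex (i, j))

/-- The sets of `k_i = n - r_i` columns, listed increasingly. They index the Plücker coordinates of
the `i`-th factor. -/
abbrev Columns (i : Fin ρ) : Type := Fin (n - r i) ↪o Fin n

instance (i : Fin ρ) : Nonempty (Columns n r i) := ⟨Fin.castLEOrderEmb (Nat.sub_le n (r i))⟩

/-- The top-aligned minor of size `k_i` in the given columns. -/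
def topMinor (i : Fin ρ) (σ : Columns n r i) : MvPolynomial (Entry n r) ℂ :=
  ((genericMatrix n r).submatrix (Fin.castLE (le_numRows n r i)) σ).det

/-- The exponent of the initial term of a top-aligned minor, for the lexicographic order with
`x_{11} > x_{12} > ⋯ > x_{1n} > x_{21} > ⋯`. -/
def initialExponent (i : Fin ρ) (σ : Columns n r i) : Entry n r →₀ ℕ :=
  (MonomialOrder.lex (σ := Entry n r)).degree (topMinor n r i σ)

/-- The degenerate toric variety of the flag variety `Fl(n; r_1, …, r_ρ)`: the toric subvariety of
the product of the Plücker projective spaces parametrised by the initial terms of the Plücker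
coordinates. -/
def degenerateFlagVariety : Over (Spec (.of ℂ)) :=
  monomialClosure (ι := Entry n r) (N := Columns n r) (initialExponent n r)

end Flag

/-! ## Toric GIT quotients -/

section GIT

variable {I E : Type} [Fintype I]

/-- The value at `g` of the character `g ↦ ∏ g_v ^ (w v)` of the torus `(ℂ^*)^I`. -/
def character (w : I → ℤ) (g : I → ℂˣ) : ℂˣ := ∏ v, g v ^ w v

/-- The action of `g` on polynomial functions on `ℂ^E` induced by
`(g · x)_a = character (D a) g * x_a`. -/
def actOn (D : E → I → ℤ) (g : I → ℂˣ) : MvPolynomial E ℂ →ₐ[ℂ] MvPolynomial E ℂ :=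
  MvPolynomial.aeval fun a =>
    MvPolynomial.C (character (D a) g : ℂ) * MvPolynomial.X a

/-- The polynomial functions `f` on `ℂ^E` with `f (g · x) = θ(g)^m * f x` for all `g`. -/
def semiInvariants (D : E → I → ℤ) (θ : I → ℤ) (m : ℕ) : Submodule ℂ (MvPolynomial E ℂ) where
  carrier := {f | ∀ g, actOn D g f = ((character θ g : ℂ) ^ m) • f}
  zero_mem' g := by simp
  add_mem' hf hf' g := by rw [map_add, hf g, hf' g, smul_add]
  smul_mem' c f hf g := by rw [map_smul, hf g, smul_comm]

/-- The ring `⨁_{m ≥ 0} (semi-invariants of weight θ^m)`, as the ring of polynomials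
`∑ f_m z^m` with `f_m` semi-invariant of weight `θ^m`. -/
def semiInvariantRing (D : E → I → ℤ) (θ : I → ℤ) :
    Subalgebra ℂ (Polynomial (MvPolynomial E ℂ)) where
  carrier := {F | ∀ m, F.coeff m ∈ semiInvariants D θ m}
  mul_mem' {F G} hF hG m g := by
    rw [Polynomial.coeff_mul, map_sum, Finset.smul_sum]
    refine Finset.sum_congr rfl fun p hp => ?_
    rw [map_mul, hF p.1 g, hG p.2 g, smul_mul_smul_comm, ← pow_add,
      Finset.HasAntidiagonal.mem_antidiagonal.mp hp]
  add_mem' {F G} hF hG m := by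
    rw [Polynomial.coeff_add]
    exact add_mem (hF m) (hG m)
  algebraMap_mem' c m := by
    rw [Polynomial.algebraMap_apply, Polynomial.coeff_C]
    split_ifs with h
    · subst h
      intro g
      rw [AlgHom.commutes, pow_zero, one_smul]
    · exact zero_mem _

/-- The part of degree `m`: the elements `f_m z^m`. -/
def semiInvariantGrading (D : E → I → ℤ) (θ : I → ℤ) (m : ℕ) :
    Submodule ℂ (semiInvariantRing D θ) where
  carrier := {F | ∀ l, l ≠ m → (F : Polynomial (MvPolynomial E ℂ)).coeff l = 0}
  zero_mem' l _ := by simp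
  add_mem' {F G} hF hG l hl := by simp [hF l hl, hG l hl]
  smul_mem' c F hF l hl := by simp [hF l hl]

/-- The component of degree `m`. -/
def semiInvariantComponent (D : E → I → ℤ) (θ : I → ℤ) (F : semiInvariantRing D θ) (m : ℕ) :
    semiInvariantGrading D θ m :=
  ⟨⟨Polynomial.monomial m ((F : Polynomial (MvPolynomial E ℂ)).coeff m), fun l => by
      rw [Polynomial.coeff_monomial]
      split_ifs with h
      · exact h ▸ F.2 m
      · exact zero_mem _⟩,
    fun l hl => by simp [Polynomial.coeff_monomial, hl.symm]⟩

theorem coeff_coeAddMonoidHom (D : E → I → ℤ) (θ : I → ℤ)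
    (x : DirectSum ℕ fun m => semiInvariantGrading D θ m) (m : ℕ) :
    (DirectSum.coeAddMonoidHom (semiInvariantGrading D θ) x :
      Polynomial (MvPolynomial E ℂ)).coeff m =
      ((x m : semiInvariantRing D θ) : Polynomial (MvPolynomial E ℂ)).coeff m := by
  induction x using DirectSum.induction_on with
  | zero => simp
  | of p F =>
    rw [DirectSum.coeAddMonoidHom_of]
    by_cases h : p = m
    · subst h
      rw [DirectSum.of_eq_same]
    · rw [DirectSum.of_eq_of_ne _ _ _ (Ne.symm h), F.2 m (Ne.symm h)]
      rfl
  | add x y hx hy => simp [hx, hy]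

instance (D : E → I → ℤ) (θ : I → ℤ) : GradedAlgebra (semiInvariantGrading D θ) where
  one_mem l hl := by simp [Polynomial.coeff_one, hl]
  mul_mem {p q} F G hF hG l hl := by
    rw [MulMemClass.coe_mul, Polynomial.coeff_mul]
    refine Finset.sum_eq_zero fun x hx => ?_
    by_cases h1 : x.1 = p
    · have h2 : x.2 ≠ q := by
        rintro rfl
        exact hl (by rw [← Finset.HasAntidiagonal.mem_antidiagonal.mp hx, h1])
      rw [hG _ h2, mul_zero]
    · rw [hF _ h1, zero_mul]
  decompose' F := DirectSum.mk (fun m => semiInvariantGrading D θ m)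
    (F : Polynomial (MvPolynomial E ℂ)).support fun m => semiInvariantComponent D θ F m
  left_inv F := by
    refine Subtype.ext (Polynomial.ext fun m => ?_)
    rw [coeff_coeAddMonoidHom]
    by_cases h : m ∈ (F : Polynomial (MvPolynomial E ℂ)).support
    · rw [DirectSum.mk_apply_of_mem h]
      simp [semiInvariantComponent]
    · rw [DirectSum.mk_apply_of_notMem h, Polynomial.notMem_support_iff.mp h]
      rfl
  right_inv x := by
    refine DirectSum.ext_iff.mpr fun m => Subtype.ext (Subtype.ext (Polynomial.ext fun l => ?_))
    by_cases hl : l = m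
    · subst hl
      by_cases h : l ∈ (DirectSum.coeAddMonoidHom (semiInvariantGrading D θ) x :
          Polynomial (MvPolynomial E ℂ)).support
      · rw [DirectSum.mk_apply_of_mem h]
        simp [semiInvariantComponent, coeff_coeAddMonoidHom]
      · rw [DirectSum.mk_apply_of_notMem h, ← coeff_coeAddMonoidHom,
          Polynomial.notMem_support_iff.mp h]
        rfl
    · have h : ∀ y : semiInvariantGrading D θ m,
          ((y : semiInvariantRing D θ) : Polynomial (MvPolynomial E ℂ)).coeff l = 0 :=
        fun y => y.2 l hl
      exact (h _).trans (h _).symm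

/-- The toric GIT quotient `ℂ^E //_θ (ℂ^*)^I`, where the torus acts on the `a`-th coordinate with
weight `D a`: the `Proj` of the ring of semi-invariants. -/
def toricGIT (D : E → I → ℤ) (θ : I → ℤ) : Over (Spec (.of ℂ)) :=
  projOver (A := semiInvariantRing D θ) (semiInvariantGrading D θ)

end GIT

/-! ## The ladder quiver -/

section Ladder

variable (n : ℕ) {ρ : ℕ} (r : Fin ρ → ℕ)

/-- Lattice points `(x, y)` with `0 ≤ x, y ≤ n`. -/
abbrev Pt : Type := Fin (n + 1) × Fin (n + 1)

/-- The ladder diagram is the union over `i` of the `(n - r_i) × r_i` grids of unit squares with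
bottom left corner `(0,0)`. `Step n r p q` says that the diagram has an edge of a unit square
going from `p` up or to the right to `q`. -/
def Step (p q : Pt n) : Prop :=
  ((q.1.val = p.1.val + 1 ∧ q.2.val = p.2.val) ∨ (q.1.val = p.1.val ∧ q.2.val = p.2.val + 1)) ∧
    ∃ i, q.1.val ≤ n - r i ∧ q.2.val ≤ r i

/-- The vertices of the ladder diagram: the origin, the top right corner `(n - r_i, r_i)` and the
interior lattice points of each of the grids, and the points `(n - r_{i-1}, r_i)` where
the boundaries of consecutive grids cross. -/
def IsVertex (p : Pt n) : Prop :=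
  (p.1.val = 0 ∧ p.2.val = 0) ∨
  (∃ i, p.1.val = n - r i ∧ p.2.val = r i) ∨
  (∃ i, 1 ≤ p.1.val ∧ p.1.val < n - r i ∧ 1 ≤ p.2.val ∧ p.2.val < r i) ∨
  (∃ i j : Fin ρ, i.val + 1 = j.val ∧ p.1.val = n - r i ∧ p.2.val = r j)

/-- The vertices of the ladder quiver. -/
abbrev Vertex : Type := {p : Pt n // IsVertex n r p}

/-- The source vertex `(0,0)`. -/
def origin : Vertex n r := ⟨(0, 0), Or.inl ⟨rfl, rfl⟩⟩

/-- The arrows of the ladder quiver: the paths in the ladder diagram, going up and to the right,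
from a vertex to the next vertex on the path. -/
@[ext]
structure Arrow where
  /-- the source -/
  src : Vertex n r
  /-- the lattice points strictly between source and target -/
  mid : List (Pt n)
  /-- the target -/
  tgt : Vertex n r
  /-- consecutive points are joined by edges of the diagram -/
  isChain : (src.1 :: (mid ++ [tgt.1])).IsChain (Step n r)
  /-- no vertex is passed on the way -/
  avoid : ∀ p ∈ mid, ¬ IsVertex n r p

/-- The sum of the coordinates. -/
def Pt.height (p : Pt n) : ℕ := p.1.val + p.2.val

theorem Arrow.nodup_mid (a : Arrow n r) : a.mid.Nodup := by
  have h : (a.mid.map (Pt.height n)).IsChain (· < ·) := by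
    have h1 : a.mid.IsChain (Step n r) := a.isChain.tail.left_of_append
    rw [List.isChain_map]
    refine h1.imp fun p q hpq => ?_
    have := hpq.1
    simp only [Pt.height]
    omega
  exact List.Nodup.of_map _ h.pairwise.nodup

instance : Finite (Arrow n r) := by
  classical
  refine Finite.of_injective
    (β := Vertex n r × {l : List (Pt n) // l.Nodup} × Vertex n r)
    (fun a => (a.src, ⟨a.mid, a.nodup_mid⟩, a.tgt)) fun a b h => ?_
  simp only [Prod.mk.injEq, Subtype.mk.injEq] at h
  exact Arrow.ext h.1 h.2.1 h.2.2

/-- The vertices other than the source. They index the factors of the torus, which is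
the quotient by the diagonal `ℂ^*` of the product of one `ℂ^*` for each vertex. -/
abbrev Node : Type := {v : Vertex n r // v ≠ origin n r}

open Classical in
instance : Fintype (Node n r) := Fintype.ofFinite _

instance : Fintype (Arrow n r) := Fintype.ofFinite _

open Classical in
/-- The weight `- e_{s(a)} + e_{t(a)}` of an arrow, where `e_v` is the standard basis vector of a
vertex `v` other than the source, and zero for the source. -/
def arrowWeight (a : Arrow n r) (v : Node n r) : ℤ :=
  (if a.tgt = v.1 then 1 else 0) - (if a.src = v.1 then 1 else 0)

/-- The anticanonical stability condition: the sum of all weights. -/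
def anticanonical (v : Node n r) : ℤ := ∑ a : Arrow n r, arrowWeight n r a v

/-- The toric variety `X(n, r_1, …, r_ρ)`. -/
def ladderVariety : Over (Spec (.of ℂ)) :=
  toricGIT (arrowWeight n r) (anticanonical n r)

end Ladder

end LadderToric

end

/-! A monomial z^u is semi-invariant of weight θ^m exactly when u, read as multiplicities on the
arrows, is a flow whose net inflow at every vertex other than the origin equals mθ
(`mem_semiInvariants_iff`). At a vertex from which the diagram continues both right and up, two
arrows enter and two leave, so θ vanishes there. Every remaining vertex except the origin is a
corner (k_i, r_i); arrows only enter it, so θ takes a value c_i > 0 there (`cornerDegree`). A flow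
of weight mθ therefore splits into paths from the origin, with m c_i of them ending at the i-th
corner (`exists_paths_of_netInflow_nonneg`).

A path to (k_i, r_i) has n steps, and the times of its k_i right steps form a set of columns. The
lexicographic initial term of a minor is its diagonal term (`initialExponent_eq`). Hence, if a right
step from (x, y) contributes the variable in row x and column x + y, the paths to the i-th corner
become exactly the initial terms of the Plücker coordinates of the i-th factor. Substituting these
monomials for the arrows maps the semi-invariants of degree m onto the span of the products of m c_i
initial terms from each factor i.

The substitution is injective in each degree. The exponent gives the flow through every horizontal
edge; conservation then gives it through the vertical edges; and each arrow has an edge lying on no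
other arrow (`Arrow.exists_critical`, `Arrow.eq_of_critical`), whose flow recovers the multiplicity
of the arrow.

So the graded ring has in degree m the monomials of multidegree (m c_1, …, m c_ρ) on the torus
closure, with all c_i positive (`MonomialModel`). This forces its `Proj` to be that closure
(`ToricAtlas.nonempty_iso`). For each choice p of one coordinate per factor there is a chart whose
ring is generated by the ratios of the coordinates to those of p. The charts glue to a closed
immersion into the product of projective spaces; the source is reduced and the torus is dense in it,
so it is the scheme-theoretic image of the torus. -/

noncomputable section

open CategoryTheory CategoryTheory.Limits AlgebraicGeometry

namespace LadderToric

/-! ## Evaluation of degree zero fractions and maps to projective spectra -/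

section AwayEval

variable {A B C : Type} [CommRing A] [CommRing B] [CommRing C] [Algebra ℂ A]

/-- Evaluation of the degree zero fractions with denominators powers of `t` along a ring
homomorphism under which `t` becomes invertible. -/
def awayEval (𝒜 : ℕ → Submodule ℂ A) [GradedAlgebra 𝒜] (h : A →+* B) (t : A)
    (ht : IsUnit (h t)) : HomogeneousLocalization.Away 𝒜 t →+* B :=
  (IsLocalization.Away.lift (S := Localization.Away t) t ht).comp
    (algebraMap (HomogeneousLocalization.Away 𝒜 t) (Localization.Away t))

variable (𝒜 : ℕ → Submodule ℂ A) [GradedAlgebra 𝒜]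

theorem awayEval_mk_mul (h : A →+* B) (t : A) (ht : IsUnit (h t)) {m : ℕ} (htm : t ∈ 𝒜 m)
    (l : ℕ) (x : A) (hx : x ∈ 𝒜 (l • m)) :
    awayEval 𝒜 h t ht (HomogeneousLocalization.Away.mk 𝒜 htm l x hx) * h t ^ l = h x := by
  have key := IsLocalization.mk'_spec (Localization.Away t) x
    (⟨t ^ l, l, rfl⟩ : Submonoid.powers t)
  rw [awayEval, RingHom.comp_apply, HomogeneousLocalization.algebraMap_apply,
    HomogeneousLocalization.Away.val_mk, Localization.mk_eq_mk', ← map_pow h,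
    ← IsLocalization.Away.lift_eq (S := Localization.Away t) t ht (t ^ l), ← map_mul, key,
    IsLocalization.Away.lift_eq]

theorem eq_awayEval (h : A →+* B) (t : A) (ht : IsUnit (h t)) {m : ℕ} (htm : t ∈ 𝒜 m)
    (φ : HomogeneousLocalization.Away 𝒜 t →+* B)
    (hφ : ∀ (l : ℕ) (x : A) (hx : x ∈ 𝒜 (l • m)),
      φ (HomogeneousLocalization.Away.mk 𝒜 htm l x hx) * h t ^ l = h x) :
    φ = awayEval 𝒜 h t ht := by
  ext z
  obtain ⟨l, x, hx, rfl⟩ := HomogeneousLocalization.Away.mk_surjective 𝒜 htm z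
  refine (ht.pow l).mul_right_cancel ?_
  rw [hφ, awayEval_mk_mul]

/-- The numerator of a degree zero fraction is homogeneous, so injectivity of `h` is only needed in
each degree separately. -/
theorem awayEval_injective (h : A →+* B) (t : A) (ht : IsUnit (h t)) {m : ℕ} (htm : t ∈ 𝒜 m)
    (hinj : ∀ (l : ℕ) (x : A), x ∈ 𝒜 l → h x = 0 → x = 0) :
    Function.Injective (awayEval 𝒜 h t ht) := by
  rw [injective_iff_map_eq_zero]
  intro z hz
  obtain ⟨l, x, hx, rfl⟩ := HomogeneousLocalization.Away.mk_surjective 𝒜 htm z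
  have h0 : x = 0 := hinj _ x hx (by
    rw [← awayEval_mk_mul 𝒜 h t ht htm l x hx, hz, zero_mul])
  subst h0
  exact HomogeneousLocalization.mk_eq_zero_of_num _ rfl

theorem comp_awayEval (h : A →+* B) (g : B →+* C) (t : A) (ht : IsUnit (h t)) {m : ℕ}
    (htm : t ∈ 𝒜 m) :
    g.comp (awayEval 𝒜 h t ht) = awayEval 𝒜 (g.comp h) t (ht.map g) := by
  refine eq_awayEval 𝒜 _ t _ htm _ fun l x hx => ?_
  rw [RingHom.comp_apply, RingHom.comp_apply, RingHom.comp_apply, ← map_pow, ← map_mul,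
    awayEval_mk_mul]

/-- Numerator and denominator have the same degree, so the powers of `u` cancel: homogeneous
coordinates matter only up to a common factor. -/
theorem awayEval_eq_of_rescale (h h' : A →+* B) (t : A) (ht : IsUnit (h t)) (ht' : IsUnit (h' t))
    {m : ℕ} (htm : t ∈ 𝒜 m) (u : B) (hu : ∀ l, ∀ x ∈ 𝒜 l, h' x = u ^ l * h x) :
    awayEval 𝒜 h t ht = awayEval 𝒜 h' t ht' := by
  refine eq_awayEval 𝒜 _ t _ htm _ fun l x hx => ?_
  rw [hu _ x hx, hu _ t htm, ← awayEval_mk_mul 𝒜 h t ht htm l x hx, smul_eq_mul, mul_comm l m]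
  ring

theorem awayEval_comp_awayMap (h : A →+* B) {t s x : A} (hx : x = t * s) {m l : ℕ}
    (htm : t ∈ 𝒜 m) (hsl : s ∈ 𝒜 l) (ht : IsUnit (h t)) (hu : IsUnit (h x)) :
    (awayEval 𝒜 h x hu).comp (HomogeneousLocalization.awayMap 𝒜 hsl hx) =
      awayEval 𝒜 h t ht := by
  subst hx
  refine eq_awayEval 𝒜 _ t _ htm _ fun p y hy => ?_
  have hs : IsUnit (h s) := by
    rw [map_mul] at hu
    exact isUnit_of_mul_isUnit_right hu
  refine (hs.pow p).mul_right_cancel ?_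
  rw [RingHom.comp_apply, HomogeneousLocalization.awayMap_mk, mul_assoc, ← mul_pow, ← map_mul,
    awayEval_mk_mul, map_mul, map_pow]

theorem awayEval_comp_fromZeroRingHom (h : A →+* B) (t : A) (ht : IsUnit (h t)) :
    (awayEval 𝒜 h t ht).comp (HomogeneousLocalization.fromZeroRingHom 𝒜 (Submonoid.powers t)) =
      h.comp (algebraMap (𝒜 0) A) := by
  ext x
  rw [RingHom.comp_apply, awayEval, RingHom.comp_apply, HomogeneousLocalization.algebraMap_apply]
  change IsLocalization.Away.lift t ht (Localization.mk _ _) = _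
  rw [RingHom.comp_apply, ← IsLocalization.Away.lift_eq (S := Localization.Away t) t ht]
  congr 1

end AwayEval

/-! ### Morphisms to `Proj` that land in a single standard chart. -/

section OfGlobalSections

variable {A : Type} [CommRing A] [Algebra ℂ A] (𝒜 : ℕ → Submodule ℂ A) [GradedAlgebra 𝒜]

theorem fromOfGlobalSections_eq {X : Scheme.{0}} (f : A →+* Γ(X, ⊤))
    (hf : (HomogeneousIdeal.irrelevant 𝒜).toIdeal.map f = ⊤) (t : A) {m : ℕ} (hm : 0 < m)
    (htm : t ∈ 𝒜 m) (ht : IsUnit (f t)) :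
    Proj.fromOfGlobalSections 𝒜 f hf =
      X.toSpecΓ ≫ Spec.map (CommRingCat.ofHom (awayEval 𝒜 f t ht)) ≫ Proj.awayι 𝒜 t htm hm := by
  -- As `f t` is a unit, the open subset on which the morphism is described by fractions over `t` is
  -- all of `X`, and its inclusion can be cancelled.
  have htop : X.basicOpen (f t) = ⊤ := Scheme.basicOpen_of_isUnit _ ht
  have h2 : (X.basicOpen (f t)).ι ≫ Proj.fromOfGlobalSections 𝒜 f hf =
      Proj.toBasicOpenOfGlobalSections 𝒜 f rfl hm htm ≫ Scheme.Opens.ι _ := by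
    rw [← Proj.fromOfGlobalSections_resLE 𝒜 f hf hm htm, Scheme.Hom.resLE_comp_ι]
  have : IsIso (X.basicOpen (f t)).ι := by
    rw [htop]; exact inferInstanceAs (IsIso (Scheme.topIso X).hom)
  rw [← cancel_epi (X.basicOpen (f t)).ι, h2, Proj.toBasicOpenOfGlobalSections]
  have h3 : CommRingCat.ofHom ((IsLocalization.map (M := .powers t) (T := .powers (f t))
      (Localization.Away (f t)) f (by
        rw [← Submonoid.map_le_iff_le_comap, Submonoid.map_powers]) :
        Localization.Away t →+* Localization.Away (f t)).comp
      (algebraMap (HomogeneousLocalization.Away 𝒜 t) (Localization.Away t))) =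
      CommRingCat.ofHom (awayEval 𝒜 f t ht) ≫
        CommRingCat.ofHom (algebraMap Γ(X, ⊤) (Localization.Away (f t))) := by
    rw [← CommRingCat.ofHom_comp, awayEval, ← RingHom.comp_assoc]
    congr 2
    refine IsLocalization.ringHom_ext (M := .powers t) ?_
    ext x
    simp
  simp only [Category.assoc, h3, Spec.map_comp, basicOpenIsoSpecAway_hom_SpecMap_assoc,
    Proj.basicOpenIsoSpec_inv_ι, Scheme.isoOfEq_inv]
  refine (congrArg (X.homOfLE _ ≫ ·) (morphismRestrict_ι_assoc X.toSpecΓ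
    (PrimeSpectrum.basicOpen (f t)) _)).trans ?_
  exact Scheme.homOfLE_ι_assoc _ _ _

end OfGlobalSections


/-! ## Closed immersions and separated schemes -/

section Schemes

variable {X P T U W : Scheme.{0}}

/-- Followed by `W.toSpecΓ`, the map becomes a map of affine schemes that is surjective on
functions, hence a closed immersion, and this property cancels. Since `W` need not be affine, the
open pieces of the product of projective spaces never have to be identified with affine spaces. -/
theorem isClosedImmersion_of_surjective_appTop [IsAffine U] [W.IsSeparated] (u : U ⟶ W)
    (hu : Function.Surjective u.appTop) : IsClosedImmersion u := by
  have h : u ≫ W.toSpecΓ = U.toSpecΓ ≫ Spec.map u.appTop := (Scheme.toSpecΓ_naturality u)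
  have h1 : IsClosedImmersion (Spec.map u.appTop) := IsClosedImmersion.spec_of_surjective _ hu
  have h2 : IsClosedImmersion (u ≫ W.toSpecΓ) := by rw [h]; infer_instance
  exact IsClosedImmersion.of_comp u W.toSpecΓ

/-- The chart `U` is open in the preimage of `W p`; it is also closed there, because its map to `W
p` is a closed immersion, and dense, because `T` factors through it. So it is the whole preimage, a
fact which thus needs no separate computation. -/
theorem isClosedImmersion_of_charts [X.IsSeparated] (i : X ⟶ P) (t : T ⟶ X) [IsDominant t]
    {J : Type} (W : J → P.Opens) (hW : iSup W = ⊤)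
    (h : ∀ p, ∃ (U : Scheme.{0}) (e : U ⟶ X) (_ : IsOpenImmersion e) (u : U ⟶ (W p).toScheme)
      (_ : IsClosedImmersion u) (t' : T ⟶ U), t' ≫ e = t ∧ u ≫ (W p).ι = e ≫ i) :
    IsClosedImmersion i := by
  refine (IsZariskiLocalAtTarget.iff_of_iSup_eq_top (P := @IsClosedImmersion) W hW).mpr fun p => ?_
  obtain ⟨U, e, _, u, _, t', ht, hu⟩ := h p
  have hr : Set.range e ⊆ Set.range (i ⁻¹ᵁ W p).ι := by
    rw [Scheme.Opens.range_ι]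
    rintro _ ⟨x, rfl⟩
    change i (e x) ∈ W p
    rw [← Scheme.Hom.comp_apply, ← hu, Scheme.Hom.comp_apply]
    exact (u x).2
  let e' : U ⟶ (i ⁻¹ᵁ W p).toScheme := IsOpenImmersion.lift (i ⁻¹ᵁ W p).ι e hr
  have he' : e' ≫ (i ⁻¹ᵁ W p).ι = e := IsOpenImmersion.lift_fac _ _ _
  have hu' : e' ≫ (i ∣_ W p) = u := by
    rw [← cancel_mono (W p).ι, Category.assoc, morphismRestrict_ι, reassoc_of% he', hu]
  have h1 : IsClosedImmersion (e' ≫ (i ∣_ W p)) := by rw [hu']; infer_instance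
  have h2 : IsClosedImmersion e' := IsClosedImmersion.of_comp e' (i ∣_ W p)
  have h3 : IsDominant ((t' ≫ e') ≫ (i ⁻¹ᵁ W p).ι) := by
    rw [Category.assoc, he', ht]; infer_instance
  have h4 : IsDominant (t' ≫ e') := IsDominant.of_comp_of_isOpenImmersion _ (i ⁻¹ᵁ W p).ι
  have h5 : IsDominant e' := IsDominant.of_comp t' e'
  have h6 : Surjective e' :=
    surjective_of_isDominant_of_isClosed_range _ e'.isClosedEmbedding.isClosed_range
  have h7 : IsOpenImmersion (e' ≫ (i ⁻¹ᵁ W p).ι) := by rw [he']; infer_instance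
  have h8 : IsOpenImmersion e' := IsOpenImmersion.of_comp e' (i ⁻¹ᵁ W p).ι
  have h9 : IsIso e' := (isIso_iff_isOpenImmersion_and_epi_base e').mpr ⟨h8, by
    rw [TopCat.epi_iff_surjective]; exact e'.surjective⟩
  rw [(IsIso.eq_inv_comp e').mpr hu']
  infer_instance

/-- The objects over `S` satisfying `Q` have finite products of their own, and the forgetful functor
preserves them. -/
theorem hom_pi_of_forall (Q : MorphismProperty Scheme.{0}) [Q.IsMultiplicative]
    [Q.IsStableUnderBaseChange] [Q.HasOfPostcompProperty Q] {S : Scheme.{0}}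
    [HasFiniteProducts (Over S)] {k : ℕ} (F : Fin k → Over S)
    (hF : ∀ i, Q (F i).hom) : Q (∏ᶜ F).hom := by
  let G : Fin k → Q.Over ⊤ S := fun i => MorphismProperty.Over.mk ⊤ (F i).hom (hF i)
  have e : (MorphismProperty.Over.forget Q ⊤ S).obj (∏ᶜ G) ≅ ∏ᶜ F :=
    PreservesProduct.iso (MorphismProperty.Over.forget Q ⊤ S) G
  exact (MorphismProperty.over_iso_iff Q e).mp (∏ᶜ G).prop

theorem isSeparated_pi {k : ℕ} (F : Fin k → Over (Spec (.of ℂ)))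
    (hF : ∀ i, IsSeparated (F i).hom) : IsSeparated (∏ᶜ F).hom := by
  have : MorphismProperty.HasOfPostcompProperty @IsSeparated.{0} @IsSeparated.{0} :=
    MorphismProperty.HasOfPostcompProperty.of_le _ ⊤ le_top
  exact hom_pi_of_forall @IsSeparated F hF

/-- The source of a dominant morphism followed by a closed immersion identifies with
the scheme-theoretic image. -/
theorem nonempty_iso_image {S : Scheme.{0}} (t : T ⟶ X) (i : X ⟶ P) [IsDominant t] [IsReduced X]
    [IsClosedImmersion i] (s : P ⟶ S) (f : T ⟶ P) (hf : t ≫ i = f)  :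
    Nonempty (Over.mk (f.imageι ≫ s) ≅ Over.mk (i ≫ s)) := by
  have h0 := IsSchemeTheoreticallyDominant.of_isDominant t
  -- The source `X` is reduced, so the dominant `t` has zero kernel and composing with it does not
  -- enlarge the kernel of `i`.
  have hk : i.ker = f.imageι.ker := by
    rw [Scheme.IdealSheafData.ker_subschemeι, ← hf, Scheme.Hom.ker_comp, t.ker_eq_bot,
      Scheme.IdealSheafData.map_bot]
  have h1 := IsClosedImmersion.isIso_lift i f.imageι hk
  exact ⟨Over.isoMk (asIso (IsClosedImmersion.lift i f.imageι hk.le)) (by simp)⟩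

end Schemes


/-! ## Charts of toric varieties -/

section Atlas

attribute [local instance] MvPolynomial.gradedAlgebra

/-- The constants in a ring of degree zero fractions. -/
def awayConst {A : Type} [CommRing A] [Algebra ℂ A] (𝒜 : ℕ → Submodule ℂ A) [GradedAlgebra 𝒜]
    (t : A) : ℂ →+* HomogeneousLocalization.Away 𝒜 t :=
  (HomogeneousLocalization.fromZeroRingHom 𝒜 (Submonoid.powers t)).comp (algebraMap ℂ (𝒜 0))

/-- Charts presenting `Proj 𝒜` as the closure of the image of a torus under monomials with
exponents `d i a`: the chart of `p` is the locus where the coordinates `p i` do not vanish. -/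
structure ToricAtlas {ι : Type} {k : ℕ} {N : Fin k → Type} (d : ∀ i, N i → ι →₀ ℕ)
    {A : Type} [CommRing A] [Algebra ℂ A] (𝒜 : ℕ → Submodule ℂ A) [GradedAlgebra 𝒜] where
  /-- the parametrisation -/
  ψ : A →ₐ[ℂ] Laurent ι
  inj : ∀ (l : ℕ) (x : A), x ∈ 𝒜 l → ψ x = 0 → x = 0
  /-- the denominators of the charts -/
  f : (∀ i, N i) → A
  f_mem : ∀ p, f p ∈ 𝒜 1
  isUnit_ψ_f : ∀ p, IsUnit (ψ.toRingHom (f p))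
  cover : ⨆ p, Proj.basicOpen 𝒜 (f p) = ⊤
  /-- the numerators of the coordinates -/
  g : (∀ i, N i) → ∀ i, N i → A
  g_mem : ∀ p i a, g p i a ∈ 𝒜 (1 • 1)
  ψ_g : ∀ p i a, ψ (g p i a) * laurentMonomial (d i (p i)) = ψ (f p) * laurentMonomial (d i a)
  gen : ∀ p (R : Subring (HomogeneousLocalization.Away 𝒜 (f p))),
    (∀ c, awayConst 𝒜 (f p) c ∈ R) →
    (∀ i a, HomogeneousLocalization.Away.mk 𝒜 (f_mem p) 1 (g p i a) (g_mem p i a) ∈ R) → R = ⊤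

theorem eval₂Hom_rescale {N B : Type} [CommRing B] (c : ℂ →+* B) (v w : N → B) (u : B)
    (h : ∀ a, w a = u * v a) (l : ℕ) (x : MvPolynomial N ℂ)
    (hx : x ∈ MvPolynomial.homogeneousSubmodule N ℂ l) :
    MvPolynomial.eval₂Hom c w x = u ^ l * MvPolynomial.eval₂Hom c v x := by
  simp only [MvPolynomial.coe_eval₂Hom, MvPolynomial.eval₂_eq, Finset.mul_sum]
  refine Finset.sum_congr rfl fun e he => ?_
  have hl : ∑ i ∈ e.support, e i = l := by
    have := hx (MvPolynomial.mem_support_iff.mp he)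
    simpa [Finsupp.weight_apply, Finsupp.sum] using this
  simp_rw [h, mul_pow, Finset.prod_mul_distrib, Finset.prod_pow_eq_pow_sum, hl]
  ring

theorem X_mem_homogeneousSubmodule {N : Type} (a : N) :
    MvPolynomial.X a ∈ MvPolynomial.homogeneousSubmodule N ℂ 1 :=
  MvPolynomial.isHomogeneous_X ℂ a

theorem isUnit_monomialSubst_X {ι N : Type} (d : N → ι →₀ ℕ) (a : N) :
    IsUnit (monomialSubst d (MvPolynomial.X a)) := by
  simpa [monomialSubst] using isUnit_laurentMonomial (d a)

theorem fromOfGlobalSections_spec_eq {A B : Type} [CommRing A] [CommRing B] [Algebra ℂ A]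
    (𝒜 : ℕ → Submodule ℂ A) [GradedAlgebra 𝒜] (h : A →+* B)
    (hh : (HomogeneousIdeal.irrelevant 𝒜).toIdeal.map
      ((Scheme.ΓSpecIso (.of B)).inv.hom.comp h) = ⊤)
    (t : A) {m : ℕ} (hm : 0 < m) (htm : t ∈ 𝒜 m) (ht : IsUnit (h t)) :
    Proj.fromOfGlobalSections 𝒜 ((Scheme.ΓSpecIso (.of B)).inv.hom.comp h) hh =
      Spec.map (CommRingCat.ofHom (awayEval 𝒜 h t ht)) ≫ Proj.awayι 𝒜 t htm hm := by
  have ht' : IsUnit (((Scheme.ΓSpecIso (.of B)).inv.hom.comp h) t) :=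
    ht.map (Scheme.ΓSpecIso (.of B)).inv.hom
  rw [fromOfGlobalSections_eq 𝒜 _ hh t hm htm ht']
  have h3 : CommRingCat.ofHom (awayEval 𝒜 ((Scheme.ΓSpecIso (.of B)).inv.hom.comp h) t
      ht') = CommRingCat.ofHom (awayEval 𝒜 h t ht) ≫ (Scheme.ΓSpecIso (.of B)).inv :=
    congrArg CommRingCat.ofHom (comp_awayEval 𝒜 h _ t ht htm).symm
  rw [h3, Spec.map_comp, Category.assoc, toSpecΓ_SpecMap_ΓSpecIso_inv_assoc]

theorem monomialMap_left {ι N : Type} [Nonempty N] (d : N → ι →₀ ℕ) (a : N) :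
    (monomialMap d).left = Spec.map (CommRingCat.ofHom
      (awayEval (MvPolynomial.homogeneousSubmodule N ℂ) (monomialSubst d) (MvPolynomial.X a)
        (isUnit_monomialSubst_X d a))) ≫
      Proj.awayι (MvPolynomial.homogeneousSubmodule N ℂ) (MvPolynomial.X a)
        (X_mem_homogeneousSubmodule a) one_pos := by
  exact fromOfGlobalSections_spec_eq _ (monomialSubst d) (map_irrelevant_monomialSections d)
    (MvPolynomial.X a) one_pos (X_mem_homogeneousSubmodule a) (isUnit_monomialSubst_X d a)

theorem isDominant_specMap_of_injective {R S : Type} [CommRing R] [CommRing S] (φ : R →+* S)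
    (hφ : Function.Injective φ) : IsDominant (Spec.map (CommRingCat.ofHom φ)) := by
  refine ⟨(PrimeSpectrum.denseRange_comap_iff_ker_le_nilRadical φ).mpr ?_⟩
  rw [(RingHom.injective_iff_ker_eq_bot φ).mp hφ]
  exact bot_le

theorem iSup_basicOpen_X {N : Type} :
    ⨆ a, Proj.basicOpen (MvPolynomial.homogeneousSubmodule N ℂ) (MvPolynomial.X a) = ⊤ := by
  refine Proj.iSup_basicOpen_eq_top' _ _ (fun a => ⟨1, MvPolynomial.isHomogeneous_X ℂ a⟩) ?_
  refine eq_top_iff.mpr fun x _ => ?_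
  induction x using MvPolynomial.induction_on with
  | C c =>
    let z : MvPolynomial.homogeneousSubmodule N ℂ 0 :=
      ⟨MvPolynomial.C c, MvPolynomial.isHomogeneous_C _ _⟩
    exact Subalgebra.algebraMap_mem _ z
  | add p q hp hq => exact add_mem (hp trivial) (hq trivial)
  | mul_X p a hp => exact mul_mem (hp trivial) (Algebra.subset_adjoin ⟨a, rfl⟩)

theorem projOver_awayι {A : Type} [CommRing A] [Algebra ℂ A] (𝒜 : ℕ → Submodule ℂ A)
    [GradedAlgebra 𝒜] (t : A) {m : ℕ} (htm : t ∈ 𝒜 m) (hm : 0 < m) :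
    Proj.awayι 𝒜 t htm hm ≫ (projOver 𝒜).hom =
      Spec.map (CommRingCat.ofHom (awayConst 𝒜 t)) := by
  change Proj.awayι 𝒜 t htm hm ≫ Proj.toSpecZero 𝒜 ≫ _ = _
  rw [Proj.awayι_toSpecZero_assoc, ← Spec.map_comp]
  rfl

instance {A : Type} [CommRing A] [Algebra ℂ A] (𝒜 : ℕ → Submodule ℂ A) [GradedAlgebra 𝒜] :
    IsSeparated (projOver 𝒜).hom := by
  change IsSeparated (Proj.toSpecZero 𝒜 ≫ Spec.map _)
  infer_instance

end Atlas


/-! ## Toric varieties with an atlas -/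

namespace ToricAtlas

attribute [local instance] MvPolynomial.gradedAlgebra

variable {ι : Type} {k : ℕ} {N : Fin k → Type} {d : ∀ i, N i → ι →₀ ℕ}
  {A : Type} [CommRing A] [Algebra ℂ A] {𝒜 : ℕ → Submodule ℂ A} [GradedAlgebra 𝒜]
  (𝔄 : ToricAtlas d 𝒜)

/-- The parametrisation of the chart of `p`. -/
def χ (p : ∀ i, N i) : HomogeneousLocalization.Away 𝒜 (𝔄.f p) →+* Laurent ι :=
  awayEval 𝒜 𝔄.ψ.toRingHom (𝔄.f p) (𝔄.isUnit_ψ_f p)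

theorem χ_injective (p : ∀ i, N i) : Function.Injective (𝔄.χ p) :=
  awayEval_injective 𝒜 _ _ _ (𝔄.f_mem p) 𝔄.inj

/-- The affine coordinate functions of the chart of `p`. -/
def coord (p : ∀ i, N i) (i : Fin k) (a : N i) : HomogeneousLocalization.Away 𝒜 (𝔄.f p) :=
  HomogeneousLocalization.Away.mk 𝒜 (𝔄.f_mem p) 1 (𝔄.g p i a) (𝔄.g_mem p i a)

theorem laurentMonomial_mul_χ_coord (p : ∀ i, N i) (i : Fin k) (a : N i) :
    laurentMonomial (d i (p i)) * 𝔄.χ p (𝔄.coord p i a) = laurentMonomial (d i a) := by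
  refine (𝔄.isUnit_ψ_f p).mul_right_cancel ?_
  have h : 𝔄.χ p (𝔄.coord p i a) * 𝔄.ψ.toRingHom (𝔄.f p) = 𝔄.ψ (𝔄.g p i a) := by
    have := awayEval_mk_mul 𝒜 𝔄.ψ.toRingHom (𝔄.f p) (𝔄.isUnit_ψ_f p) (𝔄.f_mem p) 1 (𝔄.g p i a)
      (𝔄.g_mem p i a)
    rwa [pow_one] at this
  rw [mul_assoc, h, mul_comm, 𝔄.ψ_g, mul_comm]
  rfl

theorem coord_self (p : ∀ i, N i) (i : Fin k) : 𝔄.coord p i (p i) = 1 := by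
  refine 𝔄.χ_injective p ((isUnit_laurentMonomial (d i (p i))).mul_left_cancel ?_)
  rw [laurentMonomial_mul_χ_coord, map_one, mul_one]

/-- The substitution of the affine coordinates of the chart of `p` for the homogeneous
coordinates. -/
def coordSubst (p : ∀ i, N i) (i : Fin k) :
    MvPolynomial (N i) ℂ →+* HomogeneousLocalization.Away 𝒜 (𝔄.f p) :=
  MvPolynomial.eval₂Hom (awayConst 𝒜 (𝔄.f p)) (𝔄.coord p i)

theorem coordSubst_X (p : ∀ i, N i) (i : Fin k) (a : N i) :
    𝔄.coordSubst p i (MvPolynomial.X a) = 𝔄.coord p i a :=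
  MvPolynomial.eval₂_X _ _ _

theorem isUnit_coordSubst (p : ∀ i, N i) (i : Fin k) :
    IsUnit (𝔄.coordSubst p i (MvPolynomial.X (p i))) := by
  rw [coordSubst_X, coord_self]
  exact isUnit_one

/-- The map from the chart of `p` to the affine space in the `i`-th projective space. -/
def φ (p : ∀ i, N i) (i : Fin k) :
    HomogeneousLocalization.Away (MvPolynomial.homogeneousSubmodule (N i) ℂ)
      (MvPolynomial.X (p i)) →+* HomogeneousLocalization.Away 𝒜 (𝔄.f p) :=
  awayEval _ (𝔄.coordSubst p i) _ (𝔄.isUnit_coordSubst p i)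

theorem χ_comp_awayConst (p : ∀ i, N i) :
    (𝔄.χ p).comp (awayConst 𝒜 (𝔄.f p)) = algebraMap ℂ (Laurent ι) := by
  rw [awayConst, ← RingHom.comp_assoc, χ, awayEval_comp_fromZeroRingHom]
  exact RingHom.ext fun c => 𝔄.ψ.commutes c

/-- On the torus the affine coordinates of the chart differ from the monomials `d i a` by the common
factor `laurentMonomial (d i (p i))`, which does not affect degree zero fractions. -/
theorem χ_comp_φ (p : ∀ i, N i) (i : Fin k) :
    (𝔄.χ p).comp (𝔄.φ p i) = awayEval (MvPolynomial.homogeneousSubmodule (N i) ℂ)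
      (monomialSubst (d i)) (MvPolynomial.X (p i)) (isUnit_monomialSubst_X (d i) (p i)) := by
  rw [φ, comp_awayEval _ _ _ _ _ (X_mem_homogeneousSubmodule (p i))]
  refine awayEval_eq_of_rescale _ _ _ _ _ _ (X_mem_homogeneousSubmodule (p i))
    (laurentMonomial (d i (p i))) fun l x hx => ?_
  have h1 : (𝔄.χ p).comp (𝔄.coordSubst p i) = MvPolynomial.eval₂Hom (algebraMap ℂ (Laurent ι))
      (fun a => 𝔄.χ p (𝔄.coord p i a)) := by
    rw [coordSubst, MvPolynomial.comp_eval₂Hom, χ_comp_awayConst]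
  rw [h1]
  exact eval₂Hom_rescale _ _ (fun a => laurentMonomial (d i a)) _
    (fun a => (𝔄.laurentMonomial_mul_χ_coord p i a).symm) l x hx

theorem φ_X_div (p : ∀ i, N i) (i : Fin k) (a : N i) :
    𝔄.φ p i (HomogeneousLocalization.Away.mk _ (X_mem_homogeneousSubmodule (p i)) 1
      (MvPolynomial.X a) (X_mem_homogeneousSubmodule a)) = 𝔄.coord p i a := by
  have h := awayEval_mk_mul (MvPolynomial.homogeneousSubmodule (N i) ℂ) (𝔄.coordSubst p i) _
    (𝔄.isUnit_coordSubst p i) (X_mem_homogeneousSubmodule (p i)) 1 (MvPolynomial.X a)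
    (X_mem_homogeneousSubmodule a)
  rw [coordSubst_X, coordSubst_X, coord_self, one_pow, mul_one] at h
  exact h

theorem φ_comp_awayConst (p : ∀ i, N i) (i : Fin k) :
    (𝔄.φ p i).comp (awayConst (MvPolynomial.homogeneousSubmodule (N i) ℂ)
      (MvPolynomial.X (p i))) = awayConst 𝒜 (𝔄.f p) := by
  rw [awayConst, ← RingHom.comp_assoc, φ, awayEval_comp_fromZeroRingHom]
  exact RingHom.ext fun c => MvPolynomial.eval₂_C _ _ _

/-- The chart of `p`. -/
abbrev chart (p : ∀ i, N i) : Scheme.{0} := Spec (.of (HomogeneousLocalization.Away 𝒜 (𝔄.f p)))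

/-- The inclusion of the chart of `p`. -/
abbrev chartι (p : ∀ i, N i) : 𝔄.chart p ⟶ Proj 𝒜 := Proj.awayι 𝒜 (𝔄.f p) (𝔄.f_mem p) one_pos

/-- The torus in the chart of `p`. -/
abbrev torusChart (p : ∀ i, N i) : Spec (.of (Laurent ι)) ⟶ 𝔄.chart p :=
  Spec.map (CommRingCat.ofHom (𝔄.χ p))

/-- The map from the chart of `p` to the `i`-th projective space. -/
abbrev chartToProj (p : ∀ i, N i) (i : Fin k) :
    𝔄.chart p ⟶ Proj (MvPolynomial.homogeneousSubmodule (N i) ℂ) :=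
  Spec.map (CommRingCat.ofHom (𝔄.φ p i)) ≫ Proj.awayι
    (MvPolynomial.homogeneousSubmodule (N i) ℂ) (MvPolynomial.X (p i))
    (X_mem_homogeneousSubmodule (p i)) one_pos

theorem isDominant_torusChart (p : ∀ i, N i) : IsDominant (𝔄.torusChart p) :=
  isDominant_specMap_of_injective _ (𝔄.χ_injective p)

theorem torusChart_chartToProj [∀ i, Nonempty (N i)] (p : ∀ i, N i) (i : Fin k) :
    𝔄.torusChart p ≫ 𝔄.chartToProj p i = (monomialMap (d i)).left := by
  rw [monomialMap_left (d i) (p i), ← 𝔄.χ_comp_φ p i, CommRingCat.ofHom_comp, Spec.map_comp,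
    Category.assoc]

/-- The covering by the charts. -/
def openCover : (Proj 𝒜).OpenCover :=
  Scheme.AffineOpenCover.openCover
    { I₀ := ∀ i, N i
      X := fun p => .of (HomogeneousLocalization.Away 𝒜 (𝔄.f p))
      f := 𝔄.chartι
      idx := fun x =>
        (TopologicalSpace.Opens.mem_iSup.mp (𝔄.cover.ge (Set.mem_univ x))).choose
      covers := fun x => by
        change x ∈ (Proj.awayι 𝒜 _ _ _).opensRange
        rw [Proj.opensRange_awayι]
        exact (TopologicalSpace.Opens.mem_iSup.mp (𝔄.cover.ge (Set.mem_univ x))).choose_spec }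

/-- The parametrisation of the intersection of two charts. -/
def overlapχ (p q : ∀ i, N i) :
    HomogeneousLocalization.Away 𝒜 (𝔄.f p * 𝔄.f q) →+* Laurent ι :=
  awayEval 𝒜 𝔄.ψ.toRingHom (𝔄.f p * 𝔄.f q) (by
    rw [map_mul]; exact (𝔄.isUnit_ψ_f p).mul (𝔄.isUnit_ψ_f q))

theorem overlapχ_injective (p q : ∀ i, N i) : Function.Injective (𝔄.overlapχ p q) :=
  awayEval_injective 𝒜 _ _ _ (SetLike.mul_mem_graded (𝔄.f_mem p) (𝔄.f_mem q)) 𝔄.inj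

theorem overlapχ_comp_awayMap (p q : ∀ i, N i) :
    (𝔄.overlapχ p q).comp (HomogeneousLocalization.awayMap 𝒜 (𝔄.f_mem q) rfl) = 𝔄.χ p :=
  awayEval_comp_awayMap 𝒜 _ _ (𝔄.f_mem p) (𝔄.f_mem q) _ _

theorem overlapχ_comp_awayMap' (p q : ∀ i, N i) :
    (𝔄.overlapχ p q).comp (HomogeneousLocalization.awayMap 𝒜 (𝔄.f_mem p) (mul_comm _ _)) =
      𝔄.χ q :=
  awayEval_comp_awayMap 𝒜 _ _ (𝔄.f_mem q) (𝔄.f_mem p) _ _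

/-- Both sides factor through the overlap, the chart of `f p * f q`, where they are given by the
same evaluation. -/
theorem torusChart_chartι (p q : ∀ i, N i) :
    𝔄.torusChart p ≫ 𝔄.chartι p = 𝔄.torusChart q ≫ 𝔄.chartι q := by
  have h1 := Proj.SpecMap_awayMap_awayι 𝒜 (𝔄.f_mem p) one_pos (𝔄.f_mem q)
    (x := 𝔄.f p * 𝔄.f q) rfl
  have h2 := Proj.SpecMap_awayMap_awayι 𝒜 (𝔄.f_mem q) one_pos (𝔄.f_mem p)
    (x := 𝔄.f p * 𝔄.f q) (mul_comm _ _)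
  rw [torusChart, torusChart, ← 𝔄.overlapχ_comp_awayMap p q, ← 𝔄.overlapχ_comp_awayMap' p q,
    CommRingCat.ofHom_comp, CommRingCat.ofHom_comp, Spec.map_comp, Spec.map_comp,
    Category.assoc, Category.assoc, h1, h2]

theorem isReduced_proj (𝔄 : ToricAtlas d 𝒜) : IsReduced (Proj 𝒜) := by
  have (p : 𝔄.openCover.I₀) : IsReduced (𝔄.openCover.X p) := by
    change ∀ i, N i at p
    have : _root_.IsReduced (HomogeneousLocalization.Away 𝒜 (𝔄.f p)) :=
      isReduced_of_injective _ (𝔄.χ_injective p)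
    exact inferInstanceAs (IsReduced (𝔄.chart p))
  exact IsReduced.of_openCover _ 𝔄.openCover

variable [∀ i, Nonempty (N i)]

/-- The map from the torus. -/
def torusMap : Spec (.of (Laurent ι)) ⟶ Proj 𝒜 :=
  𝔄.torusChart (fun _ => Classical.arbitrary _) ≫ 𝔄.chartι _

theorem torusChart_chartι_eq (p : ∀ i, N i) : 𝔄.torusChart p ≫ 𝔄.chartι p = 𝔄.torusMap :=
  𝔄.torusChart_chartι p _

theorem isDominant_torusMap : IsDominant 𝔄.torusMap := by
  refine ⟨fun x => ?_⟩
  obtain ⟨p, y, rfl⟩ : ∃ (p : ∀ i, N i) (y : 𝔄.chart p), 𝔄.chartι p y = x :=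
    𝔄.openCover.exists_eq x
  have := 𝔄.isDominant_torusChart p
  have h : y ∈ closure (Set.range (𝔄.torusChart p)) :=
    (𝔄.torusChart p).denseRange.closure_range ▸ Set.mem_univ y
  have h2 := image_closure_subset_closure_image (𝔄.chartι p).continuous ⟨y, h, rfl⟩
  rwa [← Set.range_comp, ← TopCat.coe_comp, ← Scheme.Hom.comp_base, torusChart_chartι_eq] at h2

/-- The map to the `i`-th projective space. -/
def toProj (i : Fin k) : Proj 𝒜 ⟶ Proj (MvPolynomial.homogeneousSubmodule (N i) ℂ) :=
  𝔄.openCover.glueMorphisms (fun p => 𝔄.chartToProj p i) (by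
    intro p q
    change ∀ i, N i at p q
    change pullback.fst (𝔄.chartι p) (𝔄.chartι q) ≫ _ =
      pullback.snd (𝔄.chartι p) (𝔄.chartι q) ≫ _
    have := isDominant_specMap_of_injective _ (𝔄.overlapχ_injective p q)
    have : _root_.IsReduced (HomogeneousLocalization.Away 𝒜 (𝔄.f p * 𝔄.f q)) :=
      isReduced_of_injective _ (𝔄.overlapχ_injective p q)
    rw [← cancel_epi (Proj.pullbackAwayιIso 𝒜 (𝔄.f_mem p) one_pos (𝔄.f_mem q) one_pos rfl).inv,
      Proj.pullbackAwayιIso_inv_fst_assoc, Proj.pullbackAwayιIso_inv_snd_assoc]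
    -- The overlap is reduced and contains the torus densely, so it suffices to compare on the
    -- torus, where both maps are `monomialMap (d i)`.
    refine ext_of_isDominant (Spec.map (CommRingCat.ofHom (𝔄.overlapχ p q))) ?_
    rw [← Spec.map_comp_assoc, ← CommRingCat.ofHom_comp, overlapχ_comp_awayMap,
      torusChart_chartToProj, ← Spec.map_comp_assoc, ← CommRingCat.ofHom_comp,
      overlapχ_comp_awayMap', torusChart_chartToProj])

theorem chartι_toProj (p : ∀ i, N i) (i : Fin k) :
    𝔄.chartι p ≫ 𝔄.toProj i = 𝔄.chartToProj p i :=
  𝔄.openCover.ι_glueMorphisms _ _ p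

end ToricAtlas


/-- The structure map of `Proj 𝒜`. -/
def projStr {A : Type} [CommRing A] [Algebra ℂ A] (𝒜 : ℕ → Submodule ℂ A) [GradedAlgebra 𝒜] :
    Proj 𝒜 ⟶ Spec (.of ℂ) :=
  (projOver 𝒜).hom

/-! ### The closed immersion into the product of projective spaces. -/

namespace ToricAtlas

attribute [local instance] MvPolynomial.gradedAlgebra

variable {ι : Type} {k : ℕ} {N : Fin k → Type} {d : ∀ i, N i → ι →₀ ℕ}
  {A : Type} [CommRing A] [Algebra ℂ A] {𝒜 : ℕ → Submodule ℂ A} [GradedAlgebra 𝒜]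
  (𝔄 : ToricAtlas d 𝒜)

theorem chartι_projStr (p : ∀ i, N i) :
    𝔄.chartι p ≫ projStr 𝒜 = Spec.map (CommRingCat.ofHom (awayConst 𝒜 (𝔄.f p))) :=
  projOver_awayι 𝒜 _ _ _

theorem chartToProj_projStr (p : ∀ i, N i) (i : Fin k) :
    𝔄.chartToProj p i ≫ projStr (MvPolynomial.homogeneousSubmodule (N i) ℂ) =
      Spec.map (CommRingCat.ofHom (awayConst 𝒜 (𝔄.f p))) := by
  refine (Category.assoc _ _ _).trans ((congrArg _ (projOver_awayι _ _ _ _)).trans ?_)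
  rw [← Spec.map_comp, ← CommRingCat.ofHom_comp, φ_comp_awayConst]

variable (N) in
/-- The product of the projective spaces. -/
abbrev prodProj : Over (Spec (.of ℂ)) := ∏ᶜ fun i => projectiveSpace (N i)

variable (N) in
/-- The projection to the `i`-th projective space. -/
def prodπ (i : Fin k) :
    (prodProj N).left ⟶ Proj (MvPolynomial.homogeneousSubmodule (N i) ℂ) :=
  (Pi.π (fun i => projectiveSpace (N i)) i).left

/-- The open subset of the product of projective spaces where the coordinates `p i` do
not vanish. -/
def affineOpen (p : ∀ i, N i) : (prodProj N).left.Opens :=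
  ⨅ i, prodπ N i ⁻¹ᵁ
    Proj.basicOpen (MvPolynomial.homogeneousSubmodule (N i) ℂ) (MvPolynomial.X (p i))

theorem mem_affineOpen (p : ∀ i, N i) (x : (prodProj N).left) :
    x ∈ affineOpen p ↔ ∀ i, prodπ N i x ∈
      Proj.basicOpen (MvPolynomial.homogeneousSubmodule (N i) ℂ) (MvPolynomial.X (p i)) := by
  rw [affineOpen, ← SetLike.mem_coe, TopologicalSpace.Opens.coe_iInf, Set.mem_iInter]
  rfl

theorem iSup_affineOpen : ⨆ p : ∀ i, N i, affineOpen p = ⊤ := by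
  refine eq_top_iff.mpr fun x _ => TopologicalSpace.Opens.mem_iSup.mpr ?_
  have h (i : Fin k) : ∃ a, prodπ N i x ∈
      Proj.basicOpen (MvPolynomial.homogeneousSubmodule (N i) ℂ) (MvPolynomial.X a) :=
    TopologicalSpace.Opens.mem_iSup.mp (iSup_basicOpen_X.ge (Set.mem_univ _))
  choose p hp using h
  exact ⟨p, (mem_affineOpen p x).mpr hp⟩

/-- The projection from `affineOpen p` to the affine space in the `i`-th projective space. -/
def affineOpenProj (p : ∀ i, N i) (i : Fin k) : (affineOpen (N := N) p).toScheme ⟶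
    Spec (.of (HomogeneousLocalization.Away (MvPolynomial.homogeneousSubmodule (N i) ℂ)
      (MvPolynomial.X (p i)))) :=
  IsOpenImmersion.lift (Proj.awayι (MvPolynomial.homogeneousSubmodule (N i) ℂ) _
      (X_mem_homogeneousSubmodule (p i)) one_pos) ((affineOpen p).ι ≫ prodπ N i) (by
    rintro _ ⟨z, rfl⟩
    have h := (mem_affineOpen p z.1).mp z.2 i
    rw [← Proj.opensRange_awayι (MvPolynomial.homogeneousSubmodule (N i) ℂ) _
      (X_mem_homogeneousSubmodule (p i)) one_pos] at h
    exact h)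

theorem affineOpenProj_awayι (p : ∀ i, N i) (i : Fin k) :
    affineOpenProj p i ≫ Proj.awayι (MvPolynomial.homogeneousSubmodule (N i) ℂ) _
      (X_mem_homogeneousSubmodule (p i)) one_pos = (affineOpen p).ι ≫ prodπ N i :=
  IsOpenImmersion.lift_fac _ _ _

/-- Functions pulled back from an affine scheme through `W` come from global functions on `W`. This
bounds the image of those functions from below without computing them. -/
theorem range_le_of_comp_eq {R S : Type} [CommRing R] [CommRing S] {W : Scheme.{0}}
    (u : Spec (.of S) ⟶ W) (q : W ⟶ Spec (.of R)) (φ : R →+* S)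
    (h : u ≫ q = Spec.map (CommRingCat.ofHom φ)) :
    φ.range ≤ (u.appTop ≫ (Scheme.ΓSpecIso (.of S)).hom).hom.range := by
  rintro _ ⟨x, rfl⟩
  have h1 : (Scheme.ΓSpecIso (.of R)).inv ≫ q.appTop ≫ u.appTop ≫ (Scheme.ΓSpecIso (.of S)).hom =
      CommRingCat.ofHom φ := by
    rw [← Scheme.Hom.comp_appTop_assoc, h, Iso.inv_comp_eq, Scheme.ΓSpecIso_naturality]
  exact ⟨q.appTop ((Scheme.ΓSpecIso (.of R)).inv x), congrArg (fun e => e.hom x) h1⟩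

theorem isSeparated_prod : (prodProj N).left.IsSeparated := by
  have h : IsSeparated (prodProj N).hom := isSeparated_pi (fun i => projectiveSpace (N i))
    fun i => by rw [projectiveSpace]; infer_instance
  refine ⟨?_⟩
  rw [← terminal.comp_from (prodProj N).hom]
  have : IsSeparated (terminal.from ((Functor.fromPUnit (Spec (.of ℂ))).obj
    (prodProj N).right)) := inferInstanceAs (IsSeparated (terminal.from (Spec (.of ℂ))))
  infer_instance

variable [∀ i, Nonempty (N i)]

theorem toProj_projStr (i : Fin k) :
    𝔄.toProj i ≫ projStr (MvPolynomial.homogeneousSubmodule (N i) ℂ) = projStr 𝒜 := by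
  refine 𝔄.openCover.hom_ext _ _ fun p => ?_
  change ∀ i, N i at p
  change 𝔄.chartι p ≫ _ = 𝔄.chartι p ≫ _
  rw [chartι_projStr, reassoc_of% 𝔄.chartι_toProj p i]
  exact 𝔄.chartToProj_projStr p i

/-- The map to the product of the projective spaces. -/
def toProd : projOver 𝒜 ⟶ prodProj N :=
  Pi.lift fun i => Over.homMk (𝔄.toProj i) (𝔄.toProj_projStr i)

/-- The underlying map of schemes of `toProd`. -/
def toProdLeft : Proj 𝒜 ⟶ (prodProj N).left := 𝔄.toProd.left

theorem toProdLeft_prodπ (i : Fin k) : 𝔄.toProdLeft ≫ prodπ N i = 𝔄.toProj i := by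
  have h : 𝔄.toProd ≫ Pi.π (fun i => projectiveSpace (N i)) i =
      Over.homMk (𝔄.toProj i) (𝔄.toProj_projStr i) := Pi.lift_π _ _
  exact congrArg (·.left) h

theorem toProdLeft_hom : 𝔄.toProdLeft ≫ (prodProj N).hom = projStr 𝒜 := Over.w 𝔄.toProd

theorem chartι_toProdLeft_prodπ (p : ∀ i, N i) (i : Fin k) :
    𝔄.chartι p ≫ 𝔄.toProdLeft ≫ prodπ N i = 𝔄.chartToProj p i := by
  rw [toProdLeft_prodπ, chartι_toProj]

theorem chartι_toProdLeft_mem (p : ∀ i, N i) (z : 𝔄.chart p) :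
    (𝔄.chartι p ≫ 𝔄.toProdLeft) z ∈ affineOpen p := by
  refine (mem_affineOpen p _).mpr fun i => ?_
  rw [← Scheme.Hom.comp_apply, Category.assoc, chartι_toProdLeft_prodπ, chartToProj,
    Scheme.Hom.comp_apply, ← Proj.opensRange_awayι
    (MvPolynomial.homogeneousSubmodule (N i) ℂ) _ (X_mem_homogeneousSubmodule (p i)) one_pos]
  exact ⟨_, rfl⟩

/-- The map from the chart of `p` to the open subset `affineOpen p`. -/
def toAffineOpen (p : ∀ i, N i) : 𝔄.chart p ⟶ (affineOpen (N := N) p).toScheme :=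
  IsOpenImmersion.lift (affineOpen p).ι (𝔄.chartι p ≫ 𝔄.toProdLeft) (by
    rw [Scheme.Opens.range_ι]
    rintro _ ⟨z, rfl⟩
    exact 𝔄.chartι_toProdLeft_mem p z)

theorem toAffineOpen_ι (p : ∀ i, N i) :
    𝔄.toAffineOpen p ≫ (affineOpen p).ι = 𝔄.chartι p ≫ 𝔄.toProdLeft :=
  IsOpenImmersion.lift_fac _ _ _

theorem toAffineOpen_affineOpenProj (p : ∀ i, N i) (i : Fin k) :
    𝔄.toAffineOpen p ≫ affineOpenProj p i = Spec.map (CommRingCat.ofHom (𝔄.φ p i)) := by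
  rw [← cancel_mono (Proj.awayι (MvPolynomial.homogeneousSubmodule (N i) ℂ) _
    (X_mem_homogeneousSubmodule (p i)) one_pos), Category.assoc, affineOpenProj_awayι,
    reassoc_of% 𝔄.toAffineOpen_ι p, chartι_toProdLeft_prodπ]

/-- The constants and the coordinate ratios generate the ring of the chart (`gen`), and all of them
are pulled back from `affineOpen p`: the constants from the base, the ratios from the projections.
-/
theorem isClosedImmersion_toAffineOpen (p : ∀ i, N i) :
    IsClosedImmersion (𝔄.toAffineOpen p) := by
  have := isSeparated_prod (N := N)
  have : (affineOpen (N := N) p).toScheme.IsSeparated := ⟨by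
    rw [← terminal.comp_from (affineOpen p).ι]
    infer_instance⟩
  refine isClosedImmersion_of_surjective_appTop _ ?_
  have h0 : 𝔄.toAffineOpen p ≫ (affineOpen p).ι ≫ (prodProj N).hom =
      Spec.map (CommRingCat.ofHom (awayConst 𝒜 (𝔄.f p))) := by
    rw [reassoc_of% 𝔄.toAffineOpen_ι p, toProdLeft_hom, chartι_projStr]
  have h := 𝔄.gen p ((𝔄.toAffineOpen p).appTop ≫ (Scheme.ΓSpecIso _).hom).hom.range
    (fun c => range_le_of_comp_eq (𝔄.toAffineOpen p) _ (awayConst 𝒜 (𝔄.f p)) h0 ⟨c, rfl⟩)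
    (fun i a => range_le_of_comp_eq (𝔄.toAffineOpen p) (affineOpenProj p i) (𝔄.φ p i)
      (𝔄.toAffineOpen_affineOpenProj p i) ⟨_, 𝔄.φ_X_div p i a⟩)
  have h2 : Function.Surjective ((𝔄.toAffineOpen p).appTop ≫ (Scheme.ΓSpecIso _).hom).hom :=
    RingHom.range_eq_top.mp h
  intro y
  obtain ⟨x, hx⟩ := h2 ((Scheme.ΓSpecIso _).hom y)
  exact ⟨x, (ConcreteCategory.bijective_of_isIso (Scheme.ΓSpecIso _).hom).1 hx⟩

theorem torusMap_projStr :
    𝔄.torusMap ≫ projStr 𝒜 = Spec.map (CommRingCat.ofHom (algebraMap ℂ (Laurent ι))) := by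
  rw [torusMap, Category.assoc, chartι_projStr, ← Spec.map_comp, ← CommRingCat.ofHom_comp,
    χ_comp_awayConst]

theorem torusMap_toProj (i : Fin k) : 𝔄.torusMap ≫ 𝔄.toProj i = (monomialMap (d i)).left := by
  rw [torusMap, Category.assoc, chartι_toProj, torusChart_chartToProj]

/-- The map from the torus, over the complex numbers. -/
def torusHom : torus ι ⟶ projOver 𝒜 := Over.homMk 𝔄.torusMap 𝔄.torusMap_projStr

theorem torusHom_toProd : 𝔄.torusHom ≫ 𝔄.toProd = multiMonomialMap d := by
  refine Pi.hom_ext _ _ fun i => ?_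
  rw [multiMonomialMap, Pi.lift_π, Category.assoc, toProd, Pi.lift_π]
  exact Over.OverMorphism.ext (𝔄.torusMap_toProj i)

theorem isClosedImmersion_toProdLeft : IsClosedImmersion 𝔄.toProdLeft := by
  have := 𝔄.isDominant_torusMap
  exact isClosedImmersion_of_charts 𝔄.toProdLeft 𝔄.torusMap affineOpen
    iSup_affineOpen fun p => ⟨𝔄.chart p, 𝔄.chartι p, inferInstance, 𝔄.toAffineOpen p,
      𝔄.isClosedImmersion_toAffineOpen p, 𝔄.torusChart p, 𝔄.torusChart_chartι_eq p,
      𝔄.toAffineOpen_ι p⟩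

theorem nonempty_iso (𝔄 : ToricAtlas d 𝒜) : Nonempty (monomialClosure d ≅ projOver 𝒜) := by
  have := 𝔄.isDominant_torusMap
  have := 𝔄.isReduced_proj
  have := 𝔄.isClosedImmersion_toProdLeft
  obtain ⟨e⟩ := nonempty_iso_image 𝔄.torusMap 𝔄.toProdLeft
    (prodProj N).hom (multiMonomialMap d).left (congrArg (·.left) 𝔄.torusHom_toProd)
  exact ⟨e ≪≫ Over.isoMk (Iso.refl _) ((Category.id_comp _).trans 𝔄.toProdLeft_hom.symm)⟩

end ToricAtlas


/-! ## Charts from monomial bases -/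

section MonomialModel

theorem laurentMonomial_zero {ι : Type} : laurentMonomial (0 : ι →₀ ℕ) = 1 := by
  rw [laurentMonomial, Finsupp.mapRange_zero]
  rfl

theorem laurentMonomial_add {ι : Type} (d e : ι →₀ ℕ) :
    laurentMonomial (d + e) = laurentMonomial d * laurentMonomial e := by
  rw [laurentMonomial, laurentMonomial, laurentMonomial, AddMonoidAlgebra.single_mul_single,
    mul_one, Finsupp.mapRange_add fun a b : ℕ => Nat.cast_add a b]

theorem laurentMonomial_sum {ι J : Type} (s : Finset J) (d : J → ι →₀ ℕ) :
    laurentMonomial (∑ j ∈ s, d j) = ∏ j ∈ s, laurentMonomial (d j) := by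
  classical
  induction s using Finset.induction_on with
  | empty => simpa using laurentMonomial_zero
  | insert j s hj ih => rw [Finset.sum_insert hj, Finset.prod_insert hj, laurentMonomial_add, ih]

theorem laurentMonomial_nsmul {ι : Type} (m : ℕ) (d : ι →₀ ℕ) :
    laurentMonomial (m • d) = laurentMonomial d ^ m := by
  induction m with
  | zero => rw [zero_smul, pow_zero, laurentMonomial_zero]
  | succ m ih => rw [succ_nsmul, laurentMonomial_add, ih, pow_succ]

variable {ι : Type} {k : ℕ} {N : Fin k → Type}

/-- The sum of the exponents in a family of multisets. -/
def multiExponent (d : ∀ i, N i → ι →₀ ℕ) (a : ∀ i, Multiset (N i)) : ι →₀ ℕ :=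
  ∑ i, ((a i).map (d i)).sum

/-- A parametrisation of a graded ring by Laurent polynomials such that the component of degree
`m` has as a basis the products of, for each `i`, `m * c i` monomials with exponents `d i a`. -/
structure MonomialModel (d : ∀ i, N i → ι →₀ ℕ) {A : Type} [CommRing A] [Algebra ℂ A]
    (𝒜 : ℕ → Submodule ℂ A) [GradedAlgebra 𝒜] where
  ψ : A →ₐ[ℂ] Laurent ι
  inj : ∀ (l : ℕ) (x : A), x ∈ 𝒜 l → ψ x = 0 → x = 0
  c : Fin k → ℕ
  c_pos : ∀ i, 0 < c i
  span : ∀ m, ∀ x ∈ 𝒜 m, ψ x ∈ Submodule.span ℂ {y | ∃ a : ∀ i, Multiset (N i),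
    (∀ i, (a i).card = m * c i) ∧ y = laurentMonomial (multiExponent d a)}
  ex : ∀ m (a : ∀ i, Multiset (N i)), (∀ i, (a i).card = m * c i) →
    ∃ x ∈ 𝒜 m, ψ x = laurentMonomial (multiExponent d a)

namespace MonomialModel

variable {d : ∀ i, N i → ι →₀ ℕ} {A : Type} [CommRing A] [Algebra ℂ A]
  {𝒜 : ℕ → Submodule ℂ A} [GradedAlgebra 𝒜] (M : MonomialModel d 𝒜)

theorem eq_of_ψ_eq {m : ℕ} {x y : A} (hx : x ∈ 𝒜 m) (hy : y ∈ 𝒜 m) (h : M.ψ x = M.ψ y) :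
    x = y :=
  sub_eq_zero.mp (M.inj m _ (sub_mem hx hy) (by rw [map_sub, h, sub_self]))

/-- The constant family at `p`. -/
def baseFamily (p : ∀ i, N i) (i : Fin k) : Multiset (N i) := Multiset.replicate (M.c i) (p i)

theorem card_baseFamily (p : ∀ i, N i) (i : Fin k) : (M.baseFamily p i).card = 1 * M.c i := by
  rw [baseFamily, Multiset.card_replicate, one_mul]

/-- The constant family at `p` with one entry replaced by `a`. -/
def coordFamily (p : ∀ i, N i) (i : Fin k) (a : N i) : ∀ j, Multiset (N j) :=
  Function.update (M.baseFamily p) i (a ::ₘ Multiset.replicate (M.c i - 1) (p i))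

theorem card_coordFamily (p : ∀ i, N i) (i : Fin k) (a : N i) (j : Fin k) :
    (M.coordFamily p i a j).card = 1 * M.c j := by
  by_cases h : j = i
  · subst h
    rw [coordFamily, Function.update_self, Multiset.card_cons, Multiset.card_replicate, one_mul]
    exact Nat.sub_add_cancel (M.c_pos j)
  · rw [coordFamily, Function.update_of_ne h, card_baseFamily]

/-- Replacing one copy of `p i` by `a` changes the exponent by `d i a - d i (p i)`, written without
subtraction. Thus the element of `coordFamily` over that of `baseFamily` is the coordinate ratio. -/
theorem multiExponent_coordFamily (p : ∀ i, N i) (i : Fin k) (a : N i) :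
    multiExponent d (M.coordFamily p i a) + d i (p i) =
      multiExponent d (M.baseFamily p) + d i a := by
  have h1 : ∀ b : ∀ j, Multiset (N j), multiExponent d b =
      ((b i).map (d i)).sum + ∑ j ∈ Finset.univ.erase i, ((b j).map (d j)).sum := fun b =>
    (Finset.add_sum_erase _ _ (Finset.mem_univ i)).symm
  have h2 : ∑ j ∈ Finset.univ.erase i, ((M.coordFamily p i a j).map (d j)).sum =
      ∑ j ∈ Finset.univ.erase i, ((M.baseFamily p j).map (d j)).sum :=
    Finset.sum_congr rfl fun j hj => by
      rw [coordFamily, Function.update_of_ne (Finset.ne_of_mem_erase hj)]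
  have h3 : ((M.coordFamily p i a i).map (d i)).sum + d i (p i) =
      ((M.baseFamily p i).map (d i)).sum + d i a := by
    obtain ⟨c, hc⟩ := Nat.exists_eq_succ_of_ne_zero (M.c_pos i).ne'
    rw [coordFamily, Function.update_self, baseFamily, hc]
    simp only [Nat.succ_eq_add_one, Nat.add_sub_cancel, Multiset.map_cons, Multiset.sum_cons,
      Multiset.replicate_succ]
    abel
  rw [h1, h1 (M.baseFamily p), h2, add_right_comm, h3, add_right_comm]

/-- The element with a given monomial as image. -/
def elt (m : ℕ) (a : ∀ i, Multiset (N i)) (h : ∀ i, (a i).card = m * M.c i) : A :=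
  (M.ex m a h).choose

theorem elt_mem (m : ℕ) (a : ∀ i, Multiset (N i)) (h : ∀ i, (a i).card = m * M.c i) :
    M.elt m a h ∈ 𝒜 m :=
  (M.ex m a h).choose_spec.1

theorem ψ_elt (m : ℕ) (a : ∀ i, Multiset (N i)) (h : ∀ i, (a i).card = m * M.c i) :
    M.ψ (M.elt m a h) = laurentMonomial (multiExponent d a) :=
  (M.ex m a h).choose_spec.2

theorem mem_of_elt_mem (m : ℕ) (P : Ideal A)
    (hP : ∀ (a : ∀ i, Multiset (N i)) (h : ∀ i, (a i).card = m * M.c i), M.elt m a h ∈ P)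
    (x : A) (hx : x ∈ 𝒜 m) : x ∈ P := by
  have key : ∀ y ∈ Submodule.span ℂ {y | ∃ a : ∀ i, Multiset (N i),
      (∀ i, (a i).card = m * M.c i) ∧ y = laurentMonomial (multiExponent d a)},
      ∃ w ∈ P, w ∈ 𝒜 m ∧ M.ψ w = y := by
    intro y hy
    induction hy using Submodule.span_induction with
    | mem y h =>
      obtain ⟨a, ha, rfl⟩ := h
      exact ⟨M.elt m a ha, hP a ha, M.elt_mem m a ha, M.ψ_elt m a ha⟩
    | zero => exact ⟨0, zero_mem _, zero_mem _, map_zero _⟩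
    | add y z _ _ hy hz =>
      obtain ⟨v, hv, hv', rfl⟩ := hy
      obtain ⟨w, hw, hw', rfl⟩ := hz
      exact ⟨v + w, add_mem hv hw, add_mem hv' hw', map_add _ _ _⟩
    | smul c y _ hy =>
      obtain ⟨v, hv, hv', rfl⟩ := hy
      refine ⟨c • v, ?_, Submodule.smul_mem _ _ hv', map_smul _ _ _⟩
      rw [Algebra.smul_def]
      exact P.mul_mem_left _ hv
  obtain ⟨w, hw, hw', h⟩ := key _ (M.span m x hx)
  rwa [← M.eq_of_ψ_eq hw' hx h]

/-- Take `p i` in `a i`. A large multiple of `a i` contains the `c i` copies of `p i` required by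
the denominator, and what is left over is again an admissible family, of degree `K * m - 1`. -/
theorem exists_pow_eq_mul (m : ℕ) (hm : 0 < m) (a : ∀ i, Multiset (N i))
    (ha : ∀ i, (a i).card = m * M.c i) :
    ∃ (p : ∀ i, N i) (K : ℕ) (y : A),
      M.elt m a ha ^ K = M.elt 1 (M.baseFamily p) (M.card_baseFamily p) * y := by
  classical
  have hne : ∀ i, ∃ b, b ∈ a i := fun i =>
    Multiset.card_pos_iff_exists_mem.mp (by rw [ha]; exact Nat.mul_pos hm (M.c_pos i))
  choose p hp using hne
  -- Any positive number which is at least every `c i` would do; the summand 1 keeps it positive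
  -- even if there are no factors.
  set K := 1 + ∑ i, M.c i with hK
  have hcK : ∀ i, M.c i ≤ K := fun i =>
    (Finset.single_le_sum (f := M.c) (fun _ _ => Nat.zero_le _) (Finset.mem_univ i)).trans
      (Nat.le_add_left _ _)
  have hle : ∀ i, M.baseFamily p i ≤ K • a i := fun i => by
    rw [baseFamily, ← Multiset.le_count_iff_replicate_le, Multiset.count_nsmul]
    exact (hcK i).trans (Nat.le_mul_of_pos_right _ (Multiset.count_pos.mpr (hp i)))
  have hKm : 1 ≤ K * m := Nat.mul_pos (by omega) hm
  have hcard : ∀ i, (K • a i - M.baseFamily p i).card = (K * m - 1) * M.c i := fun i => by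
    rw [Multiset.card_sub (hle i), Multiset.card_nsmul, ha, card_baseFamily, Nat.sub_mul,
      mul_assoc]
  refine ⟨p, K, M.elt (K * m - 1) _ hcard, ?_⟩
  refine M.eq_of_ψ_eq (m := K • m) (SetLike.pow_mem_graded K (M.elt_mem m a ha)) ?_ ?_
  · have := SetLike.mul_mem_graded (M.elt_mem 1 _ (M.card_baseFamily p))
      (M.elt_mem (K * m - 1) _ hcard)
    rwa [Nat.add_sub_cancel' hKm] at this
  · rw [map_pow, map_mul, ψ_elt, ψ_elt, ψ_elt, ← laurentMonomial_add, ← laurentMonomial_nsmul]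
    congr 1
    rw [multiExponent, multiExponent, multiExponent, ← Finset.sum_add_distrib, Finset.smul_sum]
    refine Finset.sum_congr rfl fun i _ => ?_
    rw [← Multiset.sum_add, ← Multiset.map_add, add_tsub_cancel_of_le (hle i),
      Multiset.map_nsmul, Multiset.sum_nsmul]

/-- A point outside all charts is a prime containing every denominator. By `exists_pow_eq_mul` it
contains every monomial element of positive degree, hence the irrelevant ideal, which is excluded.
-/
theorem iSup_basicOpen :
    ⨆ p, Proj.basicOpen 𝒜 (M.elt 1 (M.baseFamily p) (M.card_baseFamily p)) = ⊤ := by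
  refine eq_top_iff.mpr fun x _ => ?_
  rw [TopologicalSpace.Opens.mem_iSup]
  by_contra! h
  have h' : ∀ p, M.elt 1 (M.baseFamily p) (M.card_baseFamily p) ∈ x.asHomogeneousIdeal :=
    fun p => not_not.mp fun hn => h p hn
  refine x.not_irrelevant_le ?_
  rw [HomogeneousIdeal.irrelevant_le]
  intro m hm y hy
  refine M.mem_of_elt_mem m x.asHomogeneousIdeal.toIdeal (fun a ha => ?_) y hy
  obtain ⟨p, K, z, hz⟩ := M.exists_pow_eq_mul m hm a ha
  refine x.isPrime.mem_of_pow_mem K ?_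
  rw [hz]
  exact Ideal.mul_mem_right _ _ (h' p)

theorem isUnit_ψ_elt (m : ℕ) (a : ∀ i, Multiset (N i)) (h : ∀ i, (a i).card = m * M.c i) :
    IsUnit (M.ψ.toRingHom (M.elt m a h)) := by
  change IsUnit (M.ψ (M.elt m a h))
  rw [ψ_elt]
  exact isUnit_laurentMonomial _

theorem ψ_coord (p : ∀ i, N i) (i : Fin k) (a : N i) :
    M.ψ (M.elt 1 (M.coordFamily p i a) (M.card_coordFamily p i a)) * laurentMonomial (d i (p i)) =
      M.ψ (M.elt 1 (M.baseFamily p) (M.card_baseFamily p)) * laurentMonomial (d i a) := by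
  rw [ψ_elt, ψ_elt, ← laurentMonomial_add, ← laurentMonomial_add, multiExponent_coordFamily]

/-- A monomial of degree `m` has `m * c i` factors of type `i`, as many as the `m`-th power of the
denominator, so the quotient is a product of coordinate ratios. These identities are checked in the
Laurent ring, into which the chart embeds. -/
theorem subring_eq_top (p : ∀ i, N i) :
    ∀ R : Subring (HomogeneousLocalization.Away 𝒜
      (M.elt 1 (M.baseFamily p) (M.card_baseFamily p))),
    (∀ c, awayConst 𝒜 (M.elt 1 (M.baseFamily p) (M.card_baseFamily p)) c ∈ R) →
    (∀ i a, HomogeneousLocalization.Away.mk 𝒜 (M.elt_mem 1 _ (M.card_baseFamily p)) 1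
      (M.elt 1 (M.coordFamily p i a) (M.card_coordFamily p i a))
      (M.elt_mem 1 _ (M.card_coordFamily p i a)) ∈ R) → R = ⊤ := by
  set t := M.elt 1 (M.baseFamily p) (M.card_baseFamily p) with ht
  have htm : t ∈ 𝒜 1 := M.elt_mem 1 _ (M.card_baseFamily p)
  have hu := M.isUnit_ψ_elt 1 _ (M.card_baseFamily p)
  intro R hc hR
  set χ := awayEval 𝒜 M.ψ.toRingHom t hu with hχ
  have hψt : M.ψ t = laurentMonomial (multiExponent d (M.baseFamily p)) := M.ψ_elt _ _ _
  have hinj : Function.Injective χ := awayEval_injective 𝒜 M.ψ.toRingHom t hu htm M.inj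
  have hcoord : ∀ i a, ∃ w ∈ R, χ w * laurentMonomial (d i (p i)) = laurentMonomial (d i a) := by
    intro i a
    refine ⟨_, hR i a, ?_⟩
    have h1 := awayEval_mk_mul 𝒜 M.ψ.toRingHom t hu htm 1 _
      (M.elt_mem 1 _ (M.card_coordFamily p i a))
    refine hu.mul_left_cancel ?_
    refine Eq.trans ?_ (M.ψ_coord p i a)
    rw [← mul_assoc]
    congr 1
    refine Eq.trans ?_ h1
    rw [pow_one, mul_comm]
  have hmulti : ∀ i (s : Multiset (N i)), ∃ w ∈ R,
      χ w * laurentMonomial (s.card • d i (p i)) = laurentMonomial (s.map (d i)).sum := by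
    intro i s
    induction s using Multiset.induction_on with
    | empty => exact ⟨1, one_mem _, by simp [laurentMonomial_zero]⟩
    | cons a s ih =>
      obtain ⟨w, hw, h⟩ := ih
      obtain ⟨v, hv, h'⟩ := hcoord i a
      refine ⟨v * w, mul_mem hv hw, ?_⟩
      rw [Multiset.card_cons, Multiset.map_cons, Multiset.sum_cons, laurentMonomial_add, ← h, ← h',
        succ_nsmul, laurentMonomial_add, map_mul]
      ring
  have hfam : ∀ m (a : ∀ i, Multiset (N i)), (∀ i, (a i).card = m * M.c i) → ∃ w ∈ R,
      χ w * M.ψ t ^ m = laurentMonomial (multiExponent d a) := by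
    intro m a ha
    choose w hw h using fun i => hmulti i (a i)
    refine ⟨∏ i, w i, prod_mem fun i _ => hw i, ?_⟩
    rw [multiExponent, laurentMonomial_sum, ← Finset.prod_congr rfl fun i _ => h i,
      Finset.prod_mul_distrib, map_prod, ← laurentMonomial_sum, hψt, ← laurentMonomial_nsmul,
      multiExponent, Finset.smul_sum]
    congr 2
    refine Finset.sum_congr rfl fun i _ => ?_
    rw [ha, baseFamily, Multiset.map_replicate, Multiset.sum_replicate, mul_smul]
  have hconst : ∀ c, χ (awayConst 𝒜 t c) = algebraMap ℂ (Laurent ι) c := by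
    intro c
    have := RingHom.congr_fun (awayEval_comp_fromZeroRingHom 𝒜 M.ψ.toRingHom t hu)
      (algebraMap ℂ (𝒜 0) c)
    exact this.trans (M.ψ.commutes c)
  have hspan : ∀ m, ∀ y ∈ Submodule.span ℂ {y | ∃ a : ∀ i, Multiset (N i),
      (∀ i, (a i).card = m * M.c i) ∧ y = laurentMonomial (multiExponent d a)},
      ∃ w ∈ R, χ w * M.ψ t ^ m = y := by
    intro m y hy
    induction hy using Submodule.span_induction with
    | mem y h =>
      obtain ⟨a, ha, rfl⟩ := h
      exact hfam m a ha
    | zero => exact ⟨0, zero_mem _, by rw [map_zero, zero_mul]⟩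
    | add y z _ _ hy hz =>
      obtain ⟨v, hv, rfl⟩ := hy
      obtain ⟨w, hw, rfl⟩ := hz
      exact ⟨v + w, add_mem hv hw, by rw [map_add, add_mul]⟩
    | smul c y _ hy =>
      obtain ⟨v, hv, rfl⟩ := hy
      refine ⟨awayConst 𝒜 t c * v, mul_mem (hc c) hv, ?_⟩
      rw [map_mul, hconst, Algebra.smul_def, mul_assoc]
  refine eq_top_iff.mpr fun z _ => ?_
  obtain ⟨l, x, hx, rfl⟩ := HomogeneousLocalization.Away.mk_surjective 𝒜 htm z
  have hx' : x ∈ 𝒜 l := by simpa using hx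
  obtain ⟨w, hw, h⟩ := hspan l _ (M.span l x hx')
  have h2 := awayEval_mk_mul 𝒜 M.ψ.toRingHom t hu htm l x hx
  have : w = HomogeneousLocalization.Away.mk 𝒜 htm l x hx :=
    hinj ((hu.pow l).mul_right_cancel (h.trans h2.symm))
  exact this ▸ hw

/-- The charts given by the monomials. -/
def toricAtlas : ToricAtlas d 𝒜 where
  ψ := M.ψ
  inj := M.inj
  f p := M.elt 1 (M.baseFamily p) (M.card_baseFamily p)
  f_mem _ := M.elt_mem 1 _ _
  isUnit_ψ_f _ := M.isUnit_ψ_elt _ _ _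
  cover := M.iSup_basicOpen
  g p i a := M.elt 1 (M.coordFamily p i a) (M.card_coordFamily p i a)
  g_mem _ _ _ := M.elt_mem 1 _ _
  ψ_g p i a := M.ψ_coord p i a
  gen p R hc hR := M.subring_eq_top p R hc hR

end MonomialModel

end MonomialModel

/-! ## Rings of semi-invariants -/

section SemiInvariants

variable {I E : Type} [Fintype I] [Fintype E]

/-- The exponents whose monomials are semi-invariant of weight `θ^m`. -/
def IsFlow (D : E → I → ℤ) (θ : I → ℤ) (m : ℕ) (u : E →₀ ℕ) : Prop :=
  ∀ v, ∑ a, (u a : ℤ) * D a v = m * θ v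

theorem zpow_sum_eq_prod {J G : Type} [CommGroup G] (s : Finset J) (g : G) (k : J → ℤ) :
    g ^ (∑ j ∈ s, k j) = ∏ j ∈ s, g ^ k j := by
  classical
  induction s using Finset.induction_on with
  | empty => rw [Finset.sum_empty, Finset.prod_empty, zpow_zero]
  | insert j s hj ih => rw [Finset.sum_insert hj, Finset.prod_insert hj, zpow_add, ih]

theorem actOn_monomial (D : E → I → ℤ) (g : I → ℂˣ) (u : E →₀ ℕ) (c : ℂ) :
    actOn D g (MvPolynomial.monomial u c) =
      MvPolynomial.monomial u
        (((character (fun v => ∑ a, (u a : ℤ) * D a v) g : ℂˣ) : ℂ) * c) := by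
  have hchar : character (fun v => ∑ a, (u a : ℤ) * D a v) g = ∏ a, character (D a) g ^ u a := by
    simp only [character]
    simp_rw [← Finset.prod_pow]
    rw [Finset.prod_comm]
    refine Finset.prod_congr rfl fun v _ => ?_
    rw [zpow_sum_eq_prod]
    refine Finset.prod_congr rfl fun a _ => ?_
    rw [mul_comm, zpow_mul, zpow_natCast]
  rw [actOn, MvPolynomial.aeval_monomial, Finsupp.prod_fintype _ _ fun _ => pow_zero _,
    MvPolynomial.monomial_eq, Finsupp.prod_fintype _ _ fun _ => pow_zero _, hchar]
  simp_rw [mul_pow, Finset.prod_mul_distrib, ← map_pow, ← map_prod]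
  rw [MvPolynomial.algebraMap_eq, ← mul_assoc, ← map_mul]
  congr 2
  push_cast
  ring

theorem coeff_actOn (D : E → I → ℤ) (g : I → ℂˣ) (f : MvPolynomial E ℂ) (u : E →₀ ℕ) :
    (actOn D g f).coeff u =
      ((character (fun v => ∑ a, (u a : ℤ) * D a v) g : ℂˣ) : ℂ) * f.coeff u := by
  classical
  induction f using MvPolynomial.induction_on' with
  | monomial w c =>
    rw [actOn_monomial, MvPolynomial.coeff_monomial, MvPolynomial.coeff_monomial]
    split_ifs with h
    · rw [h]
    · rw [mul_zero]
  | add p q hp hq => rw [map_add, MvPolynomial.coeff_add, MvPolynomial.coeff_add, hp, hq, mul_add]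

theorem character_nat_mul (θ : I → ℤ) (m : ℕ) (g : I → ℂˣ) :
    character (fun v => m * θ v) g = character θ g ^ m := by
  rw [character, character, ← Finset.prod_pow]
  refine Finset.prod_congr rfl fun v _ => ?_
  rw [mul_comm, zpow_mul, zpow_natCast]

/-- Evaluating at the tuple with 2 at `v` and 1 elsewhere isolates 2 to the power `w v`; passing to
norms shows that these powers are distinct. -/
theorem character_injective {w w' : I → ℤ} (h : ∀ g, character w g = character w' g) : w = w' := by
  classical
  funext v
  have h2 : (2 : ℂ) ≠ 0 := two_ne_zero
  have key : ∀ w : I → ℤ, character w (Function.update 1 v (Units.mk0 2 h2)) =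
      Units.mk0 2 h2 ^ w v := by
    intro w
    rw [character, Finset.prod_eq_single v]
    · rw [Function.update_self]
    · intro b _ hb
      rw [Function.update_of_ne hb, Pi.one_apply, one_zpow]
    · intro hv
      exact absurd (Finset.mem_univ v) hv
  have h3 := h (Function.update 1 v (Units.mk0 2 h2))
  rw [key, key] at h3
  have h4 := congrArg (fun x : ℂˣ => ‖(x : ℂ)‖) h3
  simp only [Units.val_zpow_eq_zpow_val, Units.val_mk0, norm_zpow, Complex.norm_ofNat] at h4
  exact zpow_right_injective₀ (by norm_num) (by norm_num) h4

/-- The torus acts diagonally on monomials, so semi-invariance is a condition on each monomial of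
the support: two characters agree, and therefore so do their weights. -/
theorem mem_semiInvariants_iff (D : E → I → ℤ) (θ : I → ℤ) (m : ℕ) (f : MvPolynomial E ℂ) :
    f ∈ semiInvariants D θ m ↔ ∀ u, f.coeff u ≠ 0 → IsFlow D θ m u := by
  constructor
  · intro hf u hu
    refine congrFun (character_injective (w := fun v => ∑ a, (u a : ℤ) * D a v)
      (w' := fun v => m * θ v) fun g => ?_)
    have h := congrArg (MvPolynomial.coeff u) (hf g)
    rw [coeff_actOn, MvPolynomial.coeff_smul, smul_eq_mul] at h
    rw [character_nat_mul]
    have := mul_right_cancel₀ hu h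
    exact Units.ext (by simpa using this)
  · intro hf g
    refine MvPolynomial.ext _ _ fun u => ?_
    rw [coeff_actOn, MvPolynomial.coeff_smul, smul_eq_mul]
    by_cases hu : f.coeff u = 0
    · rw [hu, mul_zero, mul_zero]
    · rw [show (fun v => ∑ a, (u a : ℤ) * D a v) = fun v => m * θ v from funext (hf u hu),
        character_nat_mul, Units.val_pow_eq_pow_val]

variable {ι : Type}

/-- The total exponent of `u` when the coordinate of `a` is replaced by a monomial with
exponents `h a`. -/
def totalExponent (h : E → ι →₀ ℕ) (u : E →₀ ℕ) : ι →₀ ℕ := ∑ a, u a • h a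

theorem aeval_laurentMonomial (h : E → ι →₀ ℕ) (f : MvPolynomial E ℂ) :
    MvPolynomial.aeval (R := ℂ) (fun a => laurentMonomial (h a)) f =
      ∑ u ∈ f.support, f.coeff u • laurentMonomial (totalExponent h u) := by
  conv_lhs => rw [f.as_sum, map_sum]
  refine Finset.sum_congr rfl fun u _ => ?_
  rw [MvPolynomial.aeval_monomial, Finsupp.prod_fintype _ _ fun _ => pow_zero _, totalExponent,
    laurentMonomial_sum, Algebra.smul_def]
  simp_rw [laurentMonomial_nsmul]

theorem linearIndependent_laurentMonomial :
    LinearIndependent ℂ (laurentMonomial (ι := ι)) := by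
  classical
  refine linearIndependent_iff'.mpr fun s c hs d hd => ?_
  have h := congrArg
    (fun x : Laurent ι => x.coeff (d.mapRange (fun m : ℕ => (m : ℤ)) Nat.cast_zero)) hs
  simp only [AddMonoidAlgebra.coeff_sum, Finsupp.finsetSum_apply, AddMonoidAlgebra.coeff_zero,
    Finsupp.zero_apply, laurentMonomial, AddMonoidAlgebra.smul_single, smul_eq_mul, mul_one,
    AddMonoidAlgebra.coeff_single, Finsupp.single_apply,
    (Finsupp.mapRange_injective _ Nat.cast_zero Nat.cast_injective).eq_iff] at h
  rw [Finset.sum_ite_eq' s d c, if_pos hd] at h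
  exact h

/-- Substitution of monomials for the coordinates, as a function on the ring of semi-invariants. -/
def semiInvariantSubst (D : E → I → ℤ) (θ : I → ℤ) (h : E → ι →₀ ℕ) :
    semiInvariantRing D θ →ₐ[ℂ] Laurent ι :=
  ((MvPolynomial.aeval (R := ℂ) fun a => laurentMonomial (h a)).comp
    -- The variable that records the grading is sent to 1; injectivity is only claimed within one
    -- degree.
    ((Polynomial.aeval (R := MvPolynomial E ℂ) 1).restrictScalars ℂ)).comp
    (semiInvariantRing D θ).val

theorem semiInvariantSubst_of_mem (D : E → I → ℤ) (θ : I → ℤ) (h : E → ι →₀ ℕ) (m : ℕ)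
    (F : semiInvariantRing D θ) (hF : F ∈ semiInvariantGrading D θ m) :
    semiInvariantSubst D θ h F =
      ∑ u ∈ ((F : Polynomial (MvPolynomial E ℂ)).coeff m).support,
        ((F : Polynomial (MvPolynomial E ℂ)).coeff m).coeff u •
          laurentMonomial (totalExponent h u) := by
  rw [← aeval_laurentMonomial]
  have h1 : (F : Polynomial (MvPolynomial E ℂ)) =
      Polynomial.monomial m ((F : Polynomial (MvPolynomial E ℂ)).coeff m) := by
    ext1 l
    rw [Polynomial.coeff_monomial]
    split_ifs with hl
    · rw [hl]
    · exact hF l (Ne.symm hl)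
  change MvPolynomial.aeval (R := ℂ) (fun a => laurentMonomial (h a))
    (Polynomial.aeval (1 : MvPolynomial E ℂ) (F : Polynomial (MvPolynomial E ℂ))) = _
  congr 1
  conv_lhs => rw [h1]
  simp [Polynomial.aeval_monomial]

/-- The monomial with exponents `u` in degree `m`. -/
def semiInvariantMonomial (D : E → I → ℤ) (θ : I → ℤ) (m : ℕ) (u : E →₀ ℕ)
    (hu : IsFlow D θ m u) : semiInvariantRing D θ :=
  ⟨Polynomial.monomial m (MvPolynomial.monomial u 1), fun l => by
    classical
    rw [Polynomial.coeff_monomial]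
    split_ifs with h
    · subst h
      rw [mem_semiInvariants_iff]
      intro w hw
      rw [MvPolynomial.coeff_monomial] at hw
      rw [← of_not_not fun hne : u ≠ w => hw (if_neg hne)]
      exact hu
    · exact zero_mem _⟩

theorem semiInvariantMonomial_mem (D : E → I → ℤ) (θ : I → ℤ) (m : ℕ) (u : E →₀ ℕ)
    (hu : IsFlow D θ m u) :
    semiInvariantMonomial D θ m u hu ∈ semiInvariantGrading D θ m := by
  intro l hl
  change (Polynomial.monomial m (MvPolynomial.monomial u (1 : ℂ))).coeff l = 0
  rw [Polynomial.coeff_monomial, if_neg (Ne.symm hl)]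

theorem semiInvariantSubst_monomial (D : E → I → ℤ) (θ : I → ℤ) (h : E → ι →₀ ℕ) (m : ℕ)
    (u : E →₀ ℕ) (hu : IsFlow D θ m u) :
    semiInvariantSubst D θ h (semiInvariantMonomial D θ m u hu) =
      laurentMonomial (totalExponent h u) := by
  classical
  change MvPolynomial.aeval (R := ℂ) (fun a => laurentMonomial (h a))
    (Polynomial.aeval (1 : MvPolynomial E ℂ)
      (Polynomial.monomial m (MvPolynomial.monomial u (1 : ℂ)))) = _
  rw [Polynomial.aeval_monomial, one_pow, mul_one]
  change MvPolynomial.aeval (R := ℂ) (fun a => laurentMonomial (h a))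
    (MvPolynomial.monomial u (1 : ℂ)) = _
  rw [aeval_laurentMonomial, MvPolynomial.support_monomial, if_neg one_ne_zero,
    Finset.sum_singleton, MvPolynomial.coeff_monomial, if_pos rfl, one_smul]

/-- If the total exponents of flows of weight `m θ` are exactly the sums of, for each `i`,
`m * c i` of the exponents `d i a`, and determine the flow, then the ring of semi-invariants is a
monomial model. -/
def flowModel {k : ℕ} {N : Fin k → Type} (d : ∀ i, N i → ι →₀ ℕ) (D : E → I → ℤ) (θ : I → ℤ)
    (h : E → ι →₀ ℕ) (c : Fin k → ℕ) (c_pos : ∀ i, 0 < c i)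
    (inj : ∀ m u w, IsFlow D θ m u → IsFlow D θ m w → totalExponent h u = totalExponent h w →
      u = w)
    (decomp : ∀ m u, IsFlow D θ m u → ∃ a : ∀ i, Multiset (N i), (∀ i, (a i).card = m * c i) ∧
      totalExponent h u = multiExponent d a)
    (ex : ∀ m (a : ∀ i, Multiset (N i)), (∀ i, (a i).card = m * c i) →
      ∃ u, IsFlow D θ m u ∧ totalExponent h u = multiExponent d a) :
    MonomialModel (A := semiInvariantRing D θ) d (semiInvariantGrading D θ) where
  ψ := semiInvariantSubst D θ h
  inj m F hF h0 := by
    rw [semiInvariantSubst_of_mem D θ h m F hF] at h0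
    have hflow := (mem_semiInvariants_iff D θ m _).mp (F.2 m)
    set f := (F : Polynomial (MvPolynomial E ℂ)).coeff m with hf
    have hinj : Set.InjOn (totalExponent h) f.support := fun u hu w hw he =>
      inj m u w (hflow u (MvPolynomial.mem_support_iff.mp hu))
        (hflow w (MvPolynomial.mem_support_iff.mp hw)) he
    have hli : LinearIndepOn ℂ (fun u => laurentMonomial (totalExponent h u))
        (f.support : Set (E →₀ ℕ)) :=
      linearIndependent_laurentMonomial.comp (fun u : f.support => totalExponent h u)
        (fun u w he => Subtype.ext (hinj u.2 w.2 he))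
    have hz := (linearIndepOn_finset_iff.mp hli) f.coeff h0
    have hf0 : f = 0 := MvPolynomial.ext _ _ fun u => by
      by_contra hu
      exact hu (hz u (MvPolynomial.mem_support_iff.mpr hu))
    refine Subtype.ext (Polynomial.ext fun l => ?_)
    by_cases hl : l = m
    · subst hl
      exact hf0
    · exact hF l hl
  c := c
  c_pos := c_pos
  span m F hF := by
    rw [semiInvariantSubst_of_mem D θ h m F hF]
    refine Submodule.sum_mem _ fun u hu => Submodule.smul_mem _ _ (Submodule.subset_span ?_)
    obtain ⟨a, ha, he⟩ := decomp m u
      ((mem_semiInvariants_iff D θ m _).mp (F.2 m) u (MvPolynomial.mem_support_iff.mp hu))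
    exact ⟨a, ha, by rw [he]⟩
  ex m a ha := by
    obtain ⟨u, hu, he⟩ := ex m a ha
    exact ⟨semiInvariantMonomial D θ m u hu, semiInvariantMonomial_mem D θ m u hu,
      (semiInvariantSubst_monomial D θ h m u hu).trans (congrArg _ he)⟩

end SemiInvariants

/-! ## Lists of lattice points -/

section Lists

variable {α : Type}

/-- The sum of the weights of the consecutive pairs of a list. -/
def pathSum {M : Type} [AddCommMonoid M] (w : α → α → M) : List α → M
  | p :: q :: l => w p q + pathSum w (q :: l)
  | _ => 0

section PathSum

variable {M : Type} [AddCommMonoid M] (w : α → α → M)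

@[simp]
theorem pathSum_singleton (p : α) : pathSum w [p] = 0 := rfl

@[simp]
theorem pathSum_cons_cons (p q : α) (l : List α) :
    pathSum w (p :: q :: l) = w p q + pathSum w (q :: l) := rfl

theorem pathSum_append_pair (l : List α) (p q : α) :
    pathSum w (l ++ [p, q]) = pathSum w (l ++ [p]) + w p q := by
  induction l with
  | nil => simp
  | cons a l ih =>
    cases l with
    | nil => simp
    | cons b l =>
      rw [List.cons_append] at ih
      simp only [List.cons_append, pathSum_cons_cons] at ih ⊢
      rw [ih, add_assoc]

theorem map_pathSum {M' : Type} [AddCommMonoid M'] (f : M →+ M') (l : List α) :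
    f (pathSum w l) = pathSum (fun p q => f (w p q)) l := by
  induction l with
  | nil => exact map_zero f
  | cons a l ih =>
    cases l with
    | nil => exact map_zero f
    | cons b l => rw [pathSum_cons_cons, map_add, ih, pathSum_cons_cons]

theorem pathSum_add (w' : α → α → M) (l : List α) :
    pathSum (fun p q => w p q + w' p q) l = pathSum w l + pathSum w' l := by
  induction l with
  | nil => exact (add_zero _).symm
  | cons a l ih =>
    cases l with
    | nil => exact (add_zero _).symm
    | cons b l =>
      rw [pathSum_cons_cons, ih, pathSum_cons_cons, pathSum_cons_cons, add_add_add_comm]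

theorem pathSum_congr {R : α → α → Prop} {w w' : α → α → M} (h : ∀ p q, R p q → w p q = w' p q)
    {l : List α} (hl : l.IsChain R) : pathSum w l = pathSum w' l := by
  induction l with
  | nil => rfl
  | cons a l ih =>
    cases l with
    | nil => rfl
    | cons b l =>
      rw [List.isChain_cons_cons] at hl
      rw [pathSum_cons_cons, pathSum_cons_cons, ih hl.2, h _ _ hl.1]

end PathSum

theorem pathSum_telescope {M : Type} [AddCommGroup M] (f : α → M) (p : α) (l : List α) (q : α) :
    pathSum (fun p q => f q - f p) (p :: (l ++ [q])) = f q - f p := by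
  induction l generalizing p with
  | nil => simp
  | cons a l ih => rw [List.cons_append, pathSum_cons_cons, ih]; abel

open Classical in
/-- The indicator of a proposition. -/
def propIndicator (P : Prop) : ℤ := if P then 1 else 0

theorem propIndicator_of {P : Prop} (h : P) : propIndicator P = 1 := if_pos h

theorem propIndicator_of_not {P : Prop} (h : ¬ P) : propIndicator P = 0 := if_neg h

theorem propIndicator_nonneg (P : Prop) : 0 ≤ propIndicator P := by
  by_cases h : P
  · rw [propIndicator_of h]
    exact zero_le_one
  · rw [propIndicator_of_not h]

theorem exists_of_pathSum_ne_zero (p q : α) (l : List α)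
    (h : pathSum (fun x y => propIndicator (x = p ∧ y = q)) l ≠ 0) :
    ∃ A B, l = A ++ p :: q :: B := by
  induction l with
  | nil => exact absurd rfl h
  | cons a l ih =>
    cases l with
    | nil => exact absurd rfl h
    | cons b l =>
      by_cases hab : a = p ∧ b = q
      · exact ⟨[], l, by rw [hab.1, hab.2]; rfl⟩
      · rw [pathSum_cons_cons, propIndicator_of_not hab, zero_add] at h
        obtain ⟨A, B, hAB⟩ := ih h
        exact ⟨a :: A, B, by rw [hAB]; rfl⟩

theorem pathSum_pos (p q : α) (A B : List α) :
    0 < pathSum (fun x y => propIndicator (x = p ∧ y = q)) (A ++ p :: q :: B) := by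
  have hnn : ∀ l : List α,
      0 ≤ pathSum (fun x y => propIndicator (x = p ∧ y = q)) l := by
    intro l
    induction l with
    | nil => exact le_rfl
    | cons a l ih =>
      cases l with
      | nil => exact le_rfl
      | cons b l =>
        rw [pathSum_cons_cons]
        exact add_nonneg (propIndicator_nonneg _) ih
  induction A with
  | nil =>
    rw [List.nil_append, pathSum_cons_cons, propIndicator_of ⟨rfl, rfl⟩]
    linarith [hnn (q :: B)]
  | cons a A ih =>
    obtain ⟨b, l, hbl⟩ : ∃ b l, A ++ p :: q :: B = b :: l := by
      cases A with
      | nil => exact ⟨_, _, rfl⟩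
      | cons b A => exact ⟨_, _, rfl⟩
    rw [List.cons_append, hbl, pathSum_cons_cons, ← hbl]
    exact add_pos_of_nonneg_of_pos (propIndicator_nonneg _) ih

/-- Chains which end at their first point satisfying `V`. -/
inductive FirstHit (V : α → Prop) (R : α → α → Prop) : List α → Prop
  | last (t : α) : V t → FirstHit V R [t]
  | cons (p q : α) (l : List α) : ¬ V p → R p q → FirstHit V R (q :: l) → FirstHit V R (p :: q :: l)

variable {V : α → Prop} {R : α → α → Prop}

theorem firstHit_of_isChain (m : List α) (t : α) (hm : ∀ p ∈ m, ¬ V p) (ht : V t)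
    (hc : (m ++ [t]).IsChain R) : FirstHit V R (m ++ [t]) := by
  induction m with
  | nil => exact .last t ht
  | cons p m ih =>
    cases m with
    | nil =>
      rw [List.cons_append, List.nil_append, List.isChain_cons_cons] at hc
      exact .cons _ _ _ (hm p (by simp)) hc.1 (ih (by simp) hc.2)
    | cons q m =>
      rw [List.cons_append, List.cons_append, List.isChain_cons_cons] at hc
      exact .cons _ _ _ (hm p (by simp)) hc.1 (ih (fun z hz => hm z (by simp [hz])) hc.2)

theorem FirstHit.exists_eq_append {l : List α} (h : FirstHit V R l) :
    ∃ m t, l = m ++ [t] ∧ (∀ p ∈ m, ¬ V p) ∧ V t := by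
  induction h with
  | last t ht => exact ⟨[], t, rfl, by simp, ht⟩
  | cons p q l hp _ _ ih =>
    obtain ⟨m, t, h, hm, ht⟩ := ih
    refine ⟨p :: m, t, by rw [h]; rfl, fun z hz => ?_, ht⟩
    rcases List.mem_cons.mp hz with rfl | hz
    · exact hp
    · exact hm z hz

theorem FirstHit.isChain {l : List α} (h : FirstHit V R l) : l.IsChain R := by
  induction h with
  | last t _ => exact List.isChain_singleton t
  | cons p q l _ hpq _ ih => exact List.isChain_cons_cons.mpr ⟨hpq, ih⟩

theorem FirstHit.suffix {A : List α} {q : α} {B : List α} (h : FirstHit V R (A ++ q :: B)) :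
    FirstHit V R (q :: B) := by
  induction A with
  | nil => exact h
  | cons a A ih =>
    refine ih ?_
    generalize hl : A ++ q :: B = l at h
    rw [List.cons_append, hl] at h
    cases h with
    | last => cases A <;> simp at hl
    | cons _ _ _ _ _ h => exact h

theorem FirstHit.eq_nil {p : α} {l : List α} (h : FirstHit V R (p :: l)) (hp : V p) : l = [] := by
  cases h with
  | last => rfl
  | cons _ _ _ h => exact absurd hp h

/-- The invariant `Q` makes the successor of a point outside `V` unique and passes to that
successor, so the walk to the first point of `V` is deterministic. -/
theorem FirstHit.unique {Q : α → Prop}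
    (hQ : ∀ p q q', Q p → ¬ V p → R p q → R p q' → q = q' ∧ Q q) {p : α} {l l' : List α}
    (hp : Q p) (h : FirstHit V R (p :: l)) (h' : FirstHit V R (p :: l')) : l = l' := by
  induction l generalizing p l' with
  | nil =>
    cases h with
    | last _ ht => exact (h'.eq_nil ht).symm
  | cons q l ih =>
    cases h with
    | cons _ _ _ hV hpq h =>
      cases h' with
      | last _ ht => exact absurd ht hV
      | cons _ q' _ _ hpq' h' =>
        obtain ⟨rfl, hq⟩ := hQ _ _ _ hp hV hpq hpq'
        rw [ih hq h h']

theorem exists_firstHit {Q : α → Prop} (μ : α → ℕ)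
    (hQ : ∀ p, Q p → ¬ V p → ∃ q, R p q ∧ Q q ∧ μ q < μ p) (p : α) (hp : Q p) :
    ∃ l, FirstHit V R (p :: l) := by
  induction hm : μ p using Nat.strong_induction_on generalizing p with
  | _ m ih =>
    by_cases hV : V p
    · exact ⟨[], .last p hV⟩
    · obtain ⟨q, hpq, hq, hlt⟩ := hQ p hp hV
      obtain ⟨l, hl⟩ := ih _ (hm ▸ hlt) q hq rfl
      exact ⟨q :: l, .cons _ _ _ hV hpq hl⟩

end Lists

/-! ## The ladder diagram -/

section Diagram

variable (n : ℕ) {ρ : ℕ} (r : Fin ρ → ℕ)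

/-- The lattice point `(x, y)` lies in the ladder diagram. -/
def InDiagram (x y : ℕ) : Prop := ∃ i, x ≤ n - r i ∧ y ≤ r i

variable {n r}

/-- The conditions `n > r_1 > ⋯ > r_ρ > 0` and `ρ ≥ 1`. -/
structure IsLadder (n : ℕ) {ρ : ℕ} (r : Fin ρ → ℕ) : Prop where
  nonempty : 0 < ρ
  anti : StrictAnti r
  pos : ∀ i, 0 < r i
  lt : ∀ i, r i < n

theorem InDiagram.mono {x y x' y' : ℕ} (h : InDiagram n r x y) (hx : x' ≤ x) (hy : y' ≤ y) :
    InDiagram n r x' y' :=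
  h.imp fun _ hi => ⟨hx.trans hi.1, hy.trans hi.2⟩

theorem InDiagram.add_le {x y : ℕ} (H : IsLadder n r) (h : InDiagram n r x y) : x + y ≤ n := by
  obtain ⟨i, hi⟩ := h
  have := H.lt i
  omega

theorem Step.inDiagram {p q : Pt n} (h : Step n r p q) : InDiagram n r q.1 q.2 := h.2

theorem Step.inDiagram_left {p q : Pt n} (h : Step n r p q) : InDiagram n r p.1 p.2 :=
  h.inDiagram.mono (by have := h.1; omega) (by have := h.1; omega)

theorem Step.height_eq {p q : Pt n} (h : Step n r p q) :
    Pt.height n q = Pt.height n p + 1 := by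
  have := h.1
  simp only [Pt.height]
  omega

theorem Pt.ext_val {p q : Pt n} (h1 : p.1.val = q.1.val) (h2 : p.2.val = q.2.val) : p = q :=
  Prod.ext (Fin.ext h1) (Fin.ext h2)

theorem exists_pt (H : IsLadder n r) {x y : ℕ} (h : InDiagram n r x y) :
    ∃ p : Pt n, p.1.val = x ∧ p.2.val = y := by
  have := h.add_le H
  exact ⟨(⟨x, by omega⟩, ⟨y, by omega⟩), rfl, rfl⟩

/-- A local description replacing the list of vertices: off the axes, a point is a vertex if the
diagram continues in both directions or in neither. Interior points and crossings continue in both,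
corners in neither. -/
theorem isVertex_iff (H : IsLadder n r) {p : Pt n}
    (hp : 0 < p.1.val + p.2.val) (hD : InDiagram n r p.1 p.2) :
    IsVertex n r p ↔ 1 ≤ p.1.val ∧ 1 ≤ p.2.val ∧
      (InDiagram n r (p.1 + 1) p.2 ↔ InDiagram n r p.1 (p.2 + 1)) := by
  constructor
  · rintro (h | ⟨i, h⟩ | ⟨i, h⟩ | ⟨i, j, hij, h⟩)
    · omega
    · have := H.lt i
      have := H.pos i
      refine ⟨by omega, by omega, ?_⟩
      constructor
      · rintro ⟨j, hj⟩
        have := H.lt j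
        omega
      · rintro ⟨j, hj⟩
        have := H.lt j
        omega
    · exact ⟨by omega, by omega, fun _ => ⟨i, by omega, by omega⟩, fun _ => ⟨i, by omega, by omega⟩⟩
    · have := H.lt i
      have := H.pos j
      have : r j < r i := H.anti (Fin.lt_def.mpr (by omega))
      exact ⟨by omega, by omega, fun _ => ⟨i, by omega, by omega⟩, fun _ => ⟨j, by omega, by omega⟩⟩
  · rintro ⟨hx, hy, h⟩
    by_cases hf : InDiagram n r (p.1 + 1) p.2
    · obtain ⟨j, hj⟩ := h.mp hf
      obtain ⟨i, hi⟩ := hf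
      by_cases h1 : p.2.val < r i
      · exact Or.inr (Or.inr (Or.inl ⟨i, by omega, by omega, by omega, h1⟩))
      by_cases h2 : p.1.val < n - r j
      · exact Or.inr (Or.inr (Or.inl ⟨j, by omega, by omega, by omega, by omega⟩))
      -- Here the point lies on the top side of grid `i` and on the right side of grid `j`. If the
      -- grids are consecutive this is a crossing; otherwise the point is interior to grid `j + 1`.
      have hji : j < i := H.anti.lt_iff_gt.mp (by omega)
      by_cases hs : j.val + 1 = i.val
      · exact Or.inr (Or.inr (Or.inr ⟨j, i, hs, by omega, by omega⟩))
      have hlt : j.val + 1 < ρ := by have := i.2; have := Fin.lt_def.mp hji; omega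
      have h3 : r ⟨j.val + 1, hlt⟩ < r j := H.anti (Fin.lt_def.mpr (by simp))
      have h4 : r i < r ⟨j.val + 1, hlt⟩ :=
        H.anti (Fin.lt_def.mpr (by have := Fin.lt_def.mp hji; simp only; omega))
      have := H.lt j
      exact Or.inr (Or.inr (Or.inl ⟨⟨j.val + 1, hlt⟩, by omega, by omega, by omega, by omega⟩))
    · have hf' : ¬ InDiagram n r p.1 (p.2 + 1) := fun h' => hf (h.mpr h')
      obtain ⟨i, hi⟩ := hD
      refine Or.inr (Or.inl ⟨i, ?_, ?_⟩)
      · by_contra hne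
        exact hf ⟨i, by omega, by omega⟩
      · by_contra hne
        exact hf' ⟨i, by omega, by omega⟩

theorem IsVertex.inDiagram (H : IsLadder n r) {p : Pt n} (h : IsVertex n r p) :
    InDiagram n r p.1 p.2 := by
  obtain h | ⟨i, h⟩ | ⟨i, h⟩ | ⟨i, j, hij, h⟩ := h
  · exact ⟨⟨0, H.nonempty⟩, by omega, by omega⟩
  · exact ⟨i, by omega, by omega⟩
  · exact ⟨i, by omega, by omega⟩
  · have : r j < r i := H.anti (Fin.lt_def.mpr (by omega))
    exact ⟨i, by omega, by omega⟩

/-- The point lies on a coordinate axis. -/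
def Pt.OnAxis (p : Pt n) : Prop := p.1.val = 0 ∨ p.2.val = 0

theorem Step.not_onAxis {p q : Pt n} (h : Step n r p q) (hp : ¬ p.OnAxis) : ¬ q.OnAxis := by
  have := h.1
  simp only [Pt.OnAxis] at *
  omega

theorem Step.onAxis {p q : Pt n} (h : Step n r p q) (hq : q.OnAxis) : p.OnAxis := by
  by_contra hp
  exact h.not_onAxis hp hq


theorem isVertex_of_height_eq_zero {p : Pt n} (h : p.1.val + p.2.val = 0) : IsVertex n r p :=
  Or.inl (by omega)

theorem height_pos_of_not_isVertex {p : Pt n} (h : ¬ IsVertex n r p) : 0 < p.1.val + p.2.val := by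
  by_contra h0
  exact h (isVertex_of_height_eq_zero (by omega))

theorem exists_step_right (H : IsLadder n r) {p : Pt n} (h : InDiagram n r (p.1 + 1) p.2) :
    ∃ q, Step n r p q ∧ q.1.val = p.1.val + 1 ∧ q.2.val = p.2.val := by
  obtain ⟨q, h1, h2⟩ := exists_pt H h
  exact ⟨q, ⟨Or.inl ⟨h1, h2⟩, by rw [h1, h2]; exact h⟩, h1, h2⟩

theorem exists_step_up (H : IsLadder n r) {p : Pt n} (h : InDiagram n r p.1 (p.2 + 1)) :
    ∃ q, Step n r p q ∧ q.1.val = p.1.val ∧ q.2.val = p.2.val + 1 := by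
  obtain ⟨q, h1, h2⟩ := exists_pt H h
  exact ⟨q, ⟨Or.inr ⟨h1, h2⟩, by rw [h1, h2]; exact h⟩, h1, h2⟩

theorem exists_step_left_to {p : Pt n} (h : InDiagram n r p.1 p.2) (hx : 0 < p.1.val) :
    ∃ q, Step n r q p ∧ p.1.val = q.1.val + 1 ∧ p.2.val = q.2.val := by
  refine ⟨(⟨p.1.val - 1, by omega⟩, p.2), ⟨Or.inl ⟨?_, rfl⟩, h⟩, ?_, rfl⟩ <;> simp only <;> omega

theorem exists_step_below_to {p : Pt n} (h : InDiagram n r p.1 p.2) (hy : 0 < p.2.val) :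
    ∃ q, Step n r q p ∧ p.1.val = q.1.val ∧ p.2.val = q.2.val + 1 := by
  refine ⟨(p.1, ⟨p.2.val - 1, by omega⟩), ⟨Or.inr ⟨rfl, ?_⟩, h⟩, rfl, ?_⟩ <;> simp only <;> omega

theorem exists_step_from (H : IsLadder n r) {p : Pt n} (h : InDiagram n r p.1 p.2)
    (hV : ¬ IsVertex n r p) : ∃ q, Step n r p q := by
  have hp := height_pos_of_not_isVertex hV
  have key : InDiagram n r (p.1 + 1) p.2 ∨ InDiagram n r p.1 (p.2 + 1) := by
    obtain ⟨i, hi⟩ := id h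
    have h1 := H.pos i
    have h2 := H.lt i
    by_cases hx : p.1.val = 0
    · exact Or.inl ⟨i, by omega, hi.2⟩
    by_cases hy : p.2.val = 0
    · exact Or.inr ⟨i, hi.1, by omega⟩
    rw [isVertex_iff H hp h] at hV
    by_contra! hne
    exact hV ⟨by omega, by omega, fun h' => absurd h' hne.1, fun h' => absurd h' hne.2⟩
  rcases key with h' | h'
  · exact (exists_step_right H h').imp fun _ hq => hq.1
  · exact (exists_step_up H h').imp fun _ hq => hq.1

theorem exists_step_to {p : Pt n} (h : InDiagram n r p.1 p.2) (hp : 0 < p.1.val + p.2.val) :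
    ∃ q, Step n r q p := by
  by_cases hx : 0 < p.1.val
  · exact (exists_step_left_to h hx).imp fun _ hq => hq.1
  · exact (exists_step_below_to h (by omega)).imp fun _ hq => hq.1

/-- Two different steps would go right and up, and an off-axis point from which both are possible is
a vertex. -/
theorem Step.unique_from (H : IsLadder n r) {p q q' : Pt n} (hp : ¬ p.OnAxis)
    (hV : ¬ IsVertex n r p) (h : Step n r p q) (h' : Step n r p q') : q = q' := by
  rw [isVertex_iff H (height_pos_of_not_isVertex hV) h.inDiagram_left] at hV
  simp only [Pt.OnAxis] at hp
  have hne : ¬ (InDiagram n r (p.1 + 1) p.2 ∧ InDiagram n r p.1 (p.2 + 1)) :=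
    fun h' => hV ⟨by omega, by omega, fun _ => h'.2, fun _ => h'.1⟩
  obtain ⟨h1 | h1, h2⟩ := h <;> obtain ⟨h1' | h1', h2'⟩ := h'
  · exact Pt.ext_val (by omega) (by omega)
  · refine absurd ⟨?_, ?_⟩ hne
    · rw [← h1.1, ← h1.2]; exact h2
    · rw [← h1'.1, ← h1'.2]; exact h2'
  · refine absurd ⟨?_, ?_⟩ hne
    · rw [← h1'.1, ← h1'.2]; exact h2'
    · rw [← h1.1, ← h1.2]; exact h2
  · exact Pt.ext_val (by omega) (by omega)

theorem Step.unique_to {p q q' : Pt n} (hp : p.OnAxis) (h : Step n r q p) (h' : Step n r q' p) :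
    q = q' := by
  have h1 := h.1
  have h1' := h'.1
  simp only [Pt.OnAxis] at hp
  exact Pt.ext_val (by omega) (by omega)

theorem IsVertex.not_onAxis (H : IsLadder n r) {p : Pt n} (h : IsVertex n r p)
    (hp : 0 < p.1.val + p.2.val) : ¬ p.OnAxis := by
  have := (isVertex_iff H hp (h.inDiagram H)).mp h
  simp only [Pt.OnAxis]
  omega

/-- A point from which the diagram continues both to the right and up. -/
def Pt.IsFull (n : ℕ) {ρ : ℕ} (r : Fin ρ → ℕ) (p : Pt n) : Prop :=
  InDiagram n r (p.1 + 1) p.2 ∧ InDiagram n r p.1 (p.2 + 1)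

/-- The diagram is closed under decreasing coordinates, so the predecessor of a full point is full,
hence a vertex unless it is on an axis. -/
theorem Step.isVertex_or_onAxis (H : IsLadder n r) {p q : Pt n} (h : Step n r p q)
    (hq : Pt.IsFull n r q) : IsVertex n r p ∨ p.OnAxis := by
  by_contra! hne
  have hp := height_pos_of_not_isVertex hne.1
  have hne2 := hne.2
  simp only [Pt.OnAxis] at hne2
  have h1 := h.1
  refine hne.1 ((isVertex_iff H hp h.inDiagram_left).mpr ⟨by omega, by omega, ?_⟩)
  refine iff_of_true ?_ ?_
  · rcases h1 with h1 | h1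
    · exact hq.1.mono (by omega) (by omega)
    · exact hq.1.mono (by omega) (by omega)
  · rcases h1 with h1 | h1
    · exact hq.2.mono (by omega) (by omega)
    · exact hq.2.mono (by omega) (by omega)

theorem IsVertex.isFull_or_corner (H : IsLadder n r) {p : Pt n} (h : IsVertex n r p)
    (hp : 0 < p.1.val + p.2.val) :
    Pt.IsFull n r p ∨ ∃ i, p.1.val = n - r i ∧ p.2.val = r i := by
  obtain ⟨hx, hy, hiff⟩ := (isVertex_iff H hp (h.inDiagram H)).mp h
  by_cases hf : InDiagram n r (p.1 + 1) p.2
  · exact Or.inl ⟨hf, hiff.mp hf⟩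
  · right
    have hf' : ¬ InDiagram n r p.1 (p.2 + 1) := fun h' => hf (hiff.mpr h')
    obtain ⟨i, hi⟩ := h.inDiagram H
    refine ⟨i, ?_, ?_⟩
    · by_contra hne
      exact hf ⟨i, by omega, by omega⟩
    · by_contra hne
      exact hf' ⟨i, by omega, by omega⟩

theorem not_step_corner (H : IsLadder n r) {p q : Pt n} {i : Fin ρ}
    (hi : p.1.val = n - r i ∧ p.2.val = r i) : ¬ Step n r p q := by
  rintro ⟨h1, j, hj⟩
  have := H.lt i
  have := H.lt j
  omega

end Diagram

/-! ## Arrows and their critical edges -/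

section Arrows

variable {n : ℕ} {ρ : ℕ} {r : Fin ρ → ℕ}

theorem pairwise_height {l : List (Pt n)} (h : l.IsChain (Step n r)) :
    l.Pairwise fun p q => Pt.height n p < Pt.height n q := by
  have h1 : (l.map (Pt.height n)).IsChain (· < ·) := by
    rw [List.isChain_map]
    refine h.imp fun p q hpq => ?_
    have := hpq.height_eq
    omega
  exact List.pairwise_map.mp h1.pairwise

namespace Arrow

/-- The points of an arrow. -/
def pts (a : Arrow n r) : List (Pt n) := a.src.1 :: (a.mid ++ [a.tgt.1])

theorem pts_injective : Function.Injective (pts : Arrow n r → List (Pt n)) := by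
  intro a b h
  obtain ⟨h1, h2⟩ := List.cons_eq_cons.mp h
  obtain ⟨h3, h4⟩ := List.append_inj' h2 rfl
  exact Arrow.ext (Subtype.ext h1) h3 (Subtype.ext (List.singleton_inj.mp h4))

theorem height_lt (a : Arrow n r) : Pt.height n a.src.1 < Pt.height n a.tgt.1 :=
  List.rel_of_pairwise_cons (pairwise_height a.isChain) (by simp)

theorem tgt_pos (a : Arrow n r) : 0 < a.tgt.1.1.val + a.tgt.1.2.val :=
  lt_of_le_of_lt (Nat.zero_le _) a.height_lt

theorem tgt_ne_origin (a : Arrow n r) : a.tgt ≠ origin n r := by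
  intro h
  have := a.tgt_pos
  rw [h] at this
  simp [origin] at this

theorem firstHit (a : Arrow n r) : FirstHit (IsVertex n r) (Step n r) (a.mid ++ [a.tgt.1]) :=
  firstHit_of_isChain _ _ a.avoid a.tgt.2 a.isChain.tail

theorem firstHit_reverse (a : Arrow n r) :
    FirstHit (IsVertex n r) (flip (Step n r)) (a.mid.reverse ++ [a.src.1]) := by
  refine firstHit_of_isChain _ _ (fun p hp => a.avoid p (List.mem_reverse.mp hp)) a.src.2 ?_
  have h : (a.src.1 :: a.mid).IsChain (Step n r) := by
    have := a.isChain
    rw [← List.cons_append] at this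
    exact this.left_of_append
  rw [← List.reverse_cons, List.isChain_reverse]
  exact h

theorem firstHit_of_pts_eq {a : Arrow n r} {A B : List (Pt n)} {p q : Pt n}
    (h : a.pts = A ++ p :: q :: B) : FirstHit (IsVertex n r) (Step n r) (q :: B) := by
  -- The source is dropped, since as a vertex it would end a `FirstHit` chain at once; the case
  -- distinction records whether it was `p` itself.
  have h1 : a.mid ++ [a.tgt.1] = A.tail ++ (if A = [] then [] else [p]) ++ q :: B := by
    cases A with
    | nil => simpa using (List.cons_eq_cons.mp h).2
    | cons z A => simpa using (List.cons_eq_cons.mp h).2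
  have h2 := a.firstHit
  rw [h1] at h2
  exact h2.suffix

theorem firstHit_reverse_of_pts_eq {a : Arrow n r} {A B : List (Pt n)} {p q : Pt n}
    (h : a.pts = A ++ p :: q :: B) :
    FirstHit (IsVertex n r) (flip (Step n r)) (p :: A.reverse) := by
  have h0 : a.tgt.1 :: (a.mid.reverse ++ [a.src.1]) = B.reverse ++ q :: p :: A.reverse := by
    have := congrArg List.reverse h
    simpa [pts] using this
  have h1 : a.mid.reverse ++ [a.src.1] =
      B.reverse.tail ++ (if B.reverse = [] then [] else [q]) ++ p :: A.reverse := by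
    generalize B.reverse = C at h0
    cases C with
    | nil => simpa using (List.cons_eq_cons.mp h0).2
    | cons z A => simpa using (List.cons_eq_cons.mp h0).2
  have h2 := a.firstHit_reverse
  rw [h1] at h2
  exact h2.suffix

theorem step_of_pts_eq {a : Arrow n r} {A B : List (Pt n)} {p q : Pt n}
    (h : a.pts = A ++ p :: q :: B) : Step n r p q := by
  have h1 := a.isChain
  change a.pts.IsChain _ at h1
  rw [h] at h1
  exact (List.isChain_cons_cons.mp h1.right_of_append).1

theorem src_eq_of_pts_eq {a : Arrow n r} {A B : List (Pt n)} {p q : Pt n}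
    (h : a.pts = A ++ p :: q :: B) (hp : IsVertex n r p) : a.src.1 = p := by
  have h1 := (firstHit_reverse_of_pts_eq h).eq_nil hp
  rw [List.reverse_eq_nil_iff] at h1
  subst h1
  exact (List.cons_eq_cons.mp h).1

theorem tgt_eq_of_pts_eq {a : Arrow n r} {A B : List (Pt n)} {p q : Pt n}
    (h : a.pts = A ++ p :: q :: B) (hq : IsVertex n r q) : a.tgt.1 = q := by
  have h1 := (firstHit_of_pts_eq h).eq_nil hq
  subst h1
  have h2 := congrArg List.getLast? h
  simpa [pts, List.getLast?_cons, List.getLast?_append] using h2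

theorem exists_of_src (a : Arrow n r) : ∃ q B, a.pts = [] ++ a.src.1 :: q :: B := by
  cases h : a.mid with
  | nil => exact ⟨a.tgt.1, [], by simp [pts, h]⟩
  | cons z l => exact ⟨z, l ++ [a.tgt.1], by simp [pts, h]⟩

theorem exists_of_tgt (a : Arrow n r) : ∃ A p, a.pts = A ++ p :: a.tgt.1 :: [] := by
  rcases List.eq_nil_or_concat a.mid with h | ⟨l, z, h⟩
  · exact ⟨[], a.src.1, by simp [pts, h]⟩
  · exact ⟨a.src.1 :: l, z, by simp [pts, h]⟩

/-- Walk forward and backward from the edge until a vertex is met. The walks end because the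
coordinate sum is at most `n` in the diagram and a point of sum zero is a vertex. -/
theorem exists_of_step (H : IsLadder n r) {p q : Pt n} (h : Step n r p q) :
    ∃ (a : Arrow n r) (A B : List (Pt n)), a.pts = A ++ p :: q :: B := by
  obtain ⟨B, hB⟩ := exists_firstHit (V := IsVertex n r) (R := Step n r)
    (Q := fun p => InDiagram n r p.1 p.2) (fun p => n - Pt.height n p)
    (fun p hp hV => by
      obtain ⟨q, hq⟩ := exists_step_from H hp hV
      have h1 := hq.height_eq
      have h2 := hq.inDiagram.add_le H
      simp only [Pt.height] at *
      exact ⟨q, hq, hq.inDiagram, by omega⟩) q h.inDiagram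
  obtain ⟨A, hA⟩ := exists_firstHit (V := IsVertex n r) (R := flip (Step n r))
    (Q := fun p => InDiagram n r p.1 p.2) (fun p => Pt.height n p)
    (fun p hp hV => by
      obtain ⟨q, hq⟩ := exists_step_to hp (height_pos_of_not_isVertex hV)
      have h1 := hq.height_eq
      exact ⟨q, hq, hq.inDiagram_left, by omega⟩) p h.inDiagram_left
  obtain ⟨m, t, hmt, hm, ht⟩ := hB.exists_eq_append
  obtain ⟨m', s, hms, hm', hs⟩ := hA.exists_eq_append
  have hpts : s :: ((m'.reverse ++ m) ++ [t]) = A.reverse ++ p :: q :: B := by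
    have h1 := congrArg List.reverse hms
    rw [List.append_assoc, ← hmt, ← List.cons_append]
    simp only [List.reverse_cons, List.reverse_append, List.reverse_nil, List.nil_append,
      List.singleton_append] at h1
    rw [← h1]
    simp
  have hc : (A.reverse ++ p :: q :: B).IsChain (Step n r) := by
    have h1 : (A.reverse ++ [p]).IsChain (Step n r) := by
      have := hA.isChain
      rw [← List.reverse_cons, List.isChain_reverse]
      exact this
    rw [List.isChain_append] at h1 ⊢
    refine ⟨h1.1, List.isChain_cons_cons.mpr ⟨h, hB.isChain⟩, ?_⟩
    intro x hx y hy
    exact h1.2.2 x hx y (by simpa using hy)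
  refine ⟨⟨⟨s, hs⟩, m'.reverse ++ m, ⟨t, ht⟩, by rw [hpts]; exact hc, ?_⟩, A.reverse, B, hpts⟩
  intro z hz
  rcases List.mem_append.mp hz with hz | hz
  · exact hm' z (List.mem_reverse.mp hz)
  · exact hm z hz

/-- After a critical edge the path is off the axes, where non-vertices have only one successor.
Before it the path is at its source or on an axis, where there is only one predecessor. So the edge
determines the arrow. -/
theorem eq_of_critical (H : IsLadder n r) {p q : Pt n} (hp : IsVertex n r p ∨ p.OnAxis)
    (hq : ¬ q.OnAxis) {a b : Arrow n r} {A B A' B' : List (Pt n)}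
    (ha : a.pts = A ++ p :: q :: B) (hb : b.pts = A' ++ p :: q :: B') : a = b := by
  have h1 : B = B' := FirstHit.unique (V := IsVertex n r) (R := Step n r)
    (Q := fun z => ¬ z.OnAxis)
    (fun x y y' hx hV h h' => ⟨h.unique_from H hx hV h', h.not_onAxis hx⟩) hq
    (firstHit_of_pts_eq ha) (firstHit_of_pts_eq hb)
  have h2 : A.reverse = A'.reverse :=
    FirstHit.unique (V := IsVertex n r) (R := flip (Step n r))
      (Q := fun z => IsVertex n r z ∨ z.OnAxis)
      (fun x y y' hx hV h h' =>
        ⟨Step.unique_to (hx.resolve_left hV) h h', Or.inr (Step.onAxis h (hx.resolve_left hV))⟩) hp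
      (firstHit_reverse_of_pts_eq ha) (firstHit_reverse_of_pts_eq hb)
  rw [List.reverse_inj] at h2
  exact pts_injective (by rw [ha, hb, h1, h2])

/-- The target is a vertex other than the origin, hence off the axes. The first edge ending off the
axes starts at the source or on an axis. -/
theorem exists_critical (H : IsLadder n r) (a : Arrow n r) :
    ∃ A p q B, a.pts = A ++ p :: q :: B ∧ (IsVertex n r p ∨ p.OnAxis) ∧ ¬ q.OnAxis := by
  have key : ∀ (l : List (Pt n)) (p t : Pt n), (IsVertex n r p ∨ p.OnAxis) → ¬ t.OnAxis →
      ∃ A p' q' B, p :: (l ++ [t]) = A ++ p' :: q' :: B ∧ (IsVertex n r p' ∨ p'.OnAxis) ∧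
        ¬ q'.OnAxis := by
    intro l
    induction l with
    | nil => exact fun p t hp ht => ⟨[], p, t, [], rfl, hp, ht⟩
    | cons z l ih =>
      intro p t hp ht
      by_cases hz : z.OnAxis
      · obtain ⟨A, p', q', B, h, h'⟩ := ih z t (Or.inr hz) ht
        exact ⟨p :: A, p', q', B, by rw [List.cons_append, h]; rfl, h'⟩
      · exact ⟨[], p, z, l ++ [t], rfl, hp, hz⟩
  exact key a.mid a.src.1 a.tgt.1 (Or.inl a.src.2) (a.tgt.2.not_onAxis H a.tgt_pos)

end Arrow

/-! ### The anticanonical weight at full vertices and at corners. -/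

section Stability

open Classical in
-- Both edges leaving a full vertex other than the origin are critical, so each begins exactly one
-- arrow.
theorem card_src_of_isFull (H : IsLadder n r) (v : Vertex n r)
    (hv : 0 < v.1.1.val + v.1.2.val) (hf : Pt.IsFull n r v.1) :
    (Finset.univ.filter fun a : Arrow n r => a.src = v).card = 2 := by
  obtain ⟨q, hq, hq1⟩ := exists_step_right H hf.1
  obtain ⟨q', hq', hq1'⟩ := exists_step_up H hf.2
  obtain ⟨a, A, B, ha⟩ := Arrow.exists_of_step H hq
  obtain ⟨a', A', B', ha'⟩ := Arrow.exists_of_step H hq'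
  have hax := v.2.not_onAxis H hv
  refine Finset.card_eq_two.mpr ⟨a, a', ?_, ?_⟩
  · rintro rfl
    have h1 := (Arrow.firstHit_reverse_of_pts_eq ha).eq_nil v.2
    have h2 := (Arrow.firstHit_reverse_of_pts_eq ha').eq_nil v.2
    rw [List.reverse_eq_nil_iff] at h1 h2
    rw [ha, h1, h2] at ha'
    have h3 := (List.cons_eq_cons.mp (List.cons_eq_cons.mp ha').2).1
    rw [h3] at hq1
    omega
  · ext b
    simp only [Finset.mem_filter, Finset.mem_univ, true_and, Finset.mem_insert,
      Finset.mem_singleton]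
    constructor
    · rintro rfl
      obtain ⟨z, C, hb⟩ := b.exists_of_src
      have hz := Arrow.step_of_pts_eq hb
      rcases hz.1 with h | h
      · obtain rfl : z = q := Pt.ext_val (by omega) (by omega)
        exact Or.inl (Arrow.eq_of_critical H (Or.inl b.src.2) (hz.not_onAxis hax) hb ha)
      · obtain rfl : z = q' := Pt.ext_val (by omega) (by omega)
        exact Or.inr (Arrow.eq_of_critical H (Or.inl b.src.2) (hz.not_onAxis hax) hb ha')
    · rintro (rfl | rfl)
      · exact Subtype.ext (Arrow.src_eq_of_pts_eq ha v.2)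
      · exact Subtype.ext (Arrow.src_eq_of_pts_eq ha' v.2)

open Classical in
-- Both edges entering a full vertex are critical, by `Step.isVertex_or_onAxis`, so each ends
-- exactly one arrow.
theorem card_tgt_of_isFull (H : IsLadder n r) (v : Vertex n r)
    (hv : 0 < v.1.1.val + v.1.2.val) (hf : Pt.IsFull n r v.1) :
    (Finset.univ.filter fun a : Arrow n r => a.tgt = v).card = 2 := by
  have hax := v.2.not_onAxis H hv
  have hax' := hax
  simp only [Pt.OnAxis, not_or] at hax'
  have hD := v.2.inDiagram H
  obtain ⟨p, hp, hp1⟩ := exists_step_left_to hD (Nat.pos_of_ne_zero hax'.1)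
  obtain ⟨p', hp', hp1'⟩ := exists_step_below_to hD (Nat.pos_of_ne_zero hax'.2)
  obtain ⟨a, A, B, ha⟩ := Arrow.exists_of_step H hp
  obtain ⟨a', A', B', ha'⟩ := Arrow.exists_of_step H hp'
  refine Finset.card_eq_two.mpr ⟨a, a', ?_, ?_⟩
  · rintro rfl
    have h1 := (Arrow.firstHit_of_pts_eq ha).eq_nil v.2
    have h2 := (Arrow.firstHit_of_pts_eq ha').eq_nil v.2
    rw [ha, h1, h2] at ha'
    have h3 := (List.append_inj' ha' rfl).2
    have h4 := (List.cons_eq_cons.mp h3).1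
    rw [h4] at hp1
    omega
  · ext b
    simp only [Finset.mem_filter, Finset.mem_univ, true_and, Finset.mem_insert,
      Finset.mem_singleton]
    constructor
    · rintro rfl
      obtain ⟨C, z, hb⟩ := b.exists_of_tgt
      have hz := Arrow.step_of_pts_eq hb
      have hc := hz.isVertex_or_onAxis H hf
      rcases hz.1 with h | h
      · obtain rfl : z = p := Pt.ext_val (by omega) (by omega)
        exact Or.inl (Arrow.eq_of_critical H hc hax hb ha)
      · obtain rfl : z = p' := Pt.ext_val (by omega) (by omega)
        exact Or.inr (Arrow.eq_of_critical H hc hax hb ha')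
    · rintro (rfl | rfl)
      · exact Subtype.ext (Arrow.tgt_eq_of_pts_eq ha v.2)
      · exact Subtype.ext (Arrow.tgt_eq_of_pts_eq ha' v.2)

theorem node_pos (v : Node n r) : 0 < v.1.1.1.val + v.1.1.2.val := by
  by_contra h
  have h1 : (origin n r).1.1.val = 0 := rfl
  have h2 : (origin n r).1.2.val = 0 := rfl
  exact v.2 (Subtype.ext (Pt.ext_val (by omega) (by omega)))

theorem anticanonical_eq_zero (H : IsLadder n r) (v : Node n r) (hf : Pt.IsFull n r v.1.1) :
    anticanonical n r v = 0 := by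
  classical
  have h1 := card_src_of_isFull H v.1 (node_pos v) hf
  have h2 := card_tgt_of_isFull H v.1 (node_pos v) hf
  simp only [anticanonical, arrowWeight, Finset.sum_sub_distrib, Finset.sum_boole]
  rw [sub_eq_zero]
  norm_cast
  convert h2.trans h1.symm

theorem src_ne_corner (H : IsLadder n r) (a : Arrow n r) {i : Fin ρ} :
    ¬ (a.src.1.1.val = n - r i ∧ a.src.1.2.val = r i) := by
  intro h
  obtain ⟨q, B, hq⟩ := a.exists_of_src
  exact not_step_corner H h (Arrow.step_of_pts_eq hq)

theorem anticanonical_pos (H : IsLadder n r) (v : Node n r) {i : Fin ρ}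
    (hi : v.1.1.1.val = n - r i ∧ v.1.1.2.val = r i) : 0 < anticanonical n r v := by
  have h0 : ∀ a : Arrow n r, a.src ≠ v.1 := by
    rintro a h
    rw [← h] at hi
    exact src_ne_corner H a hi
  obtain ⟨q, hq⟩ := exists_step_to (v.1.2.inDiagram H) (node_pos v)
  obtain ⟨a, A, B, ha⟩ := Arrow.exists_of_step H hq
  have hat : a.tgt = v.1 := Subtype.ext (Arrow.tgt_eq_of_pts_eq ha v.1.2)
  refine Finset.sum_pos' (fun b _ => ?_) ⟨a, Finset.mem_univ a, ?_⟩
  · rw [arrowWeight, if_neg (h0 b)]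
    split_ifs <;> norm_num
  · rw [arrowWeight, if_neg (h0 a), if_pos hat]
    norm_num

end Stability

end Arrows

/-! ## The exponents of arrows determine flows -/

section Exponents

variable {n : ℕ} {ρ : ℕ} {r : Fin ρ → ℕ}

/-- A step to the right from `(x, y)` contributes the variable in row `x` and column `x + y`
(counted from zero). -/
def stepExponent (n : ℕ) {ρ : ℕ} (r : Fin ρ → ℕ) (p q : Pt n) : Entry n r →₀ ℕ :=
  Finsupp.equivFunOnFinite.symm fun x =>
    if q.1.val = p.1.val + 1 ∧ p.1.val = (ofLex x).1.val ∧ p.1.val + p.2.val = (ofLex x).2.val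
    then 1 else 0

theorem stepExponent_apply (p q : Pt n) (x : Entry n r) : stepExponent n r p q x =
    if q.1.val = p.1.val + 1 ∧ p.1.val = (ofLex x).1.val ∧ p.1.val + p.2.val = (ofLex x).2.val
    then 1 else 0 := rfl

/-- The sum of the contributions of the steps of an arrow. -/
def arrowExponent (n : ℕ) {ρ : ℕ} (r : Fin ρ → ℕ) (a : Arrow n r) : Entry n r →₀ ℕ :=
  pathSum (stepExponent n r) a.pts

/-- The number of arrows through the edges satisfying `P`, weighted by `Δ`. -/
def edgeFlow (Δ : Arrow n r → ℤ) (P : Pt n → Pt n → Prop) : ℤ :=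
  ∑ a, Δ a * pathSum (fun p q => propIndicator (P p q)) a.pts

variable {Δ : Arrow n r → ℤ}

theorem edgeFlow_congr {P P' : Pt n → Pt n → Prop}
    (h : ∀ p q, Step n r p q → (P p q ↔ P' p q)) : edgeFlow Δ P = edgeFlow Δ P' := by
  refine Finset.sum_congr rfl fun a _ => ?_
  congr 1
  exact pathSum_congr (fun p q hpq => congrArg propIndicator (propext (h p q hpq))) a.isChain

theorem edgeFlow_or {P P' : Pt n → Pt n → Prop} (h : ∀ p q, P p q → ¬ P' p q) :
    edgeFlow Δ (fun p q => P p q ∨ P' p q) = edgeFlow Δ P + edgeFlow Δ P' := by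
  simp only [edgeFlow]
  rw [← Finset.sum_add_distrib]
  refine Finset.sum_congr rfl fun a _ => ?_
  rw [← mul_add, ← pathSum_add]
  congr 2
  funext p q
  by_cases h1 : P p q
  · rw [propIndicator_of (Or.inl h1), propIndicator_of h1, propIndicator_of_not (h p q h1),
      add_zero]
  · rw [propIndicator_of_not h1, zero_add]
    exact congrArg propIndicator (propext (or_iff_right h1))

theorem edgeFlow_eq_zero {P : Pt n → Pt n → Prop} (h : ∀ p q, Step n r p q → ¬ P p q) :
    edgeFlow Δ P = 0 := by
  rw [edgeFlow_congr (P' := fun _ _ => False) fun p q hpq => iff_of_false (h p q hpq) not_false]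
  refine Finset.sum_eq_zero fun a _ => ?_
  have : ∀ l : List (Pt n), pathSum (fun _ _ => propIndicator (False)) l = 0 := by
    intro l
    induction l with
    | nil => rfl
    | cons p l ih =>
      cases l with
      | nil => rfl
      | cons q l => rw [pathSum_cons_cons, ih, propIndicator_of_not not_false, zero_add]
  exact (congrArg _ (this _)).trans (mul_zero _)

/-- The variable in row `i` and column `j` occurs only in the right step from the point (i, j - i),
so its exponent is the flow through that edge. Outside the range of the matrix there is no such
edge. -/
theorem edgeFlow_horizontal (H : IsLadder n r)
    (hexp : ∀ x, ∑ a, Δ a * (arrowExponent n r a x : ℤ) = 0) (i j : ℕ) :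
    edgeFlow Δ (fun p q => q.1.val = p.1.val + 1 ∧ p.1.val = i ∧ p.1.val + p.2.val = j) = 0 := by
  by_cases hij : i < numRows n r ∧ j < n
  · rw [← hexp (toLex (⟨i, hij.1⟩, ⟨j, hij.2⟩))]
    refine Finset.sum_congr rfl fun a _ => ?_
    congr 1
    have h := map_pathSum (stepExponent n r) ((Nat.castAddMonoidHom ℤ).comp
      (Finsupp.applyAddHom (M := ℕ) (toLex (⟨i, hij.1⟩, ⟨j, hij.2⟩) : Entry n r))) a.pts
    refine Eq.trans ?_ h.symm
    congr 1
    funext p q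
    simp only [AddMonoidHom.comp_apply, Finsupp.applyAddHom_apply, stepExponent_apply]
    split_ifs with h'
    · refine (propIndicator_of h').trans ?_
      exact Nat.cast_one.symm
    · refine (propIndicator_of_not h').trans ?_
      exact Nat.cast_zero.symm
  · refine edgeFlow_eq_zero fun p q hpq h => hij ?_
    have h0 := hpq.1
    have h1 := hpq.inDiagram.add_le H
    obtain ⟨k, hk⟩ := hpq.inDiagram
    have h2 := le_numRows n r k
    omega

/-- Along one arrow, entrances minus exits at `z` telescope to the contribution of its endpoints. At
a vertex this sums to the divergence, and elsewhere it is zero. -/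
theorem edgeFlow_conservation (hdiv : ∀ v, ∑ a, Δ a * arrowWeight n r a v = 0) (z : Pt n)
    (hz : 0 < z.1.val + z.2.val) :
    edgeFlow Δ (fun _ q => q = z) = edgeFlow Δ (fun p _ => p = z) := by
  rw [← sub_eq_zero]
  simp only [edgeFlow]
  rw [← Finset.sum_sub_distrib]
  have key : ∀ a : Arrow n r,
      pathSum (fun _ q : Pt n => propIndicator (q = z)) a.pts -
        pathSum (fun p _ : Pt n => propIndicator (p = z)) a.pts =
      propIndicator (a.tgt.1 = z) - propIndicator (a.src.1 = z) := by
    intro a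
    rw [sub_eq_iff_eq_add, Arrow.pts,
      ← pathSum_telescope (fun q : Pt n => propIndicator (q = z)), ← pathSum_add]
    simp only [sub_add_cancel]
  have hs : ∀ a : Arrow n r, Δ a * pathSum (fun _ q : Pt n => propIndicator (q = z)) a.pts -
      Δ a * pathSum (fun p _ : Pt n => propIndicator (p = z)) a.pts =
      Δ a * (propIndicator (a.tgt.1 = z) - propIndicator (a.src.1 = z)) := fun a => by
    rw [← mul_sub, key]
  refine (Finset.sum_congr rfl fun a _ => hs a).trans ?_
  by_cases hV : IsVertex n r z
  · have hne : (⟨z, hV⟩ : Vertex n r) ≠ origin n r := by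
      intro h
      have h1 : z = (origin n r).1 := congrArg Subtype.val h
      rw [h1] at hz
      simp [origin] at hz
    rw [← hdiv ⟨⟨z, hV⟩, hne⟩]
    refine Finset.sum_congr rfl fun a _ => ?_
    simp only [arrowWeight, Subtype.ext_iff, propIndicator]
    congr!
  · refine Finset.sum_eq_zero fun a _ => ?_
    rw [propIndicator_of_not, propIndicator_of_not, sub_zero, mul_zero]
    · exact fun h => hV (h ▸ a.src.2)
    · exact fun h => hV (h ▸ a.tgt.2)

theorem edgeFlow_vertical (H : IsLadder n r)
    (hdiv : ∀ v, ∑ a, Δ a * arrowWeight n r a v = 0)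
    (hexp : ∀ x, ∑ a, Δ a * (arrowExponent n r a x : ℤ) = 0) (x y : ℕ) :
    edgeFlow Δ (fun p q => q.1.val = p.1.val ∧ p.1.val = x ∧ p.2.val = y) = 0 := by
  -- Descending induction on the height `y` of the edge. At its upper end the horizontal edges carry
  -- no flow, so its flow equals that of the vertical edge above it.
  induction hd : n - y generalizing y with
  | zero =>
    refine edgeFlow_eq_zero fun p q hpq h => ?_
    have := hpq.1
    omega
  | succ d ih =>
    by_cases hx : n < x
    · refine edgeFlow_eq_zero fun p q hpq h => ?_
      omega
    · obtain ⟨z, hz1, hz2⟩ : ∃ z : Pt n, z.1.val = x ∧ z.2.val = y + 1 :=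
        ⟨(⟨x, by omega⟩, ⟨y + 1, by omega⟩), rfl, rfl⟩
      have hzero : edgeFlow Δ (fun p q => q.1.val = p.1.val + 1 ∧ q = z) = 0 := by
        rcases Nat.eq_zero_or_pos x with h0 | h0
        · refine edgeFlow_eq_zero fun p q _ h => ?_
          have := h.2 ▸ h.1
          omega
        · rw [← edgeFlow_horizontal H hexp (x - 1) (x + y)]
          refine edgeFlow_congr fun p q hpq => ?_
          have := hpq.1
          constructor
          · rintro ⟨h, rfl⟩
            omega
          · rintro ⟨h, h'⟩
            exact ⟨h, Pt.ext_val (by omega) (by omega)⟩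
      have h1 : edgeFlow Δ (fun _ q => q = z) =
          edgeFlow Δ (fun p q => q.1.val = p.1.val ∧ p.1.val = x ∧ p.2.val = y) := by
        rw [← add_zero (edgeFlow Δ fun p q => q.1.val = p.1.val ∧ p.1.val = x ∧ p.2.val = y),
          ← hzero, ← edgeFlow_or fun p q h h' => by omega]
        refine edgeFlow_congr fun p q hpq => ?_
        have := hpq.1
        constructor
        · rintro rfl
          rcases this with h | h
          · exact Or.inr ⟨h.1, rfl⟩
          · exact Or.inl (by omega)
        · rintro (h | h)
          · exact Pt.ext_val (by omega) (by omega)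
          · exact h.2
      have h2 : edgeFlow Δ (fun p _ => p = z) =
          edgeFlow Δ (fun p q => q.1.val = p.1.val ∧ p.1.val = x ∧ p.2.val = y + 1) := by
        rw [← add_zero (edgeFlow Δ fun p q => q.1.val = p.1.val ∧ p.1.val = x ∧ p.2.val = y + 1),
          ← edgeFlow_horizontal H hexp x (x + (y + 1)), ← edgeFlow_or fun p q h h' => by omega]
        refine edgeFlow_congr fun p q hpq => ?_
        have := hpq.1
        constructor
        · rintro rfl
          omega
        · rintro (h | h) <;> exact Pt.ext_val (by omega) (by omega)
      rw [← h1, edgeFlow_conservation hdiv z (by omega), h2]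
      exact ih (y + 1) (by omega)

/-- The flow through a critical edge of `a` vanishes, and only `a` passes through that edge. Applied
to the difference of two flows, this shows that exponents determine flows. -/
theorem eq_zero_of_arrowExponent (H : IsLadder n r)
    (hdiv : ∀ v, ∑ a, Δ a * arrowWeight n r a v = 0)
    (hexp : ∀ x, ∑ a, Δ a * (arrowExponent n r a x : ℤ) = 0) (a : Arrow n r) : Δ a = 0 := by
  obtain ⟨A, p, q, B, ha, hp, hq⟩ := a.exists_critical H
  have hpq := Arrow.step_of_pts_eq ha
  have h0 : edgeFlow Δ (fun x y => x = p ∧ y = q) = 0 := by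
    rcases hpq.1 with h | h
    · rw [← edgeFlow_horizontal H hexp p.1 (p.1 + p.2)]
      refine edgeFlow_congr fun x y hxy => ⟨?_, fun h' => ?_⟩
      · rintro ⟨rfl, rfl⟩
        exact ⟨h.1, rfl, rfl⟩
      · have := hxy.1
        exact ⟨Pt.ext_val (by omega) (by omega), Pt.ext_val (by omega) (by omega)⟩
    · rw [← edgeFlow_vertical H hdiv hexp p.1 p.2]
      refine edgeFlow_congr fun x y hxy => ⟨?_, fun h' => ?_⟩
      · rintro ⟨rfl, rfl⟩
        exact ⟨h.1, rfl, rfl⟩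
      · have := hxy.1
        exact ⟨Pt.ext_val (by omega) (by omega), Pt.ext_val (by omega) (by omega)⟩
  rw [edgeFlow, Finset.sum_eq_single a] at h0
  · refine (mul_eq_zero.mp h0).resolve_right ?_
    rw [ha]
    exact (pathSum_pos p q A B).ne'
  · intro b _ hb
    by_contra hne
    obtain ⟨A', B', hb'⟩ := exists_of_pathSum_ne_zero p q b.pts (right_ne_zero_of_mul hne)
    exact hb (Arrow.eq_of_critical H hp hq hb' ha)
  · exact fun h => absurd (Finset.mem_univ a) h

theorem totalExponent_arrowExponent_injective (H : IsLadder n r) (m : ℕ) (u w : Arrow n r →₀ ℕ)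
    (hu : IsFlow (arrowWeight n r) (anticanonical n r) m u)
    (hw : IsFlow (arrowWeight n r) (anticanonical n r) m w)
    (h : totalExponent (arrowExponent n r) u = totalExponent (arrowExponent n r) w) : u = w := by
  refine Finsupp.ext fun a => ?_
  have h0 := eq_zero_of_arrowExponent (Δ := fun a => (u a : ℤ) - w a) H (fun v => ?_) (fun x => ?_) a
  · omega
  · simp only [sub_mul, Finset.sum_sub_distrib]
    rw [hu v, hw v, sub_self]
  · have h1 := congrArg (fun f : Entry n r →₀ ℕ => (f x : ℤ)) h
    simp only [totalExponent, Finsupp.finsetSum_apply, Finsupp.smul_apply, smul_eq_mul,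
      Nat.cast_sum, Nat.cast_mul] at h1
    simp only [sub_mul, Finset.sum_sub_distrib]
    rw [h1, sub_self]

end Exponents

/-! ## Paths and flows -/

section Flows

variable {n : ℕ} {ρ : ℕ} {r : Fin ρ → ℕ}

/-- `PathTo p e`: there is a path in the diagram from the origin to `p` with exponent `e`. -/
inductive PathTo (n : ℕ) {ρ : ℕ} (r : Fin ρ → ℕ) : Pt n → (Entry n r →₀ ℕ) → Prop
  | start (p : Pt n) : p.1.val + p.2.val = 0 → PathTo n r p 0
  | step (p q : Pt n) (e : Entry n r →₀ ℕ) : PathTo n r p e → Step n r p q →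
      PathTo n r q (e + stepExponent n r p q)

theorem PathTo.append {p q : Pt n} {e : Entry n r →₀ ℕ} {l : List (Pt n)} (h : PathTo n r p e)
    (hl : (p :: (l ++ [q])).IsChain (Step n r)) :
    PathTo n r q (e + pathSum (stepExponent n r) (p :: (l ++ [q]))) := by
  induction l generalizing p e with
  | nil =>
    rw [List.nil_append, List.isChain_cons_cons] at hl
    rw [List.nil_append, pathSum_cons_cons, pathSum_singleton, add_zero]
    exact .step _ _ _ h hl.1
  | cons z l ih =>
    rw [List.cons_append, List.isChain_cons_cons] at hl
    rw [List.cons_append, pathSum_cons_cons, ← add_assoc]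
    exact ih (.step _ _ _ h hl.1) hl.2

theorem PathTo.arrow {a : Arrow n r} {e : Entry n r →₀ ℕ} (h : PathTo n r a.src.1 e) :
    PathTo n r a.tgt.1 (e + arrowExponent n r a) :=
  h.append a.isChain

/-- The net inflow of `u` at `v`. -/
def netInflow (u : Arrow n r →₀ ℕ) (v : Node n r) : ℤ := ∑ a, (u a : ℤ) * arrowWeight n r a v

theorem netInflow_add (u w : Arrow n r →₀ ℕ) (v : Node n r) :
    netInflow (u + w) v = netInflow u v + netInflow w v := by
  simp only [netInflow, Finsupp.add_apply, Nat.cast_add, add_mul, Finset.sum_add_distrib]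

theorem netInflow_single (a : Arrow n r) (v : Node n r) :
    netInflow (Finsupp.single a 1) v = arrowWeight n r a v := by
  classical
  rw [netInflow, Finset.sum_eq_single a]
  · rw [Finsupp.single_eq_same, Nat.cast_one, one_mul]
  · intro b _ hb
    rw [Finsupp.single_eq_of_ne hb, Nat.cast_zero, zero_mul]
  · exact fun h => absurd (Finset.mem_univ a) h

theorem totalExponent_add {E ι : Type} [Fintype E] (h : E → ι →₀ ℕ) (u w : E →₀ ℕ) :
    totalExponent h (u + w) = totalExponent h u + totalExponent h w := by
  simp only [totalExponent, Finsupp.add_apply, add_smul, Finset.sum_add_distrib]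

theorem totalExponent_zero {E ι : Type} [Fintype E] (h : E → ι →₀ ℕ) :
    totalExponent h 0 = 0 := by
  simp only [totalExponent, Finsupp.coe_zero, Pi.zero_apply, zero_smul, Finset.sum_const_zero]

theorem totalExponent_single {E ι : Type} [Fintype E] (h : E → ι →₀ ℕ) (a : E) :
    totalExponent h (Finsupp.single a 1) = h a := by
  classical
  rw [totalExponent, Finset.sum_eq_single a]
  · rw [Finsupp.single_eq_same, one_smul]
  · intro b _ hb
    rw [Finsupp.single_eq_of_ne hb, zero_smul]
  · exact fun h => absurd (Finset.mem_univ a) h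

open Classical in
-- The path is cut at the last vertex `s` visited: `u` counts the completed arrows and `l` lists the
-- points since `s`. A step into a vertex completes another arrow.
theorem PathTo.exists_partial_flow {p : Pt n} {e : Entry n r →₀ ℕ} (h : PathTo n r p e) :
    ∃ (s : Vertex n r) (l A : List (Pt n)) (u : Arrow n r →₀ ℕ),
      s.1 :: l = A ++ [p] ∧ (s.1 :: l).IsChain (Step n r) ∧ (∀ z ∈ l, ¬ IsVertex n r z) ∧
      (∀ w : Node n r, netInflow u w = if s = w.1 then 1 else 0) ∧
      e = totalExponent (arrowExponent n r) u + pathSum (stepExponent n r) (s.1 :: l) := by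
  induction h with
  | start p hp =>
    have hpo : (origin n r).1 = p :=
      Pt.ext_val (by change 0 = _; omega) (by change 0 = _; omega)
    refine ⟨origin n r, [], [], 0, by rw [hpo]; rfl, List.isChain_singleton _, by simp,
      fun w => ?_, ?_⟩
    · rw [if_neg w.2.symm]
      simp [netInflow]
    · rw [totalExponent_zero, pathSum_singleton, add_zero]
  | step p q e _ hpq ih =>
    obtain ⟨s, l, A, u, hA, hc, hl, hu, he⟩ := ih
    have hc' : (s.1 :: (l ++ [q])).IsChain (Step n r) := by
      rw [← List.cons_append, List.isChain_append]
      refine ⟨hc, List.isChain_singleton _, fun x hx y hy => ?_⟩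
      rw [hA, List.getLast?_concat, Option.mem_some_iff] at hx
      rw [List.head?_cons, Option.mem_some_iff] at hy
      rw [← hx, ← hy]
      exact hpq
    have hsum : pathSum (stepExponent n r) (s.1 :: (l ++ [q])) =
        pathSum (stepExponent n r) (s.1 :: l) + stepExponent n r p q := by
      rw [← List.cons_append, hA, List.append_assoc, ← pathSum_append_pair]
      rfl
    by_cases hq : IsVertex n r q
    · let a : Arrow n r := ⟨s, l, ⟨q, hq⟩, hc', hl⟩
      refine ⟨⟨q, hq⟩, [], [], u + Finsupp.single a 1, rfl, List.isChain_singleton _, by simp,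
        fun w => ?_, ?_⟩
      · rw [netInflow_add, netInflow_single, hu, arrowWeight]
        exact add_sub_cancel _ _
      · rw [totalExponent_add, totalExponent_single, pathSum_singleton, add_zero, he, add_assoc,
          ← hsum]
        rfl
    · refine ⟨s, l ++ [q], s.1 :: l, u, rfl, hc', fun z hz => ?_, hu, ?_⟩
      · rcases List.mem_append.mp hz with hz | hz
        · exact hl z hz
        · rw [List.mem_singleton.mp hz]
          exact hq
      · rw [he, hsum, add_assoc]

open Classical in
theorem PathTo.exists_flow {v : Node n r} {e : Entry n r →₀ ℕ} (h : PathTo n r v.1.1 e) :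
    ∃ u : Arrow n r →₀ ℕ, (∀ w, netInflow u w = if v = w then 1 else 0) ∧
      totalExponent (arrowExponent n r) u = e := by
  obtain ⟨s, l, A, u, hA, -, hl, hu, he⟩ := h.exists_partial_flow
  have hnil : l = [] := by
    by_contra hne
    have h1 : v.1.1 ∈ l := by
      have h2 := congrArg List.getLast? hA
      rw [List.getLast?_concat, List.getLast?_cons_of_ne_nil hne] at h2
      exact List.mem_of_getLast? h2
    exact hl _ h1 v.1.2
  subst hnil
  have hs : s = v.1 := by
    have h2 := congrArg List.getLast? hA
    rw [List.getLast?_concat] at h2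
    exact Subtype.ext (Option.some_injective _ h2)
  subst hs
  refine ⟨u, fun w => ?_, ?_⟩
  · rw [hu w]
    simp only [Subtype.ext_iff]
  · rw [he, pathSum_singleton, add_zero]

/-- An arrow of `u` with target of maximal height works: arrows increase height, so no arrow of `u`
leaves that target. -/
theorem exists_last_arrow (u : Arrow n r →₀ ℕ) (hu : u ≠ 0) :
    ∃ a, u a ≠ 0 ∧ 0 < netInflow u ⟨a.tgt, a.tgt_ne_origin⟩ := by
  classical
  obtain ⟨a, ha, hmax⟩ := u.support.exists_max_image (fun a => Pt.height n a.tgt.1)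
    (Finsupp.support_nonempty_iff.mpr hu)
  rw [Finsupp.mem_support_iff] at ha
  have hsrc : ∀ b, u b ≠ 0 → b.src ≠ a.tgt := by
    intro b hb h
    have h1 := b.height_lt
    have h2 := hmax b (Finsupp.mem_support_iff.mpr hb)
    rw [h] at h1
    omega
  refine ⟨a, ha, Finset.sum_pos' (fun b _ => ?_) ⟨a, Finset.mem_univ a, ?_⟩⟩
  · by_cases hb : u b = 0
    · rw [hb, Nat.cast_zero, zero_mul]
    · rw [arrowWeight, if_neg (hsrc b hb), sub_zero]
      split_ifs <;> positivity
  · rw [arrowWeight, if_neg (hsrc a ha), if_pos rfl, sub_zero, mul_one]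
    exact_mod_cast Nat.pos_of_ne_zero ha

open Classical in
-- Flow decomposition by removing a last arrow `a`. The net inflow stays nonnegative: it drops only
-- at the target, where it was positive. Extending by `a` a path which ends at the source of `a`
-- restores what was removed.
theorem exists_paths_of_netInflow_nonneg (u : Arrow n r →₀ ℕ) (hu : ∀ v, 0 ≤ netInflow u v) :
    ∃ T : Multiset (Node n r × (Entry n r →₀ ℕ)), (∀ t ∈ T, PathTo n r t.1.1.1 t.2) ∧
      (∀ v, (T.countP (fun t => t.1 = v) : ℤ) = netInflow u v) ∧
      (T.map Prod.snd).sum = totalExponent (arrowExponent n r) u := by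
  induction hd : u.degree generalizing u with
  | zero =>
    rw [Finsupp.degree_eq_zero_iff] at hd
    subst hd
    exact ⟨0, by simp, fun v => by simp [netInflow], by simp [totalExponent_zero]⟩
  | succ d ih =>
    have hne : u ≠ 0 := by
      rintro rfl
      simp at hd
    obtain ⟨a, ha, hpos⟩ := exists_last_arrow u hne
    obtain ⟨w, rfl⟩ : ∃ w, u = w + Finsupp.single a 1 := by
      refine ⟨u - Finsupp.single a 1, (tsub_add_cancel_of_le ?_).symm⟩
      rw [Finsupp.single_le_iff]
      omega
    have hnet : ∀ v, netInflow (w + Finsupp.single a 1) v = netInflow w v + arrowWeight n r a v :=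
      fun v => by rw [netInflow_add, netInflow_single]
    have hst : a.src ≠ a.tgt := by
      intro h
      have := a.height_lt
      rw [h] at this
      omega
    have hw : ∀ v, 0 ≤ netInflow w v := by
      intro v
      have h1 := hu v
      rw [hnet, arrowWeight] at h1
      by_cases hv : a.tgt = v.1
      · have hvv : v = ⟨a.tgt, a.tgt_ne_origin⟩ := Subtype.ext hv.symm
        subst hvv
        rw [hnet, arrowWeight, if_pos rfl, if_neg hst] at hpos
        omega
      · rw [if_neg hv] at h1
        split_ifs at h1 <;> omega
    have hdeg : w.degree = d := by
      rw [map_add, Finsupp.degree_single] at hd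
      omega
    obtain ⟨T, hT, hcount, hsum⟩ := ih w hw hdeg
    -- Without `a`, its source has one unit more of net inflow, hence at least one, so `T` contains
    -- a path ending there. If the source is the origin, the empty path is used instead.
    have key : ∃ (T₀ : Multiset (Node n r × (Entry n r →₀ ℕ))) (e : Entry n r →₀ ℕ),
        (∀ t ∈ T₀, PathTo n r t.1.1.1 t.2) ∧ PathTo n r a.src.1 e ∧
        (∀ v : Node n r, (T₀.countP (fun t => t.1 = v) : ℤ) =
          netInflow w v - if a.src = v.1 then 1 else 0) ∧
        (T₀.map Prod.snd).sum + e = totalExponent (arrowExponent n r) w := by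
      by_cases ho : a.src = origin n r
      · refine ⟨T, 0, hT, ?_, fun v => ?_, by rw [add_zero, hsum]⟩
        · rw [ho]
          exact .start _ rfl
        · rw [hcount, if_neg (fun h => v.2 (h.symm.trans ho)), sub_zero]
      · have h1 : 0 < netInflow w ⟨a.src, ho⟩ := by
          have h2 := hu ⟨a.src, ho⟩
          rw [hnet, arrowWeight, if_neg hst.symm, if_pos rfl] at h2
          omega
        rw [← hcount, Nat.cast_pos, Multiset.countP_pos] at h1
        obtain ⟨t, ht, hts⟩ := h1
        obtain ⟨T₀, rfl⟩ := Multiset.exists_cons_of_mem ht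
        refine ⟨T₀, t.2, fun t' ht' => hT t' (Multiset.mem_cons_of_mem ht'), ?_, fun v => ?_, ?_⟩
        · have := hT t ht
          rwa [hts] at this
        · rw [← hcount, Multiset.countP_cons, hts]
          simp only [Subtype.ext_iff]
          split_ifs <;> simp
        · rw [← hsum, Multiset.map_cons, Multiset.sum_cons, add_comm]
    obtain ⟨T₀, e, hT₀, he, hcount₀, hsum₀⟩ := key
    refine ⟨(⟨a.tgt, a.tgt_ne_origin⟩, e + arrowExponent n r a) ::ₘ T₀, fun t ht => ?_,
      fun v => ?_, ?_⟩
    · rcases Multiset.mem_cons.mp ht with rfl | ht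
      · exact he.arrow
      · exact hT₀ t ht
    · rw [hnet, Multiset.countP_cons, Nat.cast_add, hcount₀, arrowWeight]
      simp only [Subtype.ext_iff]
      push_cast
      ring
    · rw [Multiset.map_cons, Multiset.sum_cons, totalExponent_add, totalExponent_single, ← hsum₀,
        add_right_comm, add_comm e]

end Flows

/-! ## Initial terms of minors -/

section InitialTerms

variable {n : ℕ} {ρ : ℕ} {r : Fin ρ → ℕ}

/-- The exponent of the term of a minor which belongs to a permutation. -/
def minorExponent (i : Fin ρ) (σ : Columns n r i) (π : Equiv.Perm (Fin (n - r i))) :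
    Entry n r →₀ ℕ :=
  ∑ a, Finsupp.single (toLex (Fin.castLE (le_numRows n r i) a, σ (π a))) 1

theorem topMinor_eq_sum (i : Fin ρ) (σ : Columns n r i) :
    topMinor n r i σ = ∑ π : Equiv.Perm (Fin (n - r i)),
      MvPolynomial.monomial (minorExponent i σ π) ((Equiv.Perm.sign π : ℤ) : ℂ) := by
  rw [topMinor, ← Matrix.det_transpose, Matrix.det_apply']
  refine Finset.sum_congr rfl fun π _ => ?_
  have h : ∏ a, ((genericMatrix n r).submatrix (Fin.castLE (le_numRows n r i)) σ).transpose (π a) a =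
      MvPolynomial.monomial (minorExponent i σ π) (1 : ℂ) := by
    rw [minorExponent, MvPolynomial.monomial_sum_one]
    rfl
  rw [h, ← map_intCast (MvPolynomial.C (σ := Entry n r) (R := ℂ)), MvPolynomial.C_mul_monomial,
    mul_one]

theorem minorExponent_apply (i : Fin ρ) (σ : Columns n r i) (π : Equiv.Perm (Fin (n - r i)))
    (x : Entry n r) : minorExponent i σ π x =
      if ∃ a, toLex (Fin.castLE (le_numRows n r i) a, σ (π a)) = x then 1 else 0 := by
  classical
  rw [minorExponent, Finsupp.finsetSum_apply]
  simp only [Finsupp.single_apply]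
  split_ifs with h
  · obtain ⟨a, rfl⟩ := h
    rw [Finset.sum_eq_single a]
    · rw [if_pos rfl]
    · intro b _ hb
      refine if_neg fun h => hb ?_
      exact Fin.castLE_injective (le_numRows n r i) (Prod.ext_iff.mp (toLex_inj.mp h)).1
    · exact fun h => absurd (Finset.mem_univ a) h
  · exact Finset.sum_eq_zero fun a _ => if_neg fun h' => h ⟨a, h'⟩

/-- Let `b` be the first row moved by `π`; then `π b > b`. The two terms agree on all variables
before the diagonal one in row `b`, and only the diagonal term contains that variable. -/
theorem minorExponent_lt (i : Fin ρ) (σ : Columns n r i) (π : Equiv.Perm (Fin (n - r i)))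
    (hπ : π ≠ 1) : toLex (minorExponent i σ π) < toLex (minorExponent i σ 1) := by
  classical
  have hne : (Finset.univ.filter fun a => π a ≠ a).Nonempty := by
    by_contra h
    rw [Finset.not_nonempty_iff_eq_empty, Finset.filter_eq_empty_iff] at h
    exact hπ (Equiv.ext fun a => not_not.mp (h (Finset.mem_univ a)))
  obtain ⟨b, hb, hmin⟩ := Finset.exists_min_image _ id hne
  simp only [Finset.mem_filter, Finset.mem_univ, true_and, id] at hb hmin
  have hfix : ∀ a < b, π a = a := fun a ha => by
    by_contra h
    exact absurd (hmin a h) (not_le.mpr ha)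
  have hgt : b < π b := by
    refine lt_of_le_of_ne ?_ hb.symm
    by_contra h
    exact hb (π.injective (hfix _ (not_le.mp h)))
  refine Finsupp.Lex.lt_iff.mpr ⟨toLex (Fin.castLE (le_numRows n r i) b, σ b), fun x hx => ?_, ?_⟩
  · change minorExponent i σ π x = minorExponent i σ 1 x
    rw [minorExponent_apply, minorExponent_apply]
    congr 1
    refine propext (exists_congr fun a => ?_)
    rw [Prod.Lex.lt_iff] at hx
    constructor
    · rintro rfl
      simp only [ofLex_toLex] at hx
      rcases hx with h | ⟨h, h'⟩
      · rw [hfix a h, Equiv.Perm.one_apply]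
      · obtain rfl := Fin.castLE_injective (le_numRows n r i) h
        exact absurd (σ.strictMono hgt) (not_lt.mpr h'.le)
    · rintro rfl
      simp only [ofLex_toLex, Equiv.Perm.one_apply] at hx
      rcases hx with h | ⟨h, h'⟩
      · rw [hfix a h, Equiv.Perm.one_apply]
      · obtain rfl := Fin.castLE_injective (le_numRows n r i) h
        exact absurd h' (lt_irrefl _)
  · change minorExponent i σ π _ < minorExponent i σ 1 _
    rw [minorExponent_apply, minorExponent_apply, if_neg, if_pos]
    · exact zero_lt_one
    · exact ⟨b, rfl⟩
    · rintro ⟨a, ha⟩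
      obtain ⟨h1, h2⟩ := Prod.ext_iff.mp (toLex_inj.mp ha)
      obtain rfl := Fin.castLE_injective (le_numRows n r i) h1
      exact hb (σ.injective h2)

theorem initialExponent_eq (i : Fin ρ) (σ : Columns n r i) :
    initialExponent n r i σ = minorExponent i σ 1 := by
  classical
  have hcoeff : (topMinor n r i σ).coeff (minorExponent i σ 1) = 1 := by
    rw [topMinor_eq_sum, MvPolynomial.coeff_sum, Finset.sum_eq_single 1]
    · rw [MvPolynomial.coeff_monomial, if_pos rfl, Equiv.Perm.sign_one]
      simp
    · intro π _ hπ
      rw [MvPolynomial.coeff_monomial, if_neg]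
      intro h
      have := minorExponent_lt i σ π hπ
      rw [h] at this
      exact lt_irrefl _ this
    · exact fun h => absurd (Finset.mem_univ _) h
  have h1 : toLex (minorExponent i σ 1) ≤ toLex (initialExponent n r i σ) :=
    (MonomialOrder.lex (σ := Entry n r)).le_degree (MvPolynomial.mem_support_iff.mpr (by
      rw [hcoeff]
      exact one_ne_zero))
  have h2 : toLex (initialExponent n r i σ) ≤ toLex (minorExponent i σ 1) := by
    refine (MonomialOrder.lex (σ := Entry n r)).degree_le_iff.mpr fun e he => ?_
    rw [topMinor_eq_sum] at he
    obtain ⟨π, -, hπ⟩ := Finset.mem_biUnion.mp (MvPolynomial.support_sum he)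
    have he' := Finset.mem_singleton.mp (MvPolynomial.support_monomial_subset hπ)
    rw [he', MonomialOrder.lex_le_iff]
    by_cases h : π = 1
    · rw [h]
    · exact (minorExponent_lt i σ π h).le
  exact toLex_inj.mp (le_antisymm h2 h1)

theorem initialExponent_apply (i : Fin ρ) (σ : Columns n r i) (x : Entry n r) :
    initialExponent n r i σ x =
      if ∃ a, a.val = (ofLex x).1.val ∧ σ a = (ofLex x).2 then 1 else 0 := by
  rw [initialExponent_eq, minorExponent_apply]
  congr 1
  refine propext (exists_congr fun a => ?_)
  rw [← toLex_ofLex x, toLex_inj, Prod.ext_iff, Fin.ext_iff]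
  rfl

/-! ## Paths to the corners -/

/-- Here `s a` is the time of the right step leaving abscissa `a`. Times increase along the path,
which makes the columns increasing. -/
theorem PathTo.exists_columns {p : Pt n} {e : Entry n r →₀ ℕ} (h : PathTo n r p e) :
    ∃ s : ℕ → ℕ, (∀ a b, a < b → b < p.1.val → s a < s b) ∧
      (∀ a < p.1.val, s a < p.1.val + p.2.val) ∧
      ∀ x, e x = if (ofLex x).1.val < p.1.val ∧ s (ofLex x).1.val = (ofLex x).2.val
        then 1 else 0 := by
  induction h with
  | start p hp =>
    -- No row has been used yet, so any function would serve.
    refine ⟨id, fun a b _ _ => by omega, fun a ha => by omega, fun x => ?_⟩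
    rw [if_neg (by omega)]
    rfl
  | step p q e _ hpq ih =>
    obtain ⟨s, hs, hs', he⟩ := ih
    rcases hpq.1 with h | h
    · refine ⟨Function.update s p.1.val (p.1.val + p.2.val), fun a b hab hb => ?_, fun a ha => ?_,
        fun x => ?_⟩
      · rw [Function.update_of_ne (by omega)]
        by_cases hbp : b = p.1.val
        · rw [hbp, Function.update_self]
          exact hs' a (by omega)
        · rw [Function.update_of_ne hbp]
          exact hs a b hab (by omega)
      · by_cases hap : a = p.1.val
        · rw [hap, Function.update_self]
          omega
        · rw [Function.update_of_ne hap]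
          have := hs' a (by omega)
          omega
      · rw [Finsupp.add_apply, he, stepExponent_apply]
        by_cases hx : (ofLex x).1.val = p.1.val
        · rw [hx, Function.update_self, if_neg (by omega), zero_add]
          congr 1
          exact propext ⟨fun h' => ⟨by omega, h'.2.2⟩, fun h' => ⟨h.1, rfl, h'.2⟩⟩
        · rw [Function.update_of_ne hx, if_neg (c := _ ∧ p.1.val = _ ∧ _)
            fun h' => hx h'.2.1.symm, add_zero]
          congr 1
          exact propext ⟨fun h' => ⟨by omega, h'.2⟩, fun h' => ⟨by omega, h'.2⟩⟩
    · refine ⟨s, fun a b hab hb => hs a b hab (by omega), fun a ha => ?_, fun x => ?_⟩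
      · have := hs' a (by omega)
        omega
      · rw [Finsupp.add_apply, he, stepExponent_apply, if_neg (c := q.1.val = _ ∧ _) (by omega),
          add_zero, h.1]

theorem PathTo.exists_eq_initialExponent (H : IsLadder n r) {p : Pt n} {e : Entry n r →₀ ℕ}
    (h : PathTo n r p e) {i : Fin ρ} (hi : p.1.val = n - r i ∧ p.2.val = r i) :
    ∃ σ, e = initialExponent n r i σ := by
  obtain ⟨s, hs, hs', he⟩ := h.exists_columns
  have hlt := H.lt i
  refine ⟨OrderEmbedding.ofStrictMono (fun a => ⟨s a.val, ?_⟩) fun a b hab => ?_, ?_⟩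
  · have := hs' a.val (by have := a.2; omega)
    omega
  · exact hs _ _ hab (by have := b.2; omega)
  · ext x
    rw [he, initialExponent_apply]
    congr 1
    refine propext ⟨fun hx => ⟨⟨(ofLex x).1.val, by omega⟩, rfl, Fin.ext hx.2⟩, ?_⟩
    rintro ⟨a, ha, hax⟩
    have h1 := a.2
    have h2 := Fin.ext_iff.mp hax
    exact ⟨by omega, by rw [← ha]; exact h2⟩

/-- The number of columns before column `t`. -/
def columnsBefore {i : Fin ρ} (σ : Columns n r i) (t : ℕ) : ℕ :=
  (Finset.univ.filter fun a => (σ a).val < t).card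

theorem columnsBefore_le {i : Fin ρ} (σ : Columns n r i) (t : ℕ) : columnsBefore σ t ≤ n - r i :=
  (Finset.card_filter_le _ _).trans (by simp)

theorem columnsBefore_of_le {i : Fin ρ} (σ : Columns n r i) {t : ℕ} (ht : n ≤ t) :
    columnsBefore σ t = n - r i := by
  rw [columnsBefore, Finset.filter_true_of_mem, Finset.card_univ, Fintype.card_fin]
  exact fun a _ => lt_of_lt_of_le (σ a).2 ht

theorem columnsBefore_apply {i : Fin ρ} (σ : Columns n r i) (a : Fin (n - r i)) :
    columnsBefore σ (σ a).val = a.val := by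
  refine Eq.trans (congrArg Finset.card (Finset.ext fun b => ?_)) (Fin.card_Iio a)
  simp

theorem columnsBefore_succ_of_eq {i : Fin ρ} (σ : Columns n r i) (a : Fin (n - r i)) :
    columnsBefore σ ((σ a).val + 1) = a.val + 1 := by
  refine Eq.trans (congrArg Finset.card (Finset.ext fun b => ?_)) (Fin.card_Iic a)
  simp

theorem columnsBefore_succ_of_ne {i : Fin ρ} (σ : Columns n r i) {t : ℕ}
    (ht : ∀ a, (σ a).val ≠ t) : columnsBefore σ (t + 1) = columnsBefore σ t := by
  rw [columnsBefore, columnsBefore]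
  refine congrArg Finset.card (Finset.ext fun b => ?_)
  have := ht b
  simp only [Finset.mem_filter, Finset.mem_univ, true_and]
  omega

theorem columnsBefore_succ_le {i : Fin ρ} (σ : Columns n r i) (t : ℕ) :
    columnsBefore σ (t + 1) ≤ columnsBefore σ t + 1 := by
  by_cases h : ∃ a, (σ a).val = t
  · obtain ⟨a, rfl⟩ := h
    rw [columnsBefore_succ_of_eq, columnsBefore_apply]
  · rw [columnsBefore_succ_of_ne σ fun a ha => h ⟨a, ha⟩]
    exact Nat.le_succ _

theorem columnsBefore_add_le {i : Fin ρ} (σ : Columns n r i) (t s : ℕ) :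
    columnsBefore σ (t + s) ≤ columnsBefore σ t + s := by
  induction s with
  | zero => exact le_rfl
  | succ s ih => exact (columnsBefore_succ_le σ (t + s)).trans (Nat.succ_le_succ ih)

theorem columnsBefore_le_self {i : Fin ρ} (σ : Columns n r i) (t : ℕ) : columnsBefore σ t ≤ t := by
  have h := columnsBefore_add_le σ 0 t
  have h0 : columnsBefore σ 0 = 0 := by simp [columnsBefore]
  rw [zero_add, h0, zero_add] at h
  exact h

/-- At most `n - t` columns remain after time `t` while the final count is `n - r i`. This keeps the
path of `σ` below height `r i`. -/
theorem le_columnsBefore_add (H : IsLadder n r) {i : Fin ρ} (σ : Columns n r i) {t : ℕ}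
    (ht : t ≤ n) : t ≤ columnsBefore σ t + r i := by
  have h := columnsBefore_add_le σ t (n - t)
  rw [Nat.add_sub_cancel' ht, columnsBefore_of_le σ le_rfl] at h
  have := H.lt i
  omega

/-- The path of `σ` moves right at time `t` if `t` is one of its columns and up otherwise, so its
abscissa at time `t` is `columnsBefore σ t`. It stays inside the `i`-th grid. -/
theorem exists_pathTo_columns (H : IsLadder n r) {i : Fin ρ} (σ : Columns n r i) (t : ℕ)
    (ht : t ≤ n) : ∃ (p : Pt n) (e : Entry n r →₀ ℕ), PathTo n r p e ∧
      p.1.val = columnsBefore σ t ∧ p.1.val + p.2.val = t ∧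
      ∀ x, e x = if ∃ a, a.val = (ofLex x).1.val ∧ σ a = (ofLex x).2 ∧ (σ a).val < t
        then 1 else 0 := by
  induction t with
  | zero =>
    refine ⟨(0, 0), 0, .start _ rfl, by simp [columnsBefore], rfl, fun x => ?_⟩
    rw [if_neg]
    · rfl
    · rintro ⟨a, -, -, h⟩
      exact absurd h (Nat.not_lt_zero _)
  | succ t ih =>
    obtain ⟨p, e, hp, hp1, hp2, he⟩ := ih (by omega)
    have h1 := columnsBefore_le σ (t + 1)
    have h2 := columnsBefore_le_self σ (t + 1)
    have h3 := le_columnsBefore_add H σ ht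
    obtain ⟨q, hq1, hq2⟩ := exists_pt H (n := n) (r := r) (x := columnsBefore σ (t + 1))
      (y := t + 1 - columnsBefore σ (t + 1)) ⟨i, h1, by omega⟩
    have h4 := columnsBefore_le_self σ t
    by_cases h : ∃ a, (σ a).val = t
    · obtain ⟨a, ha⟩ := h
      have h5 : columnsBefore σ (t + 1) = a.val + 1 := by rw [← ha, columnsBefore_succ_of_eq]
      have h6 : columnsBefore σ t = a.val := by rw [← ha, columnsBefore_apply]
      have hpq : Step n r p q := ⟨Or.inl ⟨by omega, by omega⟩, i, by omega, by omega⟩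
      refine ⟨q, _, .step _ _ _ hp hpq, hq1, by omega, fun x => ?_⟩
      rw [Finsupp.add_apply, he, stepExponent_apply]
      by_cases hx : p.1.val = (ofLex x).1.val ∧ p.1.val + p.2.val = (ofLex x).2.val
      · rw [if_neg, if_pos ⟨by omega, hx⟩, if_pos]
        · exact ⟨a, by omega, Fin.ext (by omega), by omega⟩
        · rintro ⟨b, -, hb, hb'⟩
          have := Fin.ext_iff.mp hb
          omega
      · rw [if_neg (c := q.1.val = _ ∧ _) fun h' => hx h'.2, add_zero]
        congr 1
        refine propext (exists_congr fun b => and_congr_right fun hb => and_congr_right fun hb' =>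
          ⟨fun h' => by omega, fun h' => ?_⟩)
        by_contra hne
        have h7 : (σ b).val = t := by omega
        have h8 : b = a := σ.injective (Fin.ext (by omega))
        have h9 := Fin.ext_iff.mp hb'
        subst h8
        exact hx ⟨by omega, by omega⟩
    · have h5 := columnsBefore_succ_of_ne σ fun a ha => h ⟨a, ha⟩
      have hpq : Step n r p q := ⟨Or.inr ⟨by omega, by omega⟩, i, by omega, by omega⟩
      refine ⟨q, _, .step _ _ _ hp hpq, hq1, by omega, fun x => ?_⟩
      rw [Finsupp.add_apply, he, stepExponent_apply, if_neg (c := q.1.val = _ ∧ _) (by omega),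
        add_zero]
      congr 1
      refine propext (exists_congr fun b => and_congr_right fun _ => and_congr_right fun _ =>
        ⟨fun h' => by omega, fun h' => ?_⟩)
      have : (σ b).val ≠ t := fun hb => h ⟨b, hb⟩
      omega

theorem pathTo_initialExponent (H : IsLadder n r) {i : Fin ρ} (σ : Columns n r i) {p : Pt n}
    (hi : p.1.val = n - r i ∧ p.2.val = r i) : PathTo n r p (initialExponent n r i σ) := by
  obtain ⟨q, e, hq, hq1, hq2, he⟩ := exists_pathTo_columns H σ n le_rfl
  rw [columnsBefore_of_le σ le_rfl] at hq1
  have hlt := H.lt i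
  obtain rfl : p = q := Pt.ext_val (by omega) (by omega)
  have : e = initialExponent n r i σ := by
    ext x
    rw [he, initialExponent_apply]
    congr 1
    exact propext (exists_congr fun a => and_congr_right fun _ => and_iff_left (σ a).2)
  exact this ▸ hq

end InitialTerms

/-! ## The isomorphism -/

section Isomorphism

theorem multiExponent_zero {ι : Type} {k : ℕ} {N : Fin k → Type} (d : ∀ i, N i → ι →₀ ℕ) :
    multiExponent d 0 = 0 := by
  simp [multiExponent]

theorem multiExponent_add {ι : Type} {k : ℕ} {N : Fin k → Type} (d : ∀ i, N i → ι →₀ ℕ)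
    (a b : ∀ i, Multiset (N i)) :
    multiExponent d (a + b) = multiExponent d a + multiExponent d b := by
  simp only [multiExponent, Pi.add_apply, Multiset.map_add, Multiset.sum_add,
    Finset.sum_add_distrib]

theorem multiExponent_single {ι : Type} {k : ℕ} {N : Fin k → Type} (d : ∀ i, N i → ι →₀ ℕ)
    (i : Fin k) (b : N i) : multiExponent d (Pi.single i {b}) = d i b := by
  rw [multiExponent, Finset.sum_eq_single i]
  · simp
  · intro j _ hj
    simp [Pi.single_eq_of_ne hj]
  · exact fun h => absurd (Finset.mem_univ i) h

variable {n : ℕ} {ρ : ℕ} {r : Fin ρ → ℕ}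

/-- The top right corner of the `i`-th grid. -/
def corner (H : IsLadder n r) (i : Fin ρ) : Node n r :=
  ⟨⟨(⟨n - r i, by omega⟩, ⟨r i, Nat.lt_succ_of_lt (H.lt i)⟩), Or.inr (Or.inl ⟨i, rfl, rfl⟩)⟩,
    fun h => (H.pos i).ne' (congrArg (fun v : Vertex n r => v.1.2.val) h)⟩

theorem corner_injective (H : IsLadder n r) : Function.Injective (corner H) := fun _ _ h =>
  H.anti.injective (congrArg (fun v : Node n r => v.1.1.2.val) h)

theorem eq_corner (H : IsLadder n r) {v : Node n r} {i : Fin ρ}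
    (h : v.1.1.1.val = n - r i ∧ v.1.1.2.val = r i) : v = corner H i :=
  Subtype.ext (Subtype.ext (Pt.ext_val h.1 h.2))

theorem anticanonical_corner_pos (H : IsLadder n r) (i : Fin ρ) :
    0 < anticanonical n r (corner H i) :=
  anticanonical_pos H _ ⟨rfl, rfl⟩

theorem eq_zero_or_eq_corner (H : IsLadder n r) (v : Node n r) :
    anticanonical n r v = 0 ∨ ∃ i, v = corner H i := by
  rcases v.1.2.isFull_or_corner H (node_pos v) with h | ⟨i, hi⟩
  · exact Or.inl (anticanonical_eq_zero H v h)
  · exact Or.inr ⟨i, eq_corner H hi⟩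

theorem anticanonical_nonneg (H : IsLadder n r) (v : Node n r) : 0 ≤ anticanonical n r v := by
  rcases eq_zero_or_eq_corner H v with h | ⟨i, rfl⟩
  · exact h.ge
  · exact (anticanonical_corner_pos H i).le

open Classical in
theorem exists_family_of_paths (H : IsLadder n r) (T : Multiset (Node n r × (Entry n r →₀ ℕ)))
    (hT : ∀ t ∈ T, ∃ i σ, t.1 = corner H i ∧ t.2 = initialExponent n r i σ) :
    ∃ a : ∀ i, Multiset (Columns n r i),
      (∀ i, (a i).card = T.countP fun t => t.1 = corner H i) ∧
        multiExponent (initialExponent n r) a = (T.map Prod.snd).sum := by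
  induction T using Multiset.induction_on with
  | empty => exact ⟨0, fun i => by simp, by simp [multiExponent_zero]⟩
  | cons t T ih =>
    obtain ⟨a, ha, he⟩ := ih fun t ht => hT t (Multiset.mem_cons_of_mem ht)
    obtain ⟨i, σ, h1, h2⟩ := hT t (Multiset.mem_cons_self t T)
    refine ⟨a + Pi.single i {σ}, fun j => ?_, ?_⟩
    · rw [Pi.add_apply, Multiset.card_add, ha, Multiset.countP_cons, h1]
      congr 1
      by_cases hij : i = j
      · subst hij
        simp
      · rw [Pi.single_eq_of_ne (Ne.symm hij), if_neg fun h => hij (corner_injective H h)]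
        rfl
    · rw [multiExponent_add, multiExponent_single, he, Multiset.map_cons, Multiset.sum_cons, h2,
        add_comm]

/-- The multiplicity of the `i`-th corner in the anticanonical weight. -/
def cornerDegree (H : IsLadder n r) (i : Fin ρ) : ℕ := (anticanonical n r (corner H i)).toNat

theorem cornerDegree_cast (H : IsLadder n r) (i : Fin ρ) :
    (cornerDegree H i : ℤ) = anticanonical n r (corner H i) :=
  Int.toNat_of_nonneg (anticanonical_corner_pos H i).le

theorem exists_family_of_flow (H : IsLadder n r) (m : ℕ) (u : Arrow n r →₀ ℕ)
    (hu : IsFlow (arrowWeight n r) (anticanonical n r) m u) :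
    ∃ a : ∀ i, Multiset (Columns n r i), (∀ i, (a i).card = m * cornerDegree H i) ∧
      totalExponent (arrowExponent n r) u = multiExponent (initialExponent n r) a := by
  classical
  have hnet : ∀ v, netInflow u v = m * anticanonical n r v := hu
  obtain ⟨T, hT, hcount, hsum⟩ := exists_paths_of_netInflow_nonneg u fun v => by
    rw [hnet]
    exact mul_nonneg (Nat.cast_nonneg m) (anticanonical_nonneg H v)
  obtain ⟨a, ha, he⟩ := exists_family_of_paths H T fun t ht => by
    -- A vertex at which some path ends has positive net inflow, hence nonzero weight, so it is a
    -- corner.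
    have h1 : 0 < T.countP fun t' => t'.1 = t.1 := Multiset.countP_pos.mpr ⟨t, ht, rfl⟩
    have h2 : anticanonical n r t.1 ≠ 0 := by
      intro h
      have h3 := hcount t.1
      rw [hnet, h, mul_zero] at h3
      omega
    obtain ⟨i, hi⟩ := (eq_zero_or_eq_corner H t.1).resolve_left h2
    obtain ⟨σ, hσ⟩ := (hT t ht).exists_eq_initialExponent H (i := i) (by rw [hi]; exact ⟨rfl, rfl⟩)
    exact ⟨i, σ, hi, hσ⟩
  refine ⟨a, fun i => ?_, by rw [he, hsum]⟩
  have h1 := hcount (corner H i)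
  rw [hnet, ← cornerDegree_cast] at h1
  rw [ha]
  exact_mod_cast h1

/-- The net inflow, as a homomorphism. -/
def netInflowHom (v : Node n r) : (Arrow n r →₀ ℕ) →+ ℤ where
  toFun u := netInflow u v
  map_zero' := by simp [netInflow]
  map_add' u w := netInflow_add u w v

/-- The total exponent, as a homomorphism. -/
def totalExponentHom {E ι : Type} [Fintype E] (h : E → ι →₀ ℕ) : (E →₀ ℕ) →+ (ι →₀ ℕ) where
  toFun := totalExponent h
  map_zero' := totalExponent_zero h
  map_add' := totalExponent_add h

/-- Add up the unit flows of the paths attached to all members of the family. Only the paths to the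
`i`-th corner contribute net inflow there, one unit each, and none contribute at full vertices. -/
theorem exists_flow_of_family (H : IsLadder n r) (m : ℕ) (a : ∀ i, Multiset (Columns n r i))
    (ha : ∀ i, (a i).card = m * cornerDegree H i) :
    ∃ u, IsFlow (arrowWeight n r) (anticanonical n r) m u ∧
      totalExponent (arrowExponent n r) u = multiExponent (initialExponent n r) a := by
  classical
  choose F hF hF' using fun (i : Fin ρ) (σ : Columns n r i) =>
    (pathTo_initialExponent H σ (p := (corner H i).1.1) ⟨rfl, rfl⟩).exists_flow
  refine ⟨∑ i, ((a i).map (F i)).sum, fun v => ?_, ?_⟩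
  · have h1 : ∀ i, netInflowHom v ((a i).map (F i)).sum =
        if corner H i = v then (m : ℤ) * anticanonical n r v else 0 := by
      intro i
      rw [map_multiset_sum, Multiset.map_map]
      have h2 : (fun σ => (netInflowHom v ∘ F i) σ) =
          fun _ => if corner H i = v then (1 : ℤ) else 0 := by
        funext σ
        exact hF i σ v
      rw [Multiset.map_congr rfl fun σ _ => congrFun h2 σ, Multiset.map_const', Multiset.sum_replicate,
        ha, nsmul_eq_mul]
      split_ifs with h
      · rw [mul_one, Nat.cast_mul, cornerDegree_cast, h]
      · rw [mul_zero]
    change netInflowHom v _ = _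
    rw [map_sum, Finset.sum_congr rfl fun i _ => h1 i]
    rcases eq_zero_or_eq_corner H v with h | ⟨j, rfl⟩
    · rw [h, mul_zero]
      exact Finset.sum_eq_zero fun i _ => ite_self _
    · rw [Finset.sum_eq_single j]
      · rw [if_pos rfl]
      · intro i _ hij
        exact if_neg fun h => hij (corner_injective H h)
      · exact fun h => absurd (Finset.mem_univ j) h
  · change totalExponentHom _ _ = _
    rw [map_sum, multiExponent]
    refine Finset.sum_congr rfl fun i _ => ?_
    rw [map_multiset_sum, Multiset.map_map]
    congr 1
    exact Multiset.map_congr rfl fun σ _ => hF' i σ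

/-- The ring of semi-invariants of the ladder quiver has a basis of monomials which correspond to
the products of initial terms of Plücker coordinates. -/
def ladderModel (H : IsLadder n r) :
    MonomialModel (A := semiInvariantRing (arrowWeight n r) (anticanonical n r))
      (initialExponent n r) (semiInvariantGrading (arrowWeight n r) (anticanonical n r)) :=
  flowModel (initialExponent n r) (arrowWeight n r) (anticanonical n r) (arrowExponent n r)
    (cornerDegree H)
    (fun i => by
      have h1 := cornerDegree_cast H i
      have h2 := anticanonical_corner_pos H i
      omega)
    (fun m u w hu hw h => totalExponent_arrowExponent_injective H m u w hu hw h)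
    (fun m u hu => exists_family_of_flow H m u hu)
    (fun m a ha => exists_flow_of_family H m a ha)

theorem nonempty_iso_ladderVariety (H : IsLadder n r) :
    Nonempty (degenerateFlagVariety n r ≅ ladderVariety n r) :=
  (ladderModel H).toricAtlas.nonempty_iso

end Isomorphism

end LadderToric

end

theorem mainTheorem4 (n ρ : ℕ) (hρ : 0 < ρ) (r : Fin ρ → ℕ) (hr : StrictAnti r)
    (hr_pos : ∀ i, 0 < r i) (hr_lt : ∀ i, r i < n) :
    Nonempty (LadderToric.degenerateFlagVariety n r ≅ LadderToric.ladderVariety n r) :=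
  LadderToric.nonempty_iso_ladderVariety ⟨hρ, hr, hr_pos, hr_lt⟩
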